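/- **Divide & conquer.** Let $a\ge 1$ be an integer and $b>1$ a real number (constants), let $n_0\ge 1$ and let $T_{\mathrm{aux}}:\mathbb R\to\{1,2,\dots\}$ be a known function. Consider a divide & conquer procedure with disjunctive combining whose instances are described by bit strings $u\in\{0,1\}^W$. An instance $u$ of size $m>n_0$ is partitioned into $a$ subproblems $u_1,\dots,u_a$ of size $m/b$, and its answer is the OR of the answers of $u_1,\dots,u_a$. Each $u_i$ is computed exactly by a sequence of $T_{\mathrm{aux}}(m)$ steps, which are unitaries on a $W$-qubit work register (depending on $u$ and $i$): if $|v_0\rangle=|0\cdots0\rangle$ and $|v_{t+1}\rangle$ results from the $(t+1)$-st step on $|v_t\rangle$, then $|v_{T_{\mathrm{aux}}(m)}\rangle=|u_i\rangle$. Instances of size at most $n_0$ are base cases; a base case with positive answer is called marked. Let $T_{\mathrm Q}:\mathbb R\to\mathbb R$ satisfy $T_{\mathrm Q}(x)\ge 1$ for $x\le n_0$ and $$T_{\mathrm Q}(x)=\sqrt a\,T_{\mathrm Q}(x/b)+T_{\mathrm{aux}}(x)\qquad (x>n_0).$$ **Model.** A circuit has its own qubits, initially $0$, and an array of $W$-qubit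 work registers numbered $0,1,\dots$; register $0$ initially holds the input instance $r$ and the others hold $0\cdots 0$. Its gates are arbitrary one- and two-qubit gates on its own qubits, the quantum random access gates $$|i\rangle|c\rangle|x_1,\dots,x_M\rangle\mapsto|i\rangle|x_i\rangle|x_1,\dots,x_{i-1},c,x_{i+1},\dots,x_M\rangle$$ on its own qubits, and calls of two oracles, which are addressed in superposition by a level $k$: the step oracle $|u\rangle|i\rangle|v_t\rangle|t\rangle\mapsto|u\rangle|i\rangle|v_{t+1}\rangle|t+1\rangle$ (and its inverse), where $u$ is in work register $k-1$ and $v_t$ in work register $k$, and the marking oracle $|v\rangle|c\rangle\mapsto|v\rangle|c\oplus\mathbb 1[v\text{ is marked}]\rangle$, where $v$ is in work register $k$. At the end one qubit is measured. The query complexity is the number of oracle calls, and the time complexity is the total number of gates, each gate and each oracle call counting as one. **Theorem.** For all $a\ge1$ and $b>1$ there are constants $C,d$, depending only on $a$ and $b$, such that for all $n_0$, $T_{\mathrm{aux}}$, $T_{\mathrm Q}$ as above and every size $n\ge 2$ there is a circuit (depending only on these data, and not on $W$, the procedure or the input) with query complexity at most $$C\,T_{\mathrm Q}(n)\sqrt{\log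 n}$$ and time complexity at most $$C\,T_{\mathrm Q}(n)\,\bigl(\log(n\,T_{\mathrm Q}(n))\bigr)^{d}=\widetilde O(T_{\mathrm Q}(n)),$$ that solves the problem with bounded error: for every $W$, every divide & conquer procedure as above and every instance $r$ of size $n$, it accepts $r$ with probability at least $2/3$ if the answer of $r$ is positive, and with probability at most $1/3$ if it is negative. -/

import Mathlib

open scoped Matrix

noncomputable section

/-- Bit strings of length `W`: descriptions of problem instances, which are also the
computational basis states of a work register of `W` qubits. -/
abbrev Desc (W : ℕ) : Type := Fin W → Bool

/-- The state of a work register that starts in `|0…0⟩` and to which the steps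
`V 0, V 1, …, V (t - 1)` have been applied. -/
def runSteps {W : ℕ} (V : ℕ → Matrix (Desc W) (Desc W) ℂ) : ℕ → (Desc W → ℂ)
  | 0 => Pi.single (fun _ => false) 1
  | t + 1 => V t *ᵥ runSteps V t

/-- Divide & conquer with disjunctive combining.  An instance of size `m > n₀` is partitioned
into `a` subproblems of size `m / b` by an exact (classical or quantum) procedure making
`Taux m` steps, and its answer is the OR of their answers.  Instances of size at most `n₀`
are the base cases.  -/
structure OrDivideConquer (a : ℕ) (b n₀ : ℝ) (Taux : ℝ → ℕ) (W : ℕ) where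
  /-- The size of an instance. -/
  size : Desc W → ℝ
  /-- The Boolean answer of an instance. -/
  answer : Desc W → Bool
  /-- The `i`-th subproblem of an instance. -/
  sub : Desc W → Fin a → Desc W
  size_sub : ∀ u, n₀ < size u → ∀ i, size (sub u i) = size u / b
  answer_eq_or : ∀ u, n₀ < size u → (answer u = true ↔ ∃ i, answer (sub u i) = true)
  /-- `step u i t` is the `t`-th step of the procedure that computes the `i`-th subproblem
  of `u` in a work register; nothing is known about it for `i ≥ a`, or after the last step. -/
  step : Desc W → ℕ → ℕ → Matrix.unitaryGroup (Desc W) ℂ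
  /-- After `Taux (size u)` steps the work register holds exactly the `i`-th subproblem. -/
  step_exact : ∀ u, n₀ < size u → ∀ i : Fin a,
    runSteps (fun t => (step u i t : Matrix (Desc W) (Desc W) ℂ)) (Taux (size u)) =
      Pi.single (sub u i) 1

/-- The marked instances: base cases whose answer is `true`. -/
def OrDivideConquer.marked {a : ℕ} {b n₀ : ℝ} {Taux : ℝ → ℕ} {W : ℕ}
    (P : OrDivideConquer a b n₀ Taux W) (u : Desc W) : Bool :=
  open Classical in decide (P.size u ≤ n₀ ∧ P.answer u = true)

/-! ### Circuits in the QRAM model -/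

/-- Computational basis states of a machine with `N` qubits of its own and an array of `K`
work registers of `W` qubits each. -/
abbrev Config (N K W : ℕ) : Type := (Fin N → Bool) × (Fin K → Desc W)

/-- The number stored in binary (least significant bit first) in the register formed by the
qubits `r 0, r 1, …`. -/
def regVal {N l : ℕ} (r : Fin l → Fin N) (x : Fin N → Bool) : ℕ :=
  ∑ i, if x (r i) then 2 ^ (i : ℕ) else 0

/-- Overwrite the register `r` by the number `v` (modulo `2 ^ l`). -/
def regWrite {N l : ℕ} (r : Fin l ↪ Fin N) (v : ℕ) (x : Fin N → Bool) : Fin N → Bool :=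
  Function.extend r (fun i => v.testBit i) x

/-- Gates of a circuit with `N` qubits and `K` work registers: arbitrary one- and two-qubit
gates, quantum random access gates, and calls of the two oracles. -/
inductive Gate (N K : ℕ) : Type
  /-- A one-qubit gate. -/
  | one (q : Fin N) (U : Matrix.unitaryGroup Bool ℂ)
  /-- A two-qubit gate. -/
  | two (p q : Fin N) (hpq : p ≠ q) (U : Matrix.unitaryGroup (Bool × Bool) ℂ)
  /-- The QRAG gate `|i⟩|b⟩|x₀,…,x_{m-1}⟩ ↦ |i⟩|xᵢ⟩|x₀,…,b,…,x_{m-1}⟩`, with address register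
  `addr`, data qubit `data` and memory `cells`. -/
  | qrag {l m : ℕ} (addr : Fin l → Fin N) (data : Fin N) (cells : Fin m ↪ Fin N)
      (h₁ : ∀ i, addr i ≠ data) (h₂ : ∀ i j, addr i ≠ cells j) (h₃ : ∀ j, data ≠ cells j)
  /-- A call of the step oracle (`inv = false`) or of its inverse (`inv = true`). -/
  | step {lk li lt : ℕ} (inv : Bool) (level : Fin lk → Fin N) (idx : Fin li → Fin N)
      (time : Fin lt ↪ Fin N) (h₁ : ∀ i j, level i ≠ time j) (h₂ : ∀ i j, idx i ≠ time j)
  /-- A call of the marking oracle. -/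
  | mark {lk : ℕ} (level : Fin lk → Fin N) (target : Fin N) (h : ∀ i, level i ≠ target)

/-- The matrix `|x⟩ ↦ |f x⟩` of a reversible operation. -/
def basisMatrix {X : Type} [DecidableEq X] (f : X → X) : Matrix X X ℂ :=
  Matrix.of fun y x => if y = f x then 1 else 0

/-- The matrix of a one-qubit gate. -/
def oneMatrix {N K W : ℕ} (q : Fin N) (U : Matrix Bool Bool ℂ) :
    Matrix (Config N K W) (Config N K W) ℂ :=
  Matrix.of fun y x =>
    if (∀ s, s ≠ q → y.1 s = x.1 s) ∧ y.2 = x.2 then U (y.1 q) (x.1 q) else 0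

/-- The matrix of a two-qubit gate. -/
def twoMatrix {N K W : ℕ} (p q : Fin N) (U : Matrix (Bool × Bool) (Bool × Bool) ℂ) :
    Matrix (Config N K W) (Config N K W) ℂ :=
  Matrix.of fun y x =>
    if (∀ s, s ≠ p → s ≠ q → y.1 s = x.1 s) ∧ y.2 = x.2 then
      U (y.1 p, y.1 q) (x.1 p, x.1 q) else 0

/-- The QRAG operation on basis states; nothing happens if the address is out of range. -/
def qragMap {N K W l m : ℕ} (addr : Fin l → Fin N) (data : Fin N) (cells : Fin m ↪ Fin N)
    (x : Config N K W) : Config N K W :=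
  if h : regVal addr x.1 < m then
    (fun s => x.1 (Equiv.swap data (cells ⟨regVal addr x.1, h⟩) s), x.2)
  else x

section

variable {a : ℕ} {b n₀ : ℝ} {Taux : ℝ → ℕ} {W : ℕ}

/-- The step oracle `|u⟩|i⟩|v_t⟩|t⟩ ↦ |u⟩|i⟩|v_{t+1}⟩|t+1⟩`, applied in superposition over the
level `k`: the description `u` of the parent is in work register `k - 1` and the child is being
computed in work register `k`.  It is the identity if `k = 0` or `k ≥ K`. -/
def stepMatrix (P : OrDivideConquer a b n₀ Taux W) {N K lk li lt : ℕ} (level : Fin lk → Fin N)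
    (idx : Fin li → Fin N) (time : Fin lt ↪ Fin N) :
    Matrix (Config N K W) (Config N K W) ℂ :=
  Matrix.of fun y x =>
    if h : 0 < regVal level x.1 ∧ regVal level x.1 < K then
      if y.1 = regWrite time (regVal time x.1 + 1) x.1 ∧
          ∀ j : Fin K, (j : ℕ) ≠ regVal level x.1 → y.2 j = x.2 j then
        (P.step (x.2 ⟨regVal level x.1 - 1, by omega⟩) (regVal idx x.1) (regVal time x.1) :
            Matrix (Desc W) (Desc W) ℂ)
          (y.2 ⟨regVal level x.1, h.2⟩) (x.2 ⟨regVal level x.1, h.2⟩)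
      else 0
    else if y = x then 1 else 0

/-- The marking oracle `|v⟩|c⟩ ↦ |v⟩|c ⊕ [v is marked]⟩`, where `v` is in work register `k`. -/
def markMap (P : OrDivideConquer a b n₀ Taux W) {N K lk : ℕ} (level : Fin lk → Fin N)
    (target : Fin N) (x : Config N K W) : Config N K W :=
  if h : regVal level x.1 < K then
    (Function.update x.1 target (xor (x.1 target) (P.marked (x.2 ⟨regVal level x.1, h⟩))), x.2)
  else x

/-- The matrix of a gate. -/
def Gate.toMatrix (P : OrDivideConquer a b n₀ Taux W) {N K : ℕ} :
    Gate N K → Matrix (Config N K W) (Config N K W) ℂ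
  | .one q U => oneMatrix q U
  | .two p q _ U => twoMatrix p q U
  | .qrag addr data cells _ _ _ => basisMatrix (qragMap addr data cells)
  | .step false level idx time _ _ => stepMatrix P level idx time
  | .step true level idx time _ _ => (stepMatrix P level idx time)ᴴ
  | .mark level target _ => basisMatrix (markMap P level target)

/-- The matrix of a circuit, whose gates are applied from the head of the list on. -/
def circuitMatrix (P : OrDivideConquer a b n₀ Taux W) {N K : ℕ} :
    List (Gate N K) → Matrix (Config N K W) (Config N K W) ℂ
  | [] => 1
  | g :: c => circuitMatrix P c * g.toMatrix P

/-- The initial basis state on input `r`: all qubits are `0`, except that work register `0`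
holds `r`. -/
def initConfig {N K W : ℕ} (r : Desc W) : Config N K W :=
  (fun _ => false, fun k => if (k : ℕ) = 0 then r else fun _ => false)

/-- The probability that, on input `r`, the qubit `out` is measured as `1` at the end. -/
def acceptProb (P : OrDivideConquer a b n₀ Taux W) {N K : ℕ} (c : List (Gate N K))
    (out : Fin N) (r : Desc W) : ℝ :=
  ∑ y : Config N K W with y.1 out = true, ‖circuitMatrix P c y (initConfig r)‖ ^ 2

end

/-- Is the gate a call of one of the oracles? -/
def Gate.isQuery {N K : ℕ} : Gate N K → Bool
  | .step _ _ _ _ _ _ => true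
  | .mark _ _ _ => true
  | _ => false

/-- Query complexity: the number of calls of the step oracle, of its inverse and of the marking
oracle. -/
def queryCount {N K : ℕ} (c : List (Gate N K)) : ℕ := c.countP Gate.isQuery

/-- Time complexity: the total number of gates, where every one- or two-qubit gate, every QRAG
gate and every oracle call counts as one. -/
def timeCount {N K : ℕ} (c : List (Gate N K)) : ℕ := c.length

end

/-! ### Unitarity of the gates -/

section Unitarity

variable {N K W : ℕ}

/-! The recursion tree is searched by a quantum walk. An edge below a node at level `j` has length
`L (j + 1)`, the number of steps of the procedure that computes the child: a particle moving down
performs these steps, a particle moving up undoes them. At an inner node the amplitudes at the ports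
are reflected, the vector (1, a^(-1/4), …, a^(-1/4)) being negated (parent first, then the
children). At a leaf the sign changes unless the leaf is marked.

The core is a stationary wave (`IsWave`, `exists_isWave`). Below a node with answer v there is a
state of the subtree that an iteration reproduces if unit amplitude enters from above; unit
amplitude then leaves, with sign + for a positive and - for a negative answer. It is built from the
leaves upwards. At a positive node the wave enters a single positive child with amplitude -a^(1/4):
the port vector is orthogonal to the negated direction, hence fixed. At a negative node it enters
all children equally, with the port vector in the negated direction. In both cases the squared
amplitudes of the children sum to √a (`exists_amplitudes`), so the squared norm E of the wave obeys
E(x) = √a (2 Taux(x) + E(x/b)) up to an inequality. Twice √a TQ satisfies this.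

Outside the tree there are 2^κ time slots in uniform superposition and a control qubit in (|0⟩ +
|1⟩)/√2. Iteration τ lets only slot τ with control 1 pass through the root. Were the wave present
from the start, every slot would just acquire the sign (`run_loop`), and a final rotation would turn
the control qubit into the answer. The actual start lacks the wave, an error that unitarity keeps at
its initial size: its squared norm is at most 2 E(n) / 2^κ, which is at most 1/3 once 2^κ is a
suitable multiple of TQ(n) (`wrong_prob_le`).

An iteration makes four queries and costs a number of gates linear in the product of the depth and
the register width, both logarithmic. The query bound obtained is O(TQ(n)), without the factor √(log
n). -/

theorem mem_unitaryGroup_of_star_mul {X : Type} [Fintype X] [DecidableEq X] {M : Matrix X X ℂ}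
    (h : Mᴴ * M = 1) : M ∈ Matrix.unitaryGroup X ℂ :=
  Matrix.mem_unitaryGroup_iff'.2 h

theorem unitary_sum_star {X : Type} [Fintype X] [DecidableEq X] (U : Matrix.unitaryGroup X ℂ)
    (x x' : X) : ∑ z, star ((U : Matrix X X ℂ) z x) * (U : Matrix X X ℂ) z x' =
      if x = x' then 1 else 0 := by
  have h := congrFun (congrFun (Matrix.mem_unitaryGroup_iff'.1 U.2) x) x'
  simpa [Matrix.mul_apply, Matrix.star_apply, Matrix.one_apply] using h

/-- Only basis states that agree with `x` off the qubit `q` contribute to an inner product of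
columns, which thus collapses to an inner product of columns of `U`. -/
theorem oneMatrix_unitary (q : Fin N) (U : Matrix.unitaryGroup Bool ℂ) :
    (oneMatrix q U : Matrix (Config N K W) (Config N K W) ℂ) ∈ Matrix.unitaryGroup _ ℂ := by
  apply mem_unitaryGroup_of_star_mul
  ext x x'
  have key : ∀ f : Config N K W → ℂ,
      (∀ z, ¬ ((∀ s, s ≠ q → z.1 s = x.1 s) ∧ z.2 = x.2) → f z = 0) →
      ∑ z, f z = ∑ b : Bool, f (Function.update x.1 q b, x.2) := by
    intro f hf
    have hinj : Function.Injective fun b : Bool => ((Function.update x.1 q b, x.2) : Config N K W) := by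
      intro b b' h
      have := congrFun (congrArg Prod.fst h) q
      simpa using this
    symm
    apply Fintype.sum_of_injective _ hinj
    · intro z hz
      apply hf
      rintro ⟨h1, h2⟩
      apply hz
      refine ⟨z.1 q, Prod.ext ?_ h2.symm⟩
      funext s
      by_cases hs : s = q
      · subst hs; simp
      · simp [hs, h1 s hs]
    · intro b; rfl
  rw [Matrix.mul_apply, key _ (by
    intro z hz
    simp only [Matrix.conjTranspose_apply, oneMatrix, Matrix.of_apply]
    rw [if_neg hz]; simp)]
  by_cases hx : (∀ s, s ≠ q → x.1 s = x'.1 s) ∧ x.2 = x'.2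
  · have e1 : ∀ b, (∀ s, s ≠ q → Function.update x.1 q b s = x'.1 s) ∧ x.2 = x'.2 := by
      intro b; refine ⟨fun s hs => ?_, hx.2⟩; simp [hs, hx.1 s hs]
    have e2 : ∀ b, (∀ s, s ≠ q → Function.update x.1 q b s = x.1 s) := by
      intro b s hs; simp [hs]
    have := unitary_sum_star U (x.1 q) (x'.1 q)
    simp only [Matrix.conjTranspose_apply, oneMatrix, Matrix.of_apply, Matrix.one_apply]
    calc _ = ∑ b, star ((U : Matrix Bool Bool ℂ) b (x.1 q)) * (U : Matrix Bool Bool ℂ) b (x'.1 q) := by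
          refine Finset.sum_congr rfl fun b _ => ?_
          rw [if_pos (e1 b), if_pos ⟨e2 b, trivial⟩, Function.update_self]
      _ = _ := this
    congr 1
    apply propext
    constructor
    · intro h
      refine Prod.ext ?_ hx.2
      funext s
      by_cases hs : s = q
      · subst hs; exact h
      · exact hx.1 s hs
    · intro h; rw [h]
  · rw [Matrix.one_apply_ne (by rintro rfl; exact hx ⟨fun _ _ => rfl, rfl⟩)]
    apply Finset.sum_eq_zero
    intro b _
    simp only [oneMatrix, Matrix.of_apply]
    rw [if_neg (c := (∀ s, s ≠ q → Function.update x.1 q b s = x'.1 s) ∧ x.2 = x'.2), mul_zero]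
    rintro ⟨h1, h2⟩
    refine hx ⟨fun s hs => ?_, h2⟩
    simpa [hs] using h1 s hs

/-- Overwrite the qubits `p` and `q`. -/
def setPair (p q : Fin N) (c : Bool × Bool) (x : Fin N → Bool) : Fin N → Bool :=
  Function.update (Function.update x p c.1) q c.2

theorem setPair_eq_iff {p q : Fin N} (hpq : p ≠ q) (c : Bool × Bool) (x y : Fin N → Bool) :
    y = setPair p q c x ↔ (∀ s, s ≠ p → s ≠ q → y s = x s) ∧ (y p, y q) = c := by
  constructor
  · rintro rfl
    refine ⟨fun s h1 h2 => by simp [setPair, h1, h2], ?_⟩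
    simp [setPair, Function.update_of_ne hpq]
  · rintro ⟨h, rfl⟩
    funext s
    by_cases h2 : s = q
    · subst h2; simp [setPair]
    · by_cases h1 : s = p
      · subst h1; simp [setPair, Function.update_of_ne h2]
      · simp [setPair, h1, h2, h s h1 h2]

theorem twoMatrix_unitary (p q : Fin N) (hpq : p ≠ q)
    (U : Matrix.unitaryGroup (Bool × Bool) ℂ) :
    (twoMatrix p q U : Matrix (Config N K W) (Config N K W) ℂ) ∈ Matrix.unitaryGroup _ ℂ := by
  apply mem_unitaryGroup_of_star_mul
  ext x x'
  have key : ∀ f : Config N K W → ℂ,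
      (∀ z, ¬ ((∀ s, s ≠ p → s ≠ q → z.1 s = x.1 s) ∧ z.2 = x.2) → f z = 0) →
      ∑ z, f z = ∑ c : Bool × Bool, f (setPair p q c x.1, x.2) := by
    intro f hf
    have hinj : Function.Injective fun c => ((setPair p q c x.1, x.2) : Config N K W) := by
      intro b b' h
      have h2 := ((setPair_eq_iff hpq b' x.1 _).1 (congrArg Prod.fst h)).2
      have h1 := ((setPair_eq_iff hpq b x.1 _).1 rfl).2
      exact h1.symm.trans h2
    symm
    apply Fintype.sum_of_injective _ hinj
    · intro z hz
      apply hf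
      rintro ⟨h1, h2⟩
      apply hz
      exact ⟨(z.1 p, z.1 q), Prod.ext ((setPair_eq_iff hpq _ _ _).2 ⟨h1, rfl⟩).symm h2.symm⟩
    · intro b; rfl
  rw [Matrix.mul_apply, key _ (by
    intro z hz
    simp only [Matrix.conjTranspose_apply, twoMatrix, Matrix.of_apply]
    rw [if_neg hz]; simp)]
  have e2 : ∀ c, (∀ s, s ≠ p → s ≠ q → setPair p q c x.1 s = x.1 s) := fun c =>
    ((setPair_eq_iff hpq c x.1 _).1 rfl).1
  have e3 : ∀ c, (setPair p q c x.1 p, setPair p q c x.1 q) = c := fun c =>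
    ((setPair_eq_iff hpq c x.1 _).1 rfl).2
  by_cases hx : (∀ s, s ≠ p → s ≠ q → x.1 s = x'.1 s) ∧ x.2 = x'.2
  · have e1 : ∀ c, (∀ s, s ≠ p → s ≠ q → setPair p q c x.1 s = x'.1 s) ∧ x.2 = x'.2 := by
      intro b; refine ⟨fun s hs hs' => ?_, hx.2⟩; rw [e2 _ s hs hs', hx.1 s hs hs']
    have := unitary_sum_star U (x.1 p, x.1 q) (x'.1 p, x'.1 q)
    simp only [Matrix.conjTranspose_apply, twoMatrix, Matrix.of_apply, Matrix.one_apply]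
    calc _ = ∑ c, star ((U : Matrix (Bool × Bool) (Bool × Bool) ℂ) c (x.1 p, x.1 q)) *
            (U : Matrix (Bool × Bool) (Bool × Bool) ℂ) c (x'.1 p, x'.1 q) := by
          refine Finset.sum_congr rfl fun c _ => ?_
          rw [if_pos (e1 c), if_pos ⟨e2 c, trivial⟩, e3]
      _ = _ := this
    congr 1
    apply propext
    constructor
    · intro h
      refine Prod.ext ?_ hx.2
      funext s
      by_cases hs : s = p
      · subst hs; exact congrArg Prod.fst h
      · by_cases hs' : s = q
        · subst hs'; exact congrArg Prod.snd h
        · exact hx.1 s hs hs'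
    · intro h; rw [h]
  · rw [Matrix.one_apply_ne (by rintro rfl; exact hx ⟨fun _ _ _ => rfl, rfl⟩)]
    apply Finset.sum_eq_zero
    intro b _
    simp only [twoMatrix, Matrix.of_apply]
    rw [if_neg (c := (∀ s, s ≠ p → s ≠ q → setPair p q b x.1 s = x'.1 s) ∧ x.2 = x'.2), mul_zero]
    rintro ⟨h1, h2⟩
    refine hx ⟨fun s hs hs' => ?_, h2⟩
    rw [← h1 s hs hs', e2 _ s hs hs']

theorem basisMatrix_conjTranspose {X : Type} [DecidableEq X] {f : X → X}
    (hf : Function.Involutive f) : (basisMatrix f)ᴴ = basisMatrix f := by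
  ext y x
  have : x = f y ↔ y = f x := ⟨fun h => by rw [h, hf], fun h => by rw [h, hf]⟩
  simp only [basisMatrix, Matrix.conjTranspose_apply, Matrix.of_apply, this]
  split_ifs <;> simp

theorem basisMatrix_unitary {X : Type} [Fintype X] [DecidableEq X] {f : X → X}
    (hf : Function.Involutive f) : basisMatrix f ∈ Matrix.unitaryGroup X ℂ := by
  apply mem_unitaryGroup_of_star_mul
  rw [basisMatrix_conjTranspose hf]
  ext y x
  simp [basisMatrix, Matrix.mul_apply, Matrix.one_apply, hf x]

theorem regVal_congr {l : ℕ} {r : Fin l → Fin N} {x y : Fin N → Bool}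
    (h : ∀ i, x (r i) = y (r i)) : regVal r x = regVal r y := by
  simp [regVal, h]

/-- The swap does not touch the address qubits, so a second application reads the same address and
swaps back. -/
theorem qragMap_involutive {l m : ℕ} (addr : Fin l → Fin N) (data : Fin N) (cells : Fin m ↪ Fin N)
    (h₁ : ∀ i, addr i ≠ data) (h₂ : ∀ i j, addr i ≠ cells j) :
    Function.Involutive (qragMap (K := K) (W := W) addr data cells) := by
  intro x
  by_cases h : regVal addr x.1 < m
  · have hv : regVal addr (fun s => x.1 (Equiv.swap data (cells ⟨regVal addr x.1, h⟩) s)) =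
        regVal addr x.1 :=
      regVal_congr fun i => by
        show x.1 (Equiv.swap data (cells ⟨regVal addr x.1, h⟩) (addr i)) = _
        rw [Equiv.swap_apply_of_ne_of_ne (h₁ i) (h₂ i _)]
    have e : qragMap addr data cells x =
        (fun s => x.1 (Equiv.swap data (cells ⟨regVal addr x.1, h⟩) s), x.2) := by
      rw [qragMap, dif_pos h]
    rw [e, qragMap, dif_pos (show regVal addr (_, x.2).1 < m from hv.symm ▸ h)]
    refine Prod.ext (funext fun s => ?_) rfl
    simp only [hv, Equiv.swap_apply_self]
  · have e : qragMap addr data cells x = x := by rw [qragMap, dif_neg h]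
    rw [e, e]

/-! ### Unitarity of the oracles; inverses of gates. -/

section oracles

variable {a : ℕ} {b n₀ : ℝ} {Taux : ℝ → ℕ} (P : OrDivideConquer a b n₀ Taux W)

theorem markMap_involutive {lk : ℕ} (level : Fin lk → Fin N) (target : Fin N)
    (h : ∀ i, level i ≠ target) : Function.Involutive (markMap (K := K) P level target) := by
  intro x
  by_cases hk : regVal level x.1 < K
  · have hv : ∀ c, regVal level (Function.update x.1 target c) = regVal level x.1 := fun c =>
      regVal_congr fun i => by rw [Function.update_of_ne (h i)]
    have e : markMap P level target x = (Function.update x.1 target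
        (xor (x.1 target) (P.marked (x.2 ⟨regVal level x.1, hk⟩))), x.2) := by
      rw [markMap, dif_pos hk]
    rw [e, markMap, dif_pos (show regVal level (_, x.2).1 < K from (hv _).symm ▸ hk)]
    refine Prod.ext ?_ rfl
    simp [hv]
  · have e : markMap P level target x = x := by rw [markMap, dif_neg hk]
    rw [e, e]

theorem regWrite_self {l : ℕ} (r : Fin l ↪ Fin N) (v : ℕ) (x : Fin N → Bool) (i : Fin l) :
    regWrite r v x (r i) = v.testBit i := r.injective.extend_apply _ _ _

theorem regWrite_of_ne {l : ℕ} (r : Fin l ↪ Fin N) (v : ℕ) (x : Fin N → Bool) {s : Fin N}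
    (h : ∀ i, s ≠ r i) : regWrite r v x s = x s :=
  Function.extend_apply' _ _ _ (by rintro ⟨i, rfl⟩; exact h i rfl)

theorem regVal_eq_ofBits {l : ℕ} (r : Fin l → Fin N) (x : Fin N → Bool) :
    regVal r x = Nat.ofBits fun i => x (r i) := by
  induction l with
  | zero => simp [regVal]
  | succ l ih =>
    have e := ih (r ∘ Fin.succ)
    have e2 : regVal r x = 2 * regVal (r ∘ Fin.succ) x + (x (r 0)).toNat := by
      simp only [regVal, Fin.sum_univ_succ, Finset.mul_sum, Function.comp, Fin.val_succ, pow_succ']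
      cases x (r 0) <;> simp [mul_ite, add_comm]
    rw [e2, e, Nat.ofBits_succ]
    rfl

theorem regVal_eq_mod {l : ℕ} (r : Fin l → Fin N) (x : Fin N → Bool) {v : ℕ}
    (h : ∀ i, x (r i) = v.testBit i) : regVal r x = v % 2 ^ l := by
  rw [regVal_eq_ofBits, ← Nat.ofBits_testBit]
  simp only [h]

/-- The increment is taken modulo `2 ^ l`, but the old value is below `2 ^ l` and so can be
recovered; all other qubits are unchanged. This makes the clock of the step oracle reversible. -/
theorem regWrite_succ_injective {l : ℕ} (r : Fin l ↪ Fin N) :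
    Function.Injective fun x => regWrite r (regVal r x + 1) x := by
  intro x y h
  have h1 : ∀ i : Fin l, (regVal r x + 1).testBit i = (regVal r y + 1).testBit i := by
    intro i
    have := congrFun h (r i)
    simpa [regWrite_self] using this
  have h2 : (regVal r x + 1) % 2 ^ l = (regVal r y + 1) % 2 ^ l := by
    rw [← Nat.ofBits_testBit, ← Nat.ofBits_testBit]
    simp only [h1]
  have hb : ∀ z : Fin N → Bool, regVal r z < 2 ^ l := fun z => by
    rw [regVal_eq_ofBits]; exact Nat.ofBits_lt_two_pow _
  have h3 : regVal r x = regVal r y := by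
    have : regVal r x ≡ regVal r y [MOD 2 ^ l] := Nat.ModEq.add_right_cancel' 1 h2
    exact this.eq_of_lt_of_lt (hb x) (hb y)
  have h4 : ∀ i, x (r i) = y (r i) := by
    intro i
    have e : ∀ z : Fin N → Bool, z (r i) = (regVal r z).testBit i := fun z => by
      rw [regVal_eq_ofBits, Nat.testBit_ofBits_lt _ _ i.2]
    rw [e x, e y, h3]
  funext s
  by_cases hs : ∃ i, s = r i
  · obtain ⟨i, rfl⟩ := hs; exact h4 i
  · push Not at hs
    have := congrFun h s
    simpa [regWrite_of_ne r _ _ hs] using this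

theorem sum_agree_off {k : Fin K} (y : Fin K → Desc W) (f : (Fin K → Desc W) → ℂ)
    (hf : ∀ z, ¬ (∀ j, j ≠ k → z j = y j) → f z = 0) :
    ∑ z, f z = ∑ v, f (Function.update y k v) := by
  symm
  apply Fintype.sum_of_injective _ (Function.update_injective y k)
  · intro z hz
    apply hf
    intro h
    apply hz
    refine ⟨z k, funext fun j => ?_⟩
    by_cases hj : j = k
    · subst hj; simp
    · simp [hj, h j hj]
  · intro v; rfl

/-- The level and the parent's register are left alone and the time is changed injectively. What
remains within a block is a unitary on the child's register. -/
theorem stepMatrix_unitary {lk li lt : ℕ} (level : Fin lk → Fin N)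
    (idx : Fin li → Fin N) (time : Fin lt ↪ Fin N) (h₁ : ∀ i j, level i ≠ time j) :
    (stepMatrix P level idx time : Matrix (Config N K W) _ ℂ) ∈ Matrix.unitaryGroup _ ℂ := by
  apply mem_unitaryGroup_of_star_mul
  have hlev : ∀ (v : ℕ) (x : Fin N → Bool), regVal level (regWrite time v x) = regVal level x :=
    fun v x => regVal_congr fun i => regWrite_of_ne _ _ _ (h₁ i)
  ext x x'
  rw [Matrix.mul_apply, Matrix.one_apply]
  simp only [Matrix.conjTranspose_apply, stepMatrix, Matrix.of_apply]
  by_cases hx : 0 < regVal level x.1 ∧ regVal level x.1 < K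
  · rw [Fintype.sum_prod_type]
    simp only [dif_pos hx]
    by_cases hx' : 0 < regVal level x'.1 ∧ regVal level x'.1 < K
    · simp only [dif_pos hx']
      by_cases h1 : x'.1 = x.1
      · obtain ⟨x1, x2⟩ := x
        obtain ⟨x1', x2'⟩ := x'
        simp only at h1 hx hx' ⊢
        subst h1
        rw [Finset.sum_eq_single (regWrite time (regVal time x1' + 1) x1')
          (by intro z _ hz; simp [hz]) (by simp)]
        simp only [true_and]
        set k : Fin K := ⟨regVal level x1', hx.2⟩ with hk
        have hne : ∀ j : Fin K, (j : ℕ) ≠ regVal level x1' ↔ j ≠ k := by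
          intro j; rw [hk, Ne, Ne, Fin.ext_iff]
        simp only [hne]
        rw [sum_agree_off (k := k) x2 _ (by intro z hz; rw [if_neg hz]; simp)]
        have e1 : ∀ v j, j ≠ k → Function.update x2 k v j = x2 j := by
          intro v j hj; simp [hj]
        by_cases h2 : ∀ j, j ≠ k → x2 j = x2' j
        · have e2 : ∀ v j, j ≠ k → Function.update x2 k v j = x2' j := by
            intro v j hj; rw [e1 v j hj, h2 j hj]
          -- The level is positive, so register `k - 1` is not register `k`, and both columns
          -- involve the same step unitary.
          have e3 : x2 ⟨regVal level x1' - 1, by omega⟩ = x2' ⟨regVal level x1' - 1, by omega⟩ := by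
            apply h2
            rw [hk, Ne, Fin.ext_iff]
            simp only
            omega
          have := unitary_sum_star (P.step (x2 ⟨regVal level x1' - 1, by omega⟩)
            (regVal idx x1') (regVal time x1')) (x2 k) (x2' k)
          calc _ = _ := by
                refine Finset.sum_congr rfl fun v _ => ?_
                rw [if_pos (e1 v), if_pos (e2 v), Function.update_self, ← e3]
            _ = _ := this
          congr 1
          apply propext
          constructor
          · intro h
            refine Prod.ext rfl (funext fun j => ?_)
            by_cases hj : j = k
            · subst hj; exact h
            · exact h2 j hj
          · intro h; exact congrFun (congrArg Prod.snd h) k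
        · rw [if_neg (by intro h; exact h2 fun j _ => congrFun (congrArg Prod.snd h) j)]
          apply Finset.sum_eq_zero
          intro v _
          rw [if_neg (c := ∀ j, j ≠ k → Function.update x2 k v j = x2' j), mul_zero]
          intro h
          exact h2 fun j hj => by rw [← h j hj, e1 v j hj]
      · rw [if_neg (by rintro rfl; exact h1 rfl)]
        apply Finset.sum_eq_zero; intro z1 _
        apply Finset.sum_eq_zero; intro z2 _
        by_cases hz : z1 = regWrite time (regVal time x.1 + 1) x.1
        · rw [if_neg (c := _ ∧ ∀ j : Fin K, (j : ℕ) ≠ regVal level x'.1 → z2 j = x'.2 j), mul_zero]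
          rintro ⟨h2, -⟩
          exact h1 (regWrite_succ_injective time (h2.symm.trans hz))
        · rw [if_neg (by rintro ⟨h, -⟩; exact hz h)]; simp
    · simp only [dif_neg hx']
      rw [if_neg (by rintro rfl; exact hx' hx)]
      apply Finset.sum_eq_zero; intro z1 _
      apply Finset.sum_eq_zero; intro z2 _
      by_cases hz : z1 = regWrite time (regVal time x.1 + 1) x.1
      · rw [if_neg (c := (z1, z2) = x'), mul_zero]
        rintro rfl
        simp only [hz, hlev] at hx'
        exact hx' hx
      · rw [if_neg (by rintro ⟨h, -⟩; exact hz h)]; simp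
  · simp only [dif_neg hx]
    rw [Finset.sum_eq_single x (by intro z _ hz; simp [hz]) (by simp)]
    simp only [if_true, star_one, one_mul]
    by_cases hx' : 0 < regVal level x'.1 ∧ regVal level x'.1 < K
    · rw [dif_pos hx', if_neg, if_neg]
      · rintro rfl; exact hx hx'
      · rintro ⟨h, -⟩
        rw [h, hlev] at hx
        exact hx hx'
    · rw [dif_neg hx']

theorem Gate.toMatrix_unitary (g : Gate N K) :
    (g.toMatrix P : Matrix (Config N K W) _ ℂ) ∈ Matrix.unitaryGroup _ ℂ := by
  cases g with
  | one q U => exact oneMatrix_unitary q U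
  | two p q h U => exact twoMatrix_unitary p q h U
  | qrag addr data cells h₁ h₂ h₃ => exact basisMatrix_unitary (qragMap_involutive _ _ _ h₁ h₂)
  | step inv level idx time h₁ h₂ =>
    cases inv
    · exact stepMatrix_unitary P level idx time h₁
    · exact Unitary.star_mem (stepMatrix_unitary P level idx time h₁)
  | mark level target h => exact basisMatrix_unitary (markMap_involutive P _ _ h)

/-- The inverse of a gate. -/
def Gate.inv : Gate N K → Gate N K
  | .one q U => .one q U⁻¹
  | .two p q h U => .two p q h U⁻¹
  | .step i level idx time h₁ h₂ => .step (!i) level idx time h₁ h₂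
  | g => g

theorem Gate.toMatrix_inv (g : Gate N K) : g.inv.toMatrix P = (g.toMatrix P)ᴴ := by
  cases g with
  | one q U =>
    ext y x
    simp only [Gate.inv, Gate.toMatrix, oneMatrix, Matrix.conjTranspose_apply, Matrix.of_apply]
    have : ((∀ s, s ≠ q → y.1 s = x.1 s) ∧ y.2 = x.2) ↔
        ((∀ s, s ≠ q → x.1 s = y.1 s) ∧ x.2 = y.2) :=
      ⟨fun h => ⟨fun s hs => (h.1 s hs).symm, h.2.symm⟩, fun h => ⟨fun s hs => (h.1 s hs).symm, h.2.symm⟩⟩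
    simp only [this]
    split_ifs
    · rfl
    · simp
  | two p q h U =>
    ext y x
    simp only [Gate.inv, Gate.toMatrix, twoMatrix, Matrix.conjTranspose_apply, Matrix.of_apply]
    have : ((∀ s, s ≠ p → s ≠ q → y.1 s = x.1 s) ∧ y.2 = x.2) ↔
        ((∀ s, s ≠ p → s ≠ q → x.1 s = y.1 s) ∧ x.2 = y.2) :=
      ⟨fun h => ⟨fun s hs hs' => (h.1 s hs hs').symm, h.2.symm⟩,
        fun h => ⟨fun s hs hs' => (h.1 s hs hs').symm, h.2.symm⟩⟩
    simp only [this]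
    split_ifs
    · rfl
    · simp
  | qrag addr data cells h₁ h₂ h₃ =>
    exact (basisMatrix_conjTranspose (qragMap_involutive _ _ _ h₁ h₂)).symm
  | step inv level idx time h₁ h₂ => cases inv <;> simp [Gate.inv, Gate.toMatrix]
  | mark level target h => exact (basisMatrix_conjTranspose (markMap_involutive P _ _ h)).symm

/-- The inverse of a circuit. -/
def circuitInv (c : List (Gate N K)) : List (Gate N K) := (c.map Gate.inv).reverse

/-- The action of a circuit on state vectors. -/
noncomputable def run (c : List (Gate N K)) (v : Config N K W → ℂ) : Config N K W → ℂ := circuitMatrix P c *ᵥ v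

variable {P}

/-! ### Linearity and inversion of circuits. -/

@[simp] theorem run_nil (v : Config N K W → ℂ) : run P [] v = v := by
  simp [run, circuitMatrix]

theorem run_cons (g : Gate N K) (c : List (Gate N K)) (v : Config N K W → ℂ) :
    run P (g :: c) v = run P c (g.toMatrix P *ᵥ v) := by
  simp [run, circuitMatrix]

theorem run_append (c c' : List (Gate N K)) (v : Config N K W → ℂ) :
    run P (c ++ c') v = run P c' (run P c v) := by
  induction c generalizing v with
  | nil => simp
  | cons g c ih => simp [run_cons, ih]

theorem run_singleton (g : Gate N K) (v : Config N K W → ℂ) :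
    run P [g] v = g.toMatrix P *ᵥ v := by
  simp [run_cons]

theorem run_add (c : List (Gate N K)) (v w : Config N K W → ℂ) :
    run P c (v + w) = run P c v + run P c w := Matrix.mulVec_add _ _ _

theorem run_smul (c : List (Gate N K)) (z : ℂ) (v : Config N K W → ℂ) :
    run P c (z • v) = z • run P c v := Matrix.mulVec_smul _ _ _

theorem run_sum {ι : Type} (c : List (Gate N K)) (s : Finset ι) (v : ι → Config N K W → ℂ) :
    run P c (∑ i ∈ s, v i) = ∑ i ∈ s, run P c (v i) := by
  simp [run, Matrix.mulVec_sum]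

theorem run_circuitInv_run (c : List (Gate N K)) (v : Config N K W → ℂ) :
    run P (circuitInv c) (run P c v) = v := by
  induction c generalizing v with
  | nil => simp [circuitInv]
  | cons g c ih =>
    have : circuitInv (g :: c) = circuitInv c ++ [g.inv] := by simp [circuitInv]
    have h := Matrix.mem_unitaryGroup_iff'.1 (g.toMatrix_unitary P)
    rw [Matrix.star_eq_conjTranspose] at h
    rw [this, run_append, run_cons g c, ih, run_singleton, Gate.toMatrix_inv, Matrix.mulVec_mulVec, h,
      Matrix.one_mulVec]

theorem run_circuitInv {c : List (Gate N K)} {v v' : Config N K W → ℂ} (h : run P c v = v') :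
    run P (circuitInv c) v' = v := by
  rw [← h, run_circuitInv_run]

theorem run_flatMap_of_fixed {ι : Type} {f : ι → List (Gate N K)} {l : List ι}
    {v : Config N K W → ℂ} (h : ∀ i ∈ l, run P (f i) v = v) : run P (l.flatMap f) v = v := by
  induction l with
  | nil => simp
  | cons i l ih =>
    rw [List.flatMap_cons, run_append, h i (by simp), ih fun j hj => h j (by simp [hj])]

/-- Only one of the pieces of a circuit acts. -/
theorem run_flatMap_of_single {ι : Type} {f : ι → List (Gate N K)} {l : List ι} (hl : l.Nodup)
    {i : ι} (hi : i ∈ l) {v v' : Config N K W → ℂ} (h : ∀ j ∈ l, j ≠ i → run P (f j) v = v)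
    (hv : run P (f i) v = v') (h' : ∀ j ∈ l, j ≠ i → run P (f j) v' = v') :
    run P (l.flatMap f) v = v' := by
  induction l with
  | nil => simp at hi
  | cons j l ih =>
    rw [List.nodup_cons] at hl
    rw [List.flatMap_cons, run_append]
    by_cases hj : j = i
    · subst hj
      rw [hv]
      exact run_flatMap_of_fixed fun m hm => h' m (by simp [hm]) (by rintro rfl; exact hl.1 hm)
    · rw [h j (by simp) hj]
      refine ih hl.2 ?_ (fun m hm => h m (by simp [hm])) (fun m hm => h' m (by simp [hm]))
      simpa [Ne.symm hj] using hi

/-- The squared norm of a vector. -/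
noncomputable def nsq {X : Type} [Fintype X] (v : X → ℂ) : ℝ := ∑ x, ‖v x‖ ^ 2

/-! ### Squared norms and disjoint supports. -/

theorem nsq_eq_dotProduct {X : Type} [Fintype X] (v : X → ℂ) : (nsq v : ℂ) = star v ⬝ᵥ v := by
  simp only [nsq, dotProduct, Complex.ofReal_sum, Pi.star_apply]
  refine Finset.sum_congr rfl fun x _ => ?_
  rw [← Complex.normSq_eq_norm_sq, Complex.normSq_eq_conj_mul_self]
  rfl

theorem nsq_mulVec {X : Type} [Fintype X] [DecidableEq X] {U : Matrix X X ℂ}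
    (hU : U ∈ Matrix.unitaryGroup X ℂ) (v : X → ℂ) : nsq (U *ᵥ v) = nsq v := by
  have h := Matrix.mem_unitaryGroup_iff'.1 hU
  rw [Matrix.star_eq_conjTranspose] at h
  have : (nsq (U *ᵥ v) : ℂ) = nsq v := by
    rw [nsq_eq_dotProduct, nsq_eq_dotProduct, Matrix.star_mulVec, ← Matrix.dotProduct_mulVec,
      Matrix.mulVec_mulVec, h, Matrix.one_mulVec]
  exact_mod_cast this

theorem nsq_run (c : List (Gate N K)) (v : Config N K W → ℂ) : nsq (run P c v) = nsq v := by
  induction c generalizing v with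
  | nil => simp
  | cons g c ih => rw [run_cons, ih, nsq_mulVec (g.toMatrix_unitary P)]

theorem nsq_smul {X : Type} [Fintype X] (z : ℂ) (v : X → ℂ) : nsq (z • v) = ‖z‖ ^ 2 * nsq v := by
  simp [nsq, mul_pow, Finset.mul_sum]

theorem nsq_sub_le {X : Type} [Fintype X] (v w : X → ℂ) :
    nsq (v - w) ≤ 2 * nsq v + 2 * nsq w := by
  simp only [nsq, Finset.mul_sum, ← Finset.sum_add_distrib, Pi.sub_apply]
  refine Finset.sum_le_sum fun x _ => ?_
  have := norm_sub_le (v x) (w x)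
  have h0 := norm_nonneg (v x - w x)
  nlinarith [sq_nonneg (‖v x‖ - ‖w x‖)]

theorem nsq_add_of_disjoint {X : Type} [Fintype X] {v w : X → ℂ} (h : ∀ x, v x = 0 ∨ w x = 0) :
    nsq (v + w) = nsq v + nsq w := by
  simp only [nsq, ← Finset.sum_add_distrib, Pi.add_apply]
  refine Finset.sum_congr rfl fun x _ => ?_
  rcases h x with h | h <;> simp [h]

theorem nsq_sum_of_disjoint {X ι : Type} [Fintype X] [DecidableEq ι] {s : Finset ι} {v : ι → X → ℂ}
    (h : ∀ x, ∀ i ∈ s, ∀ j ∈ s, i ≠ j → v i x = 0 ∨ v j x = 0) :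
    nsq (∑ i ∈ s, v i) = ∑ i ∈ s, nsq (v i) := by
  induction s using Finset.induction_on with
  | empty => simp [nsq]
  | insert i s hi ih =>
    rw [Finset.sum_insert hi, Finset.sum_insert hi, nsq_add_of_disjoint, ih]
    · intro x j hj k hk
      exact h x j (by simp [hj]) k (by simp [hk])
    · intro x
      by_cases hx : v i x = 0
      · exact Or.inl hx
      · right
        rw [Finset.sum_apply]
        refine Finset.sum_eq_zero fun j hj => ?_
        exact (h x i (by simp) j (by simp [hj]) (by rintro rfl; exact hi hj)).resolve_left hx

end oracles

end Unitarity

/-! ### Action of the gates on product vectors -/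

section Embedding

variable {N K W : ℕ}

/-- The vector `|x⟩ ⊗ ω`, where `ω` is a state of the work registers. -/
noncomputable def emb (x : Fin N → Bool) (ω : (Fin K → Desc W) → ℂ) : Config N K W → ℂ :=
  fun y => if y.1 = x then ω y.2 else 0

theorem mulVec_emb (M : Matrix (Config N K W) (Config N K W) ℂ) (x : Fin N → Bool)
    (ω : (Fin K → Desc W) → ℂ) (y : Config N K W) :
    (M *ᵥ emb x ω) y = ∑ z, M y (x, z) * ω z := by
  rw [Matrix.mulVec, dotProduct, Fintype.sum_prod_type,
    Finset.sum_eq_single x (by intro z _ hz; simp [emb, hz]) (by simp)]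
  simp [emb]

theorem nsq_emb (x : Fin N → Bool) (ω : (Fin K → Desc W) → ℂ) : nsq (emb x ω) = nsq ω := by
  rw [nsq, Fintype.sum_prod_type, Finset.sum_eq_single x (by intro z _ hz; simp [emb, hz]) (by simp)]
  simp [emb, nsq]

theorem emb_single (x : Fin N → Bool) (z : Fin K → Desc W) :
    emb x (Pi.single z 1) = Pi.single (x, z) 1 := by
  ext y
  by_cases h : y = (x, z)
  · subst h; simp [emb]
  · rw [Pi.single_eq_of_ne h, emb]
    split_ifs with h1
    · rw [Pi.single_eq_of_ne]
      rintro h2; exact h (Prod.ext h1 h2)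
    · rfl

theorem twoMatrix_emb {p q : Fin N} (hpq : p ≠ q) (U : Matrix (Bool × Bool) (Bool × Bool) ℂ)
    (x : Fin N → Bool) (ω : (Fin K → Desc W) → ℂ) :
    twoMatrix p q U *ᵥ emb x ω = ∑ c, U c (x p, x q) • emb (setPair p q c x) ω := by
  ext y
  rw [mulVec_emb, Finset.sum_apply]
  simp only [twoMatrix, Matrix.of_apply, Pi.smul_apply, emb, smul_eq_mul, setPair_eq_iff hpq]
  by_cases h : ∀ s, s ≠ p → s ≠ q → y.1 s = x s
  · rw [Finset.sum_eq_single y.2 (by intro z _ hz; rw [if_neg (fun h => hz h.2.symm), zero_mul])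
      (by simp), Finset.sum_eq_single (y.1 p, y.1 q)
      (by intro c _ hc; rw [if_neg (fun h => hc h.2.symm), mul_zero]) (by simp)]
    simp
  · rw [Finset.sum_eq_zero (by intro z _; rw [if_neg (fun h' => h h'.1), zero_mul]),
      Finset.sum_eq_zero (by intro z _; rw [if_neg (fun h' => h h'.1), mul_zero])]

/-- The condition on `f` is restricted to the support of `ω` because the action of the marking
oracle depends on the descriptions in the work registers. -/
theorem basisMatrix_emb {f : Config N K W → Config N K W} {x x' : Fin N → Bool}
    {ω : (Fin K → Desc W) → ℂ} (h : ∀ z, ω z ≠ 0 → f (x, z) = (x', z)) :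
    basisMatrix f *ᵥ emb x ω = emb x' ω := by
  ext y
  rw [mulVec_emb]
  have e : ∀ z, basisMatrix f y (x, z) * ω z = if y = (x', z) then ω z else 0 := by
    intro z
    by_cases hz : ω z = 0
    · simp [hz]
    · simp [basisMatrix, h z hz]
  simp only [e, emb]
  rw [Finset.sum_eq_single y.2 (by
    intro z _ hz; rw [if_neg]; intro h; exact hz (congrArg Prod.snd h).symm) (by simp)]
  congr 1
  exact propext ⟨fun h => congrArg Prod.fst h, fun h => Prod.ext h rfl⟩

/-- Work register `k` is in state `φ`, and every other work register `j` in the basis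
state `d j`. -/
noncomputable def workVec (d : Fin K → Desc W) (k : Fin K) (φ : Desc W → ℂ) :
    (Fin K → Desc W) → ℂ :=
  fun z => if ∀ j, j ≠ k → z j = d j then φ (z k) else 0

theorem workVec_single (d : Fin K → Desc W) (k : Fin K) (u : Desc W) :
    workVec d k (Pi.single u 1) = Pi.single (Function.update d k u) 1 := by
  ext z
  by_cases h : z = Function.update d k u
  · subst h
    rw [workVec, if_pos (by intro j hj; simp [hj])]
    simp
  · rw [Pi.single_eq_of_ne h, workVec]
    split_ifs with h1
    · rw [Pi.single_eq_of_ne]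
      intro h2
      apply h
      funext j
      by_cases hj : j = k
      · subst hj; simp [h2]
      · simp [hj, h1 j hj]
    · rfl

theorem nsq_workVec (d : Fin K → Desc W) (k : Fin K) (φ : Desc W → ℂ) :
    nsq (workVec d k φ) = nsq φ := by
  have : ((nsq (workVec d k φ) : ℝ) : ℂ) = nsq φ := by
    simp only [nsq, Complex.ofReal_sum]
    rw [sum_agree_off (k := k) d _ (by intro z hz; simp [workVec, if_neg hz])]
    refine Finset.sum_congr rfl fun v _ => ?_
    rw [workVec, if_pos (by intro j hj; simp [hj]), Function.update_self]
  exact_mod_cast this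

section oracles

variable {a : ℕ} {b n₀ : ℝ} {Taux : ℝ → ℕ} (P : OrDivideConquer a b n₀ Taux W)

theorem stepMatrix_emb {lk li lt : ℕ} (level : Fin lk → Fin N)
    (idx : Fin li → Fin N) (time : Fin lt ↪ Fin N) (x : Fin N → Bool) (d : Fin K → Desc W)
    (k k' : Fin K) (hk' : (k' : ℕ) + 1 = k) (φ : Desc W → ℂ) (hk : regVal level x = k) :
    stepMatrix P level idx time *ᵥ emb x (workVec d k φ) =
      emb (regWrite time (regVal time x + 1) x) (workVec d k
        ((P.step (d k') (regVal idx x) (regVal time x) : Matrix _ _ ℂ) *ᵥ φ)) := by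
  ext y
  rw [mulVec_emb]
  have hx : 0 < regVal level x ∧ regVal level x < K := by
    rw [hk]; exact ⟨by omega, k.2⟩
  have hkk : k = ⟨regVal level x, hx.2⟩ := Fin.ext hk.symm
  have hkk' : k' = ⟨regVal level x - 1, by omega⟩ := Fin.ext (by simp only; omega)
  have hne : ∀ j : Fin K, (j : ℕ) ≠ regVal level x ↔ j ≠ k := by
    intro j; rw [hk, Ne, Ne, Fin.ext_iff]
  simp only [stepMatrix, Matrix.of_apply, dif_pos hx, hne, ← hkk, ← hkk']
  by_cases h1 : y.1 = regWrite time (regVal time x + 1) x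
  · rw [emb, if_pos h1]
    simp only [h1, true_and]
    rw [sum_agree_off (k := k) d _ (by intro z hz; simp [workVec, if_neg hz])]
    have e1 : ∀ v j, j ≠ k → Function.update d k v j = d j := by
      intro v j hj; simp [hj]
    have e2 : k' ≠ k := by rintro rfl; omega
    simp only [workVec, e1 _ _ e2, Function.update_self]
    by_cases h2 : ∀ j, j ≠ k → y.2 j = d j
    · rw [if_pos h2, Matrix.mulVec, dotProduct]
      refine Finset.sum_congr rfl fun v _ => ?_
      rw [if_pos (by intro j hj; rw [e1 v j hj, h2 j hj]), if_pos (e1 v)]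
    · rw [if_neg h2]
      refine Finset.sum_eq_zero fun v _ => ?_
      rw [if_neg, zero_mul]
      intro h; exact h2 fun j hj => by rw [h j hj, e1 v j hj]
  · rw [emb, if_neg h1]
    refine Finset.sum_eq_zero fun z _ => ?_
    rw [if_neg (fun h => h1 h.1), zero_mul]

/-- Level `0` is the off position of the step oracle; it replaces a controlled call. -/
theorem stepMatrix_emb_idle {lk li lt : ℕ} (level : Fin lk → Fin N)
    (idx : Fin li → Fin N) (time : Fin lt ↪ Fin N) (x : Fin N → Bool)
    (ω : (Fin K → Desc W) → ℂ) (hk : regVal level x = 0) :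
    stepMatrix P level idx time *ᵥ emb x ω = emb x ω := by
  ext y
  rw [mulVec_emb]
  simp only [stepMatrix, Matrix.of_apply, hk, lt_irrefl, false_and, dif_neg not_false]
  rw [Finset.sum_eq_single y.2 (by
    intro z _ hz; rw [if_neg (by rintro rfl; exact hz rfl), zero_mul]) (by simp), emb]
  by_cases h : y.1 = x
  · rw [if_pos h, if_pos (show y = (x, y.2) from Prod.ext h rfl), one_mul]
  · rw [if_neg h, if_neg (fun h' => h (congrArg Prod.fst h')), zero_mul]

end oracles

end Embedding

/-! ### Register machines -/

section Registers

set_option linter.unusedSectionVars false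

variable {R : Type} [Fintype R] [DecidableEq R] (w : ℕ)

/-- The number of qubits of a machine with registers `R` of `w` qubits and two ancillas. -/
abbrev qubits (R : Type) [Fintype R] (w : ℕ) : ℕ := Fintype.card (Bool ⊕ R × Fin w)

/-- The `j`-th qubit of register `r`. -/
noncomputable def regQubit (r : R) (j : Fin w) : Fin (qubits R w) :=
  Fintype.equivFin (Bool ⊕ R × Fin w) (.inr (r, j))

/-- One of the two ancillas. -/
noncomputable def ancilla (R : Type) [Fintype R] (w : ℕ) (e : Bool) : Fin (qubits R w) :=
  Fintype.equivFin (Bool ⊕ R × Fin w) (.inl e)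

/-- The basis state with the numbers `ρ` in the registers, and the ancillas `f` and `o`. -/
noncomputable def regState (f o : Bool) (ρ : R → ℕ) : Fin (qubits R w) → Bool := fun q =>
  match (Fintype.equivFin (Bool ⊕ R × Fin w)).symm q with
  | .inl false => f
  | .inl true => o
  | .inr (r, j) => (ρ r).testBit j

variable {w}

theorem regQubit_inj {r r' : R} {j j' : Fin w} :
    regQubit w r j = regQubit w r' j' ↔ r = r' ∧ j = j' := by
  simp [regQubit]

theorem regQubit_ne_ancilla (r : R) (j : Fin w) (e : Bool) : regQubit w r j ≠ ancilla R w e := by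
  simp [regQubit, ancilla]

theorem ancilla_inj {e e' : Bool} : ancilla R w e = ancilla R w e' ↔ e = e' := by
  simp [ancilla]

@[simp] theorem regState_regQubit (f o : Bool) (ρ : R → ℕ) (r : R) (j : Fin w) :
    regState w f o ρ (regQubit w r j) = (ρ r).testBit j := by
  simp [regState, regQubit]

@[simp] theorem regState_ancilla_false (f o : Bool) (ρ : R → ℕ) :
    regState w f o ρ (ancilla R w false) = f := by
  simp [regState, ancilla]

@[simp] theorem regState_ancilla_true (f o : Bool) (ρ : R → ℕ) :
    regState w f o ρ (ancilla R w true) = o := by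
  simp [regState, ancilla]

theorem qubit_cases {p : Fin (qubits R w) → Prop} (h₁ : p (ancilla R w false))
    (h₂ : p (ancilla R w true)) (h₃ : ∀ r j, p (regQubit w r j)) (q) : p q := by
  obtain ⟨s, rfl⟩ := (Fintype.equivFin (Bool ⊕ R × Fin w)).surjective q
  rcases s with (_ | _) | ⟨r, j⟩
  · exact h₁
  · exact h₂
  · exact h₃ r j

theorem regVal_regState (f o : Bool) (ρ : R → ℕ) (r : R) (h : ρ r < 2 ^ w) :
    regVal (regQubit w r) (regState w f o ρ) = ρ r := by
  rw [regVal_eq_mod _ _ (v := ρ r) (by simp), Nat.mod_eq_of_lt h]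

/-- The total number that a list of assignments XORs to a register. -/
def xorVal : List (R × ℕ) → R → ℕ
  | [], _ => 0
  | (r', v) :: l, r => (if r = r' then v else 0) ^^^ xorVal l r

/-- XOR numbers to registers. -/
def xorState (ρ : R → ℕ) (l : List (R × ℕ)) : R → ℕ := fun r => ρ r ^^^ xorVal l r

@[simp] theorem xorState_xorState (ρ : R → ℕ) (l : List (R × ℕ)) :
    xorState (xorState ρ l) l = ρ := by
  funext r; simp [xorState]

theorem xorVal_of_notMem {l : List (R × ℕ)} {r : R} (h : r ∉ l.map Prod.fst) : xorVal l r = 0 := by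
  induction l with
  | nil => rfl
  | cons p l ih =>
    simp only [List.map_cons, List.mem_cons, not_or] at h
    simp [xorVal, h.1, ih h.2]

/-- Do the registers of the list hold the numbers of the list? -/
def Matches (ρ : R → ℕ) (l : List (R × ℕ)) : Prop := ∀ r ∈ l.map Prod.fst, ρ r = xorVal l r

theorem matches_xorState {ρ : R → ℕ} {l : List (R × ℕ)} (h : ∀ r ∈ l.map Prod.fst, ρ r = 0) :
    Matches (xorState ρ l) l := fun r hr => by simp [xorState, h r hr]

/-- The unitary matrix of a permutation of the basis states of two qubits that flips the second
one if `g` of the first one holds. -/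
def flipUnitary (g : Bool → Bool) : Matrix.unitaryGroup (Bool × Bool) ℂ :=
  ⟨basisMatrix fun c => (c.1, xor c.2 (g c.1)), basisMatrix_unitary fun c => by simp⟩

variable {K W a : ℕ} {b n₀ : ℝ} {Taux : ℝ → ℕ} {P : OrDivideConquer a b n₀ Taux W}

/-- Flip a qubit of a register if `g` of the first ancilla holds. -/
noncomputable def flipGate (K : ℕ) (g : Bool → Bool) (r : R) (j : Fin w) : Gate (qubits R w) K :=
  .two (ancilla R w false) (regQubit w r j) (regQubit_ne_ancilla r j false).symm (flipUnitary g)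

/-- XOR numbers to registers if `g` of the first ancilla holds. -/
noncomputable def xorCircuit (K : ℕ) (w : ℕ) (g : Bool → Bool) (l : List (R × ℕ)) :
    List (Gate (qubits R w) K) :=
  l.flatMap fun p => (List.finRange w).flatMap fun j : Fin w =>
    if p.2.testBit j then [flipGate K g p.1 j] else []

theorem flipUnitary_mulVec_emb {N : ℕ} {p q : Fin N} (hpq : p ≠ q) (g : Bool → Bool)
    (x : Fin N → Bool) (ω : (Fin K → Desc W) → ℂ) :
    twoMatrix p q (flipUnitary g : Matrix _ _ ℂ) *ᵥ emb x ω =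
      emb (Function.update x q (xor (x q) (g (x p)))) ω := by
  rw [twoMatrix_emb hpq, Finset.sum_eq_single (x p, xor (x q) (g (x p)))]
  · simp [flipUnitary, basisMatrix, setPair]
  · intro c _ hc
    simp [flipUnitary, basisMatrix, hc]
  · simp

theorem run_flip_list (g : Bool → Bool) (r : R) (v : ℕ) (x : Fin (qubits R w) → Bool)
    (ω : (Fin K → Desc W) → ℂ) (l : List (Fin w)) (hl : l.Nodup) :
    run P (l.flatMap fun j : Fin w => if v.testBit j then [flipGate K g r j] else []) (emb x ω) =
      emb (fun q => xor (x q) (g (x (ancilla R w false)) &&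
        decide (∃ j ∈ l, q = regQubit w r j ∧ v.testBit j))) ω := by
  induction l generalizing x with
  | nil => simp
  | cons i l ih =>
    rw [List.nodup_cons] at hl
    rw [List.flatMap_cons, run_append]
    have hi : run P (if v.testBit i then [flipGate K g r i] else []) (emb x ω) =
        emb (fun q => xor (x q) (g (x (ancilla R w false)) &&
          decide (q = regQubit w r i ∧ v.testBit i))) ω := by
      split_ifs with h
      · rw [run_singleton, flipGate, Gate.toMatrix, flipUnitary_mulVec_emb
          (regQubit_ne_ancilla r i false).symm]
        congr 1
        funext q
        by_cases hq : q = regQubit w r i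
        · subst hq; simp [h]
        · simp [hq]
      · simp [h]
    rw [hi, ih _ hl.2]
    congr 1
    funext q
    have h0 : ancilla R w false ≠ regQubit w r i := (regQubit_ne_ancilla r i false).symm
    simp only [h0, false_and, decide_false, Bool.and_false, Bool.xor_false]
    rw [Bool.xor_assoc]
    congr 1
    by_cases hg : g (x (ancilla R w false))
    · simp only [hg, Bool.true_and, List.mem_cons, exists_eq_or_imp]
      by_cases hq : q = regQubit w r i ∧ v.testBit i
      · have : ¬ ∃ j ∈ l, q = regQubit w r j ∧ v.testBit j := by
          rintro ⟨j, hj, h1, -⟩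
          have := hq.1.symm.trans h1
          rw [regQubit_inj] at this
          exact hl.1 (this.2 ▸ hj)
        simp [hq]
        rw [hq.1] at this
        simpa using this
      · simp [hq]
    · simp [hg]

theorem run_xorCircuit (g : Bool → Bool) (l : List (R × ℕ)) (f o : Bool) (ρ : R → ℕ)
    (ω : (Fin K → Desc W) → ℂ) :
    run P (xorCircuit K w g l) (emb (regState w f o ρ) ω) =
      emb (regState w f o (if g f then xorState ρ l else ρ)) ω := by
  induction l generalizing ρ with
  | nil =>
    have : xorState ρ ([] : List (R × ℕ)) = ρ := by funext r; simp [xorState, xorVal]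
    simp [xorCircuit, this]
  | cons p l ih =>
    obtain ⟨r, v⟩ := p
    rw [xorCircuit, List.flatMap_cons, run_append, run_flip_list g r v _ _ _ (List.nodup_finRange w)]
    have e : (fun q => xor (regState w f o ρ q) (g (regState w f o ρ (ancilla R w false)) &&
        decide (∃ j ∈ List.finRange w, q = regQubit w r j ∧ v.testBit j))) =
        regState w f o (if g f then Function.update ρ r (ρ r ^^^ v) else ρ) := by
      funext q
      refine qubit_cases (p := fun q => xor (regState w f o ρ q)
        (g (regState w f o ρ (ancilla R w false)) &&
        decide (∃ j ∈ List.finRange w, q = regQubit w r j ∧ v.testBit j)) =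
        regState w f o (if g f then Function.update ρ r (ρ r ^^^ v) else ρ) q) ?_ ?_ ?_ q
      · simp [(regQubit_ne_ancilla _ _ _).symm]
      · simp [(regQubit_ne_ancilla _ _ _).symm]
      · intro s j
        by_cases hg : g f
        · by_cases hs : s = r
          · subst hs; simp [regQubit_inj, hg]
          · simp [regQubit_inj, hg, hs]
        · simp [hg]
    rw [e]
    have := ih (if g f then Function.update ρ r (ρ r ^^^ v) else ρ)
    rw [xorCircuit] at this
    rw [this]
    by_cases hg : g f
    · simp only [hg, if_true]
      congr 2
      funext s
      by_cases hs : s = r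
      · subst hs; simp [xorState, xorVal, Nat.xor_assoc]
      · simp [xorState, xorVal, hs]
    · simp [hg]

/-- Basis state of the registers, with ancillas at rest, tensored with a state of the work
registers. -/
noncomputable def regVec (w : ℕ) (ρ : R → ℕ) (ω : (Fin K → Desc W) → ℂ) :
    Config (qubits R w) K W → ℂ := emb (regState w false true ρ) ω

/-- The list of all qubits of the registers of a list. -/
noncomputable def testQubits (w : ℕ) (l : List (R × ℕ)) : List (Fin (qubits R w)) :=
  l.flatMap fun p => (List.finRange w).map (regQubit w p.1)

theorem mem_testQubits {l : List (R × ℕ)} {q : Fin (qubits R w)} :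
    q ∈ testQubits w l ↔ ∃ r ∈ l.map Prod.fst, ∃ j, regQubit w r j = q := by
  simp [testQubits]

theorem testQubits_ne_ancilla {l : List (R × ℕ)} (e : Bool) (i) :
    (testQubits w l).get i ≠ ancilla R w e := by
  obtain ⟨r, -, j, h⟩ := mem_testQubits.1 (List.get_mem (testQubits w l) i)
  rw [← h]; exact regQubit_ne_ancilla r j e

/-- Swap the ancillas if all registers of the list are zero. -/
noncomputable def zeroTest (K w : ℕ) (l : List (R × ℕ)) : Gate (qubits R w) K :=
  .qrag (m := 1) (testQubits w l).get (ancilla R w false)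
    ⟨fun _ => ancilla R w true, fun _ _ _ => Subsingleton.elim _ _⟩
    (testQubits_ne_ancilla false) (fun i _ => testQubits_ne_ancilla true i)
    (fun _ => show ancilla R w false ≠ ancilla R w true by simp [ancilla_inj])

theorem regVal_eq_zero_iff {N m : ℕ} {r : Fin m → Fin N} {x : Fin N → Bool} :
    regVal r x = 0 ↔ ∀ i, x (r i) = false := by
  simp [regVal]

/-- The QRAG memory has a single cell, so the address is in range exactly if all tested qubits
vanish. One gate thus does the work of a multiply controlled one: from the resting ancillas `(false,
true)`, the swap raises the first ancilla. -/
theorem run_zeroTest_pos {l : List (R × ℕ)} {ρ : R → ℕ} (h : ∀ r ∈ l.map Prod.fst, ρ r = 0)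
    (f o : Bool) (ω : (Fin K → Desc W) → ℂ) :
    run P [zeroTest K w l] (emb (regState w f o ρ) ω) = emb (regState w o f ρ) ω := by
  rw [run_singleton, zeroTest, Gate.toMatrix]
  refine basisMatrix_emb fun z _ => ?_
  have h0 : regVal (testQubits w l).get (regState w f o ρ) = 0 := by
    rw [regVal_eq_zero_iff]
    intro i
    obtain ⟨r, hr, j, h'⟩ := mem_testQubits.1 (List.get_mem (testQubits w l) i)
    rw [← h', regState_regQubit, h r hr, Nat.zero_testBit]
  rw [qragMap, dif_pos (by rw [h0]; exact Nat.one_pos)]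
  refine Prod.ext (funext fun q => ?_) rfl
  simp only []
  refine qubit_cases (p := fun q => regState w f o ρ
    (Equiv.swap (ancilla R w false) (ancilla R w true) q) = regState w o f ρ q) ?_ ?_ ?_ q
  · simp
  · simp
  · intro r j
    rw [Equiv.swap_apply_of_ne_of_ne (regQubit_ne_ancilla r j _) (regQubit_ne_ancilla r j _)]
    simp

theorem run_zeroTest_neg {l : List (R × ℕ)} {ρ : R → ℕ} {r : R} (hr : r ∈ l.map Prod.fst)
    (h : ρ r ≠ 0) (h' : ρ r < 2 ^ w) (f o : Bool) (ω : (Fin K → Desc W) → ℂ) :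
    run P [zeroTest K w l] (emb (regState w f o ρ) ω) = emb (regState w f o ρ) ω := by
  rw [run_singleton, zeroTest, Gate.toMatrix]
  refine basisMatrix_emb fun z _ => ?_
  rw [qragMap, dif_neg]
  rw [Nat.lt_one_iff, regVal_eq_zero_iff]
  intro h0
  obtain ⟨j, hj⟩ := Nat.exists_testBit_of_ne_zero h
  -- A set bit lies within the width of the register and hence belongs to the address.
  have hjw : j < w := by
    by_contra hjw
    push Not at hjw
    rw [Nat.testBit_lt_two_pow (h'.trans_le (Nat.pow_le_pow_right (by norm_num) hjw))] at hj
    simp at hj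
  obtain ⟨i, hi⟩ := List.get_of_mem (mem_testQubits.2 ⟨r, hr, ⟨j, hjw⟩, rfl⟩)
  have := h0 i
  rw [hi] at this
  simp only [regState_regQubit, hj] at this
  simp at this

/-- XOR numbers to registers if the registers of `cs` hold the numbers of `cs`. -/
noncomputable def controlled (K w : ℕ) (cs xs : List (R × ℕ)) : List (Gate (qubits R w) K) :=
  (xorCircuit K w (fun _ => true) cs ++ [zeroTest K w cs] ++ xorCircuit K w (fun _ => true) cs) ++
    xorCircuit K w id xs ++
  circuitInv
    (xorCircuit K w (fun _ => true) cs ++ [zeroTest K w cs] ++ xorCircuit K w (fun _ => true) cs)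

theorem run_test_pos {cs : List (R × ℕ)} {ρ : R → ℕ} (h : Matches ρ cs)
    (ω : (Fin K → Desc W) → ℂ) :
    run P (xorCircuit K w (fun _ => true) cs ++ [zeroTest K w cs] ++
      xorCircuit K w (fun _ => true) cs) (emb (regState w false true ρ) ω) =
      emb (regState w true false ρ) ω := by
  rw [run_append, run_append, run_xorCircuit, if_pos rfl, run_zeroTest_pos, run_xorCircuit,
    if_pos rfl, xorState_xorState]
  intro r hr
  simp [xorState, h r hr]

/-- The XOR leaves the tested registers alone, so the inverse test still recognises the pattern and
returns the ancillas to rest. -/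
theorem run_controlled_pos {cs xs : List (R × ℕ)} {ρ : R → ℕ} (h : Matches ρ cs)
    (hd : ∀ r ∈ cs.map Prod.fst, r ∉ xs.map Prod.fst) (ω : (Fin K → Desc W) → ℂ) :
    run P (controlled K w cs xs) (regVec w ρ ω) = regVec w (xorState ρ xs) ω := by
  have h' : Matches (xorState ρ xs) cs := fun r hr => by
    rw [xorState, xorVal_of_notMem (hd r hr), Nat.xor_zero, h r hr]
  rw [controlled, regVec, run_append, run_append, run_test_pos h, run_xorCircuit]
  exact run_circuitInv (run_test_pos h' ω)

theorem run_controlled_neg {cs xs : List (R × ℕ)} {ρ : R → ℕ} {r : R}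
    (hr : r ∈ cs.map Prod.fst) (h : ρ r ≠ xorVal cs r) (h₁ : ρ r < 2 ^ w)
    (h₂ : xorVal cs r < 2 ^ w) (ω : (Fin K → Desc W) → ℂ) :
    run P (controlled K w cs xs) (regVec w ρ ω) = regVec w ρ ω := by
  have key : run P (xorCircuit K w (fun _ => true) cs ++ [zeroTest K w cs] ++
      xorCircuit K w (fun _ => true) cs) (emb (regState w false true ρ) ω) =
      emb (regState w false true ρ) ω := by
    rw [run_append, run_append, run_xorCircuit, if_pos rfl, run_zeroTest_neg hr, run_xorCircuit,
      if_pos rfl, xorState_xorState]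
    · simpa [xorState] using h
    · exact Nat.xor_lt_two_pow h₁ h₂
  rw [controlled, regVec, run_append, run_append, key, run_xorCircuit]
  exact run_circuitInv key

/-- Exchange the pattern `p` (in registers that are otherwise `0`) with the number `1` in
register `c`. -/
noncomputable def move (K w : ℕ) (p : List (R × ℕ)) (c : R) : List (Gate (qubits R w) K) :=
  controlled K w p [(c, 1)] ++ controlled K w [(c, 1)] p

/-- The first half writes `1` to `c`; the second, controlled by this `1`, erases the pattern. The
particle changes registers without leaving a trace. -/
theorem run_move_pos {p : List (R × ℕ)} {c : R} {ρ : R → ℕ} (h : ∀ r ∈ p.map Prod.fst, ρ r = 0)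
    (hp : c ∉ p.map Prod.fst) (hc : ρ c = 0) (ω : (Fin K → Desc W) → ℂ) :
    run P (move K w p c) (regVec w (xorState ρ p) ω) = regVec w (Function.update ρ c 1) ω := by
  rw [move, run_append, run_controlled_pos (matches_xorState h)
    (by intro r hr h'; simp only [List.map_cons, List.map_nil, List.mem_singleton] at h'
        exact hp (h' ▸ hr)), run_controlled_pos]
  · congr 1
    funext r
    by_cases hr : r = c
    · subst hr; simp [xorState, xorVal, hc, xorVal_of_notMem hp]
    · simp [xorState, xorVal, hr]
  · intro r hr
    simp only [List.map_cons, List.map_nil, List.mem_singleton] at hr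
    subst hr
    simp [xorState, xorVal, hc, xorVal_of_notMem hp]
  · simpa using hp

theorem run_move_neg {p : List (R × ℕ)} {c : R} {ρ : R → ℕ} {r : R} (hr : r ∈ p.map Prod.fst)
    (h : ρ r ≠ xorVal p r) (h₁ : ρ r < 2 ^ w) (h₂ : xorVal p r < 2 ^ w) (hc : ρ c = 0)
    (hw : 0 < w) (ω : (Fin K → Desc W) → ℂ) :
    run P (move K w p c) (regVec w ρ ω) = regVec w ρ ω := by
  rw [move, run_append, run_controlled_neg hr h h₁ h₂,
    run_controlled_neg (r := c) (by simp) (by simp [hc, xorVal]) (by simp [hc])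
      (by simpa [xorVal] using hw.ne')]

/-! Bounds for the numbers of gates. -/

theorem length_xorCircuit_le (g : Bool → Bool) (l : List (R × ℕ)) :
    (xorCircuit K w g l).length ≤ l.length * w := by
  induction l with
  | nil => simp [xorCircuit]
  | cons p l ih =>
    rw [xorCircuit, List.flatMap_cons, List.length_append, List.length_cons, add_mul, one_mul,
      add_comm]
    refine add_le_add ih ?_
    rw [List.length_flatMap]
    refine (List.sum_le_card_nsmul _ 1 ?_).trans (by simp)
    intro n hn
    simp only [List.mem_map] at hn
    obtain ⟨j, -, rfl⟩ := hn
    split_ifs <;> simp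

@[simp] theorem length_circuitInv {N : ℕ} (c : List (Gate N K)) :
    (circuitInv c).length = c.length := by simp [circuitInv]

theorem length_controlled_le (cs xs : List (R × ℕ)) :
    (controlled K w cs xs).length ≤ (4 * cs.length + xs.length) * w + 2 := by
  have h₁ := length_xorCircuit_le (K := K) (w := w) (fun _ => true) cs
  have h₂ := length_xorCircuit_le (K := K) (w := w) id xs
  simp only [controlled, List.length_append, length_circuitInv, List.length_singleton]
  linarith

theorem length_move_le (p : List (R × ℕ)) (c : R) :
    (move K w p c).length ≤ (5 * p.length + 5) * w + 4 := by
  have h₁ := length_controlled_le (K := K) (w := w) p [(c, 1)]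
  have h₂ := length_controlled_le (K := K) (w := w) [(c, 1)] p
  simp only [move, List.length_append, List.length_singleton] at *
  linarith

theorem queryCount_append {N : ℕ} (c c' : List (Gate N K)) :
    queryCount (c ++ c') = queryCount c + queryCount c' := List.countP_append

theorem queryCount_circuitInv {N : ℕ} (c : List (Gate N K)) :
    queryCount (circuitInv c) = queryCount c := by
  rw [queryCount, circuitInv, List.countP_reverse, List.countP_map, queryCount]
  congr 1
  funext g
  cases g <;> rfl

theorem queryCount_flatMap {N : ℕ} {ι : Type} (f : ι → List (Gate N K)) (l : List ι) :
    queryCount (l.flatMap f) = (l.map fun i => queryCount (f i)).sum := by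
  induction l with
  | nil => rfl
  | cons i l ih => rw [List.flatMap_cons, queryCount_append, ih]; simp

theorem queryCount_flatMap_eq_zero {N : ℕ} {ι : Type} {f : ι → List (Gate N K)} {l : List ι}
    (h : ∀ i, queryCount (f i) = 0) : queryCount (l.flatMap f) = 0 := by
  rw [queryCount_flatMap]; simp [h]

theorem length_flatMap_le {α ι : Type} {f : ι → List α} {l : List ι} {m : ℕ}
    (h : ∀ i, (f i).length ≤ m) : (l.flatMap f).length ≤ l.length * m := by
  rw [List.length_flatMap]
  refine (List.sum_le_card_nsmul _ m ?_).trans (by simp)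
  intro n hn
  obtain ⟨i, -, rfl⟩ := List.mem_map.1 hn
  exact h i

theorem queryCount_xorCircuit (g : Bool → Bool) (l : List (R × ℕ)) :
    queryCount (xorCircuit K w g l) = 0 := by
  refine queryCount_flatMap_eq_zero fun p => queryCount_flatMap_eq_zero fun j => ?_
  split_ifs <;> rfl

theorem queryCount_controlled (cs xs : List (R × ℕ)) :
    queryCount (controlled K w cs xs) = 0 := by
  have : queryCount [zeroTest K w cs] = 0 := rfl
  simp only [controlled, queryCount_append, queryCount_circuitInv, queryCount_xorCircuit, this]

theorem queryCount_move (p : List (R × ℕ)) (c : R) : queryCount (move K w p c) = 0 := by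
  simp only [move, queryCount_append, queryCount_controlled]

end Registers

/-! ### The registers and the circuits of the walk -/

section Gates

variable {N K W a : ℕ} {b n₀ : ℝ} {Taux : ℝ → ℕ} {P : OrDivideConquer a b n₀ Taux W}

/-- A diagonal two-qubit gate with entries `±1`. -/
def signUnitary (g : Bool × Bool → Bool) : Matrix.unitaryGroup (Bool × Bool) ℂ :=
  ⟨Matrix.diagonal fun c => if g c then -1 else 1, mem_unitaryGroup_of_star_mul (by
    rw [Matrix.diagonal_conjTranspose, Matrix.diagonal_mul_diagonal, ← Matrix.diagonal_one]
    congr 1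
    funext c
    simp only [Pi.star_apply]
    split_ifs <;> simp)⟩

theorem signUnitary_mulVec_emb {p q : Fin N} (hpq : p ≠ q) (g : Bool × Bool → Bool)
    (x : Fin N → Bool) (ω : (Fin K → Desc W) → ℂ) :
    twoMatrix p q (signUnitary g : Matrix _ _ ℂ) *ᵥ emb x ω =
      (if g (x p, x q) then -1 else 1 : ℂ) • emb x ω := by
  rw [twoMatrix_emb hpq, Finset.sum_eq_single (x p, x q)]
  · simp [signUnitary, setPair]
  · intro c _ hc
    simp [signUnitary, Matrix.diagonal_apply_ne _ hc]
  · simp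

/-- A rotation in the span of `|10⟩` and `|01⟩`. -/
noncomputable def exchangeMatrix (θ : ℝ) : Matrix (Bool × Bool) (Bool × Bool) ℂ :=
  Matrix.of fun y x =>
    match x, y with
    | (true, false), (true, false) => Complex.cos θ
    | (true, false), (false, true) => -Complex.sin θ
    | (false, true), (true, false) => Complex.sin θ
    | (false, true), (false, true) => Complex.cos θ
    | (false, false), (false, false) => 1
    | (true, true), (true, true) => 1
    | _, _ => 0

theorem exchangeMatrix_unitary (θ : ℝ) :
    exchangeMatrix θ ∈ Matrix.unitaryGroup (Bool × Bool) ℂ := by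
  apply mem_unitaryGroup_of_star_mul
  have h := Complex.cos_sq_add_sin_sq (θ : ℂ)
  have hc : (starRingEnd ℂ) (Complex.cos θ) = Complex.cos θ := by
    rw [← Complex.cos_conj, Complex.conj_ofReal]
  have hs : (starRingEnd ℂ) (Complex.sin θ) = Complex.sin θ := by
    rw [← Complex.sin_conj, Complex.conj_ofReal]
  ext ⟨y1, y2⟩ ⟨x1, x2⟩
  cases y1 <;> cases y2 <;> cases x1 <;> cases x2 <;>
    simp [Matrix.mul_apply, Fintype.sum_prod_type, exchangeMatrix, hc, hs] <;>
    first | linear_combination h | ring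

/-- The rotation in the span of `|10⟩` and `|01⟩` by an angle. -/
noncomputable def exchangeUnitary (θ : ℝ) : Matrix.unitaryGroup (Bool × Bool) ℂ :=
  ⟨exchangeMatrix θ, exchangeMatrix_unitary θ⟩

theorem sqrt_half_mul_self : (((√2)⁻¹ : ℝ) : ℂ) * ((√2)⁻¹ : ℝ) = 1 / 2 := by
  rw [← Complex.ofReal_mul, ← mul_inv, Real.mul_self_sqrt (by norm_num)]
  norm_num

/-- The rotation of the first of two qubits that maps `|0⟩` to `(|0⟩ + |1⟩) / √2` and `|1⟩` to
`(|1⟩ - |0⟩) / √2`. -/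
noncomputable def mixMatrix : Matrix (Bool × Bool) (Bool × Bool) ℂ :=
  Matrix.of fun y x =>
    if y.2 = x.2 then if x.1 && !y.1 then -((√2)⁻¹ : ℝ) else ((√2)⁻¹ : ℝ) else 0

theorem mixMatrix_unitary : mixMatrix ∈ Matrix.unitaryGroup (Bool × Bool) ℂ := by
  apply mem_unitaryGroup_of_star_mul
  have h := sqrt_half_mul_self
  ext ⟨y1, y2⟩ ⟨x1, x2⟩
  cases y1 <;> cases y2 <;> cases x1 <;> cases x2 <;>
    simp only [Matrix.mul_apply, Fintype.sum_prod_type, Fintype.sum_bool, mixMatrix, Matrix.of_apply,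
      Matrix.conjTranspose_apply, RCLike.star_def, Matrix.one_apply] <;>
    simp [-Complex.ofReal_inv, Complex.conj_ofReal, h] <;> norm_num

theorem mixMatrix_mulVec_emb {p q : Fin N} (hpq : p ≠ q)
    (x : Fin N → Bool) (ω : (Fin K → Desc W) → ℂ) :
    twoMatrix p q mixMatrix *ᵥ emb x ω = (((√2)⁻¹ : ℝ) : ℂ) •
      ((if x p then -1 else 1 : ℂ) • emb (Function.update x p false) ω +
        emb (Function.update x p true) ω) := by
  have e : ∀ c, setPair p q (c, x q) x = Function.update x p c := by
    intro c
    funext s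
    by_cases hs : s = q
    · subst hs; simp [setPair, Function.update_of_ne hpq.symm]
    · simp [setPair, hs]
  rw [twoMatrix_emb hpq, Fintype.sum_prod_type]
  simp only [Fintype.sum_bool]
  cases hq : x q <;> cases hp : x p <;>
    simp only [mixMatrix, Matrix.of_apply, ← e, hq] <;>
    simp [-Complex.ofReal_inv, smul_add, add_comm]

end Gates

/-- The registers of the walk. -/
inductive WalkReg (a D : ℕ) : Type
  /-- Level of a particle that moves down (`false`) or up (`true`). -/
  | lev (e : Bool)
  | time
  | idx
  | cnt
  | ctl
  | pub
  | flag
  | mlev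
  | slot (k : Fin (D + 1))
  | coin (c : Option (Fin a))
  deriving DecidableEq, Fintype

open WalkReg

/-- The parameters of the walk: number of children, depth, logarithm of the number of iterations,
width of the registers, lengths of the edges. -/
structure WalkData where
  a : ℕ
  D : ℕ
  κ : ℕ
  w : ℕ
  L : ℕ → ℕ
  a_pos : 1 ≤ a
  a_le : a ≤ 2 ^ w
  D_lt : D + 1 < 2 ^ w
  κ_le : κ ≤ w
  L_lt : ∀ k, L k < 2 ^ w
  L_pos : ∀ k, 1 ≤ L k

namespace WalkData

variable (G : WalkData)

theorem w_pos : 0 < G.w := by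
  by_contra h
  have := G.D_lt
  have h' : G.w = 0 := by omega
  simp [h'] at this

abbrev Reg : Type := WalkReg G.a G.D

abbrev size : ℕ := qubits G.Reg G.w

abbrev Circuit : Type := List (Gate G.size (G.D + 1))

/-- The lowest qubit of a register. -/
noncomputable def low (r : G.Reg) : Fin G.size := regQubit G.w r ⟨0, G.w_pos⟩

variable {G} in
theorem low_ne {r r' : G.Reg} (h : r ≠ r') : G.low r ≠ G.low r' := by
  simp [low, regQubit_inj, h]

/-- The port to the parent of a node at level `j`; at the root, the outside world. -/
def parPat (τ : ℕ) (e : Bool) (j : ℕ) : List (G.Reg × ℕ) :=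
  -- At the root the pattern includes the counter, which is erased on entry: inside the tree nothing
  -- remembers the time slot, so one wave serves all slots. The direction plays no role there.
  if j = 0 then [(pub, 1), (ctl, 1), (cnt, τ)] else [(lev e, j), (time, G.L j)]

/-- The port to the `i`-th child of a node at level `j`. -/
def childPat (e : Bool) {j : ℕ} (h : j < G.D) (i : Fin G.a) : List (G.Reg × ℕ) :=
  [(lev e, j + 1), (time, 0), (slot ⟨j + 1, by omega⟩, i)]

/-- Move the particle from the ports of the nodes at level `j` to the coin registers. -/
noncomputable def convIn (τ : ℕ) (e : Bool) (j : ℕ) : G.Circuit :=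
  -- A particle that arrives from the parent moves down, one that arrives from a child moves up;
  -- hence the opposite directions. The inverse with `e = true` describes departure.
  move _ G.w (G.parPat τ e j) (coin none) ++
    if h : j < G.D then
      (List.finRange G.a).flatMap fun i => move _ G.w (G.childPat (!e) h i) (coin (some i))
    else []

/-- The angle of the rotation that maps `(p, g)` to the first axis. -/
noncomputable def angle (p g : ℝ) : ℝ := Complex.arg ⟨p, g⟩

/-- Rotations that collect the amplitudes of the children in the amplitude of the parent. -/
noncomputable def givens (g : ℝ) : ℝ → List (Fin G.a) → G.Circuit
  | _, [] => []
  | p, i :: l => .two (G.low (coin none)) (G.low (coin (some i))) (low_ne (by simp))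
      (exchangeUnitary (angle p g)) :: givens g ‖(⟨p, g⟩ : ℂ)‖ l

/-- The amplitude of a child relative to that of its parent. -/
noncomputable def ratio : ℝ := (√(√G.a))⁻¹

/-- Change the sign if the particle is at the port to the parent. -/
noncomputable def signGate : Gate G.size (G.D + 1) :=
  .two (G.low (coin none)) (ancilla _ _ false) (regQubit_ne_ancilla _ _ _) (signUnitary Prod.fst)

/-- The work registers are numbered from `0` to `G.D`. Level `G.D + 1` is therefore out of range and
switches the marking oracle off when no particle is at a leaf. -/
noncomputable def leafLevel : G.Circuit :=
  controlled _ G.w [(coin none, 1)] [(mlev, G.D)] ++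
    controlled _ G.w [(coin none, 0)] [(mlev, G.D + 1)]

noncomputable def markGate : Gate G.size (G.D + 1) :=
  .mark (regQubit G.w mlev) (G.low flag) (by simp [low, regQubit_inj])

noncomputable def leafPhase : Gate G.size (G.D + 1) :=
  .two (G.low (coin none)) (G.low flag) (low_ne (by simp)) (signUnitary fun c => c.1 && !c.2)

/-- Reflection of the particle at a leaf. -/
noncomputable def leaf : G.Circuit :=
  G.leafLevel ++ [G.markGate] ++ [G.leafPhase] ++ [G.markGate] ++ circuitInv G.leafLevel

/-- Scattering of the particle at a node. -/
noncomputable def scatter (j : ℕ) : G.Circuit :=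
  if j < G.D then
    G.givens G.ratio 1 (List.finRange G.a) ++ [G.signGate] ++
      circuitInv (G.givens G.ratio 1 (List.finRange G.a))
  else G.leaf

/-- Arrival, scattering and departure of the particle at the nodes at level `j`. -/
noncomputable def node (τ j : ℕ) : G.Circuit :=
  G.convIn τ false j ++ G.scatter j ++ circuitInv (G.convIn τ true j)

/-- Copy the index of the current child. -/
noncomputable def fetch (e : Bool) : G.Circuit :=
  -- The step oracle reads the child index from one fixed register, whereas the slot that stores it
  -- depends on the level.
  (List.finRange G.D ×ˢ List.finRange G.a).flatMap fun p =>
    controlled _ G.w [(lev e, p.1 + 1), (slot p.1.succ, p.2)] [(idx, p.2)]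

noncomputable def timeEmb : Fin G.w ↪ Fin G.size :=
  ⟨regQubit G.w time, fun _ _ h => (regQubit_inj.1 h).2⟩

noncomputable def stepGate (e : Bool) : Gate G.size (G.D + 1) :=
  .step false (regQubit G.w (lev e)) (regQubit G.w idx)
    G.timeEmb
    (fun i j => show regQubit G.w (lev e) i ≠ regQubit G.w time j by simp [regQubit_inj])
    (fun i j => show regQubit G.w idx i ≠ regQubit G.w time j by simp [regQubit_inj])

/-- Step of the particles that move in the direction `e`. -/
noncomputable def stepHalf (e : Bool) : G.Circuit :=
  G.fetch e ++ [G.stepGate e] ++ circuitInv (G.fetch e)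

/-- Step of all particles. -/
noncomputable def steps : G.Circuit := G.stepHalf false ++ circuitInv (G.stepHalf true)

/-- Scattering at all nodes. -/
noncomputable def nodes (τ : ℕ) : G.Circuit := (List.range (G.D + 1)).flatMap (G.node τ)

variable {G}

/-- Basis state in which only the path to a node is stored. -/
def pathState (sl : Fin (G.D + 1) → ℕ) : G.Reg → ℕ
  | slot k => sl k
  | _ => 0

/-- Basis state of a particle on an edge. -/
def arc (e : Bool) (k t : ℕ) (sl : Fin (G.D + 1) → ℕ) : G.Reg → ℕ :=
  Function.update (Function.update (pathState sl) (lev e) k) time t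

/-- Basis state of a particle in a coin register. -/
def coinState (c : Option (Fin G.a)) (sl : Fin (G.D + 1) → ℕ) : G.Reg → ℕ :=
  Function.update (pathState sl) (coin c) 1

/-! ### Ports, and their conversion to coin states. -/

theorem xorState_parPat {τ j : ℕ} {e : Bool} (hj : j ≠ 0) (sl : Fin (G.D + 1) → ℕ) :
    xorState (pathState sl) (G.parPat τ e j) = arc e j (G.L j) sl := by
  funext r
  cases r <;> simp [xorState, xorVal, parPat, hj, arc, pathState, Function.update_apply]

theorem xorState_childPat {j : ℕ} {e : Bool} (hj : j < G.D) (i : Fin G.a)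
    {sl : Fin (G.D + 1) → ℕ} (hs : sl ⟨j + 1, by omega⟩ = 0) :
    xorState (pathState sl) (G.childPat e hj i) =
      arc e (j + 1) 0 (Function.update sl ⟨j + 1, by omega⟩ i) := by
  funext r
  cases r with
  | slot k =>
    by_cases hk : k = ⟨j + 1, by omega⟩
    · subst hk; simp [xorState, xorVal, childPat, arc, pathState, hs]
    · simp [xorState, xorVal, childPat, arc, pathState, hk]
  | _ => simp [xorState, xorVal, childPat, arc, pathState, Function.update_apply]

theorem a_lt (i : Fin G.a) : (i : ℕ) < 2 ^ G.w := i.2.trans_le G.a_le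

theorem pow_pos' : 0 < 2 ^ G.w := by positivity

theorem one_lt_pow : 1 < 2 ^ G.w := Nat.one_lt_two_pow G.w_pos.ne'

variable {W : ℕ} {b n₀ : ℝ} {Taux : ℝ → ℕ} {P : OrDivideConquer G.a b n₀ Taux W}
  {τ j : ℕ} {e : Bool} {sl : Fin (G.D + 1) → ℕ} (ω : (Fin (G.D + 1) → Desc W) → ℂ)

theorem run_childMoves_fixed (hj : j < G.D) {ρ : G.Reg → ℕ} (hρ : ∀ r, ρ r < 2 ^ G.w)
    (hc : ∀ i, ρ (coin (some i)) = 0) (h : ρ (lev e) ≠ j + 1 ∨ ρ time ≠ 0) (i : Fin G.a) :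
    run P (move _ G.w (G.childPat e hj i) (coin (some i))) (regVec G.w ρ ω) =
      regVec G.w ρ ω := by
  have hD := G.D_lt
  rcases h with h | h
  · exact run_move_neg (r := lev e) (by simp [childPat]) (by simpa [childPat, xorVal] using h)
      (hρ _) (by simp [childPat, xorVal]; omega) (hc i) G.w_pos _
  · exact run_move_neg (r := time) (by simp [childPat]) (by simpa [childPat, xorVal] using h)
      (hρ _) (by simp [childPat, xorVal]) (hc i) G.w_pos _

theorem xorVal_parPat_lt (hj : j ≤ G.D) (hτ : τ < 2 ^ G.w) (r) (hr : r ∈ (G.parPat τ e j).map Prod.fst) :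
    xorVal (G.parPat τ e j) r < 2 ^ G.w := by
  have hD := G.D_lt
  have := G.L_lt j
  have := G.one_lt_pow
  by_cases h0 : j = 0
  · simp only [parPat, h0, if_true, List.map_cons, List.map_nil, List.mem_cons, List.not_mem_nil,
      or_false] at hr ⊢
    rcases hr with rfl | rfl | rfl <;> simp [xorVal, G.w_pos.ne', hτ]
  · simp only [parPat, h0, if_false, List.map_cons, List.map_nil, List.mem_cons, List.not_mem_nil,
      or_false] at hr ⊢
    rcases hr with rfl | rfl <;> simp [xorVal] <;> omega

theorem run_convIn_fixed (hj : j ≤ G.D) (hτ : τ < 2 ^ G.w) {ρ : G.Reg → ℕ}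
    (hρ : ∀ r, ρ r < 2 ^ G.w) (hc : ∀ c, ρ (coin c) = 0) (h₁ : ¬ Matches ρ (G.parPat τ e j))
    (h₂ : ρ (lev !e) ≠ j + 1 ∨ ρ time ≠ 0) :
    run P (G.convIn τ e j) (regVec G.w ρ ω) = regVec G.w ρ ω := by
  rw [Matches] at h₁
  push Not at h₁
  obtain ⟨r, hr, h₁⟩ := h₁
  rw [convIn, run_append, run_move_neg hr h₁ (hρ r) (xorVal_parPat_lt hj hτ r hr) (hc _) G.w_pos]
  split_ifs with h
  · exact run_flatMap_of_fixed fun i _ => run_childMoves_fixed ω h hρ (fun i => hc _) h₂ i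
  · simp

theorem coinState_lt (hs : ∀ k, sl k < 2 ^ G.w) (c : Option (Fin G.a)) (r : G.Reg) :
    coinState c sl r < 2 ^ G.w := by
  have := G.one_lt_pow
  cases r <;> simp [coinState, pathState, Function.update_apply, hs]
  split_ifs <;> omega

theorem arc_lt (hs : ∀ k, sl k < 2 ^ G.w) {k t : ℕ} (hk : k ≤ G.D) (ht : t < 2 ^ G.w) (r : G.Reg) :
    arc e k t sl r < 2 ^ G.w := by
  have := G.D_lt
  cases r <;> simp [arc, pathState, Function.update_apply, hs, ht]
  split_ifs <;> omega

/-- Once the particle is in the coin register both level registers are `0`, so no child pattern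
matches any more. -/
theorem run_convIn_par (hs : ∀ k, sl k < 2 ^ G.w) :
    run P (G.convIn τ e j) (regVec G.w (xorState (pathState sl) (G.parPat τ e j)) ω) =
      regVec G.w (coinState none sl) ω := by
  rw [convIn, run_append, run_move_pos]
  · split_ifs with h
    · exact run_flatMap_of_fixed fun i _ => run_childMoves_fixed ω h (coinState_lt hs none)
        (by simp [coinState, pathState]) (by simp [coinState, pathState]) i
    · simp [coinState]
  · intro r hr
    rw [parPat] at hr
    split_ifs at hr <;> simp at hr
    · rcases hr with rfl | rfl | rfl <;> rfl
    · rcases hr with rfl | rfl <;> rfl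
  · rw [parPat]; split_ifs <;> simp
  · rfl

/-- The parent pattern fails: `pub` is `0` if the node is the root, and otherwise the level in
direction `e` is `0`. Of the child moves, the slot selects the `i`-th; after it the level is `0`,
which disables the others. -/
theorem run_convIn_child (hj : j < G.D) (hτ : τ < 2 ^ G.w) (hs : ∀ k, sl k < 2 ^ G.w) (i : Fin G.a)
    (hsj : sl ⟨j + 1, by omega⟩ = 0) :
    run P (G.convIn τ e j)
      (regVec G.w (arc (!e) (j + 1) 0 (Function.update sl ⟨j + 1, by omega⟩ i)) ω) =
      regVec G.w (coinState (some i) sl) ω := by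
  have hs' : ∀ k, Function.update sl ⟨j + 1, by omega⟩ (i : ℕ) k < 2 ^ G.w := by
    intro k
    by_cases hk : k = ⟨j + 1, by omega⟩
    · subst hk; simp [a_lt]
    · simp [hk, hs]
  have h1 := G.one_lt_pow
  rw [convIn, run_append, dif_pos hj]
  have e1 : run P (move _ G.w (G.parPat τ e j) (coin none))
      (regVec G.w (arc (!e) (j + 1) 0 (Function.update sl ⟨j + 1, by omega⟩ i)) ω) =
      (regVec G.w (arc (!e) (j + 1) 0 (Function.update sl ⟨j + 1, by omega⟩ i)) ω) := by
    by_cases h0 : j = 0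
    · exact run_move_neg (r := pub) (by simp [parPat, h0]) (by simp [parPat, h0, arc, pathState, xorVal])
        (arc_lt hs' (by omega) (by omega) _) (by simp [parPat, h0, xorVal, h1])
        (by simp [arc, pathState]) G.w_pos _
    · refine run_move_neg (r := lev e) (by simp [parPat, h0])
        (by simp [parPat, h0, arc, pathState, xorVal]; omega)
        (arc_lt hs' (by omega) (by omega) _)
        (xorVal_parPat_lt hj.le hτ _ (by simp [parPat, h0])) (by simp [arc, pathState]) G.w_pos _
  rw [e1]
  refine run_flatMap_of_single (i := i) (List.nodup_finRange _) (List.mem_finRange i) ?_ ?_ ?_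
  · intro i' _ hi'
    refine run_move_neg (r := slot ⟨j + 1, by omega⟩) (by simp [childPat])
        (by simp [childPat, arc, pathState, xorVal, Fin.val_inj, hi'.symm])
        (arc_lt hs' (by omega) (by omega) _)
        (by simp [childPat, xorVal, a_lt]) (by simp [arc, pathState]) G.w_pos _
  · rw [← xorState_childPat hj i hsj, run_move_pos]
    · rfl
    · intro r hr
      simp only [childPat, List.map_cons, List.map_nil, List.mem_cons, List.not_mem_nil,
        or_false] at hr
      rcases hr with rfl | rfl | rfl
      · rfl
      · rfl
      · exact hsj
    · simp [childPat]
    · rfl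
  · intro i' _ hi'
    refine run_move_neg (r := lev !e) (by simp [childPat])
        (by simp [childPat, coinState, pathState, xorVal])
        (coinState_lt hs _ _) (by have := G.D_lt; simp [childPat, xorVal]; omega)
        (by simp [coinState, pathState, hi']) G.w_pos _

/-! Steps. -/

theorem run_fetch_idle {ρ : G.Reg → ℕ} (hρ : ρ (lev e) = 0) :
    run P (G.fetch e) (regVec G.w ρ ω) = regVec G.w ρ ω := by
  have hD := G.D_lt
  refine run_flatMap_of_fixed fun p _ => ?_
  have := p.1.2
  exact run_controlled_neg (r := lev e) (by simp) (by simp [hρ, xorVal]) (by simp [hρ])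
    (by simp [xorVal]; omega) _

theorem toMatrix_stepGate : (G.stepGate e).toMatrix P =
    stepMatrix P (regQubit G.w (lev e)) (regQubit G.w idx) G.timeEmb := rfl

/-- This covers the particles that move in the other direction and those that wait outside. -/
theorem run_stepHalf_idle {ρ : G.Reg → ℕ} (hρ : ρ (lev e) = 0) :
    run P (G.stepHalf e) (regVec G.w ρ ω) = regVec G.w ρ ω := by
  rw [stepHalf, run_append, run_append, run_fetch_idle ω hρ, run_singleton, regVec,
    toMatrix_stepGate, stepMatrix_emb_idle]
  · exact run_circuitInv (run_fetch_idle ω hρ)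
  · rw [regVal_regState _ _ _ _ (by simp [hρ]), hρ]

theorem run_fetch {j : ℕ} (hj : j < G.D) {t : ℕ} (ht : t < 2 ^ G.w) (hs : ∀ k, sl k < 2 ^ G.w)
    (i : Fin G.a) (hi : sl ⟨j + 1, by omega⟩ = i) :
    run P (G.fetch e) (regVec G.w (arc e (j + 1) t sl) ω) =
      regVec G.w (Function.update (arc e (j + 1) t sl) idx i) ω := by
  have hD := G.D_lt
  have hneg : ∀ ρ : G.Reg → ℕ, (∀ r, ρ r < 2 ^ G.w) → ρ (lev e) = j + 1 →
      ρ (slot ⟨j + 1, by omega⟩) = i → ∀ p : Fin G.D × Fin G.a, p ≠ (⟨j, hj⟩, i) →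
      run P (controlled _ G.w [(lev e, p.1 + 1), (slot p.1.succ, p.2)] [(idx, p.2)])
        (regVec G.w ρ ω) = regVec G.w ρ ω := by
    intro ρ hρ h1 h2 p hp
    have := p.1.2
    by_cases h : (p.1 : ℕ) = j
    · have h' : p.1 = ⟨j, hj⟩ := Fin.ext h
      have h'' : (i : ℕ) ≠ p.2 := by
        intro h''; exact hp (Prod.ext h' (Fin.ext h''.symm))
      refine run_controlled_neg (r := slot ⟨j + 1, by omega⟩) (by simp [h'])
        (by simpa [xorVal, h', h2] using h'') (hρ _) (by simp [xorVal, h', a_lt]) _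
    · exact run_controlled_neg (r := lev e) (by simp) (by simp [h1, xorVal]; omega) (hρ _)
        (by simp [xorVal]; omega) _
  refine run_flatMap_of_single (i := (⟨j, hj⟩, i))
    (List.Nodup.product (List.nodup_finRange _) (List.nodup_finRange _)) (by simp) ?_ ?_ ?_
  · exact fun p _ hp => hneg _ (arc_lt hs (by omega) ht) (by simp [arc]) (by simp [arc, pathState, hi])
      p hp
  · rw [run_controlled_pos]
    · congr 1
      funext r
      by_cases hr : r = idx
      · subst hr; simp [xorState, xorVal, arc, pathState]
      · simp [xorState, xorVal, hr]
    · intro r hr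
      simp at hr
      rcases hr with rfl | rfl
      · simp [arc, xorVal]
      · simp [arc, xorVal, pathState, hi]
    · intro r hr
      simp at hr
      rcases hr with rfl | rfl <;> simp
  · refine fun p _ hp => hneg _ ?_ (by simp [arc]) (by simp [arc, pathState, hi]) p hp
    intro r
    by_cases hr : r = idx
    · subst hr; simp [a_lt]
    · simpa [hr] using arc_lt hs (by omega) ht r

/-- The fetched index can be erased after the step because fetching does not depend on the time. -/
theorem run_stepHalf {j : ℕ} (hj : j < G.D) {t : ℕ} (ht : t + 1 < 2 ^ G.w)
    (hs : ∀ k, sl k < 2 ^ G.w) (i : Fin G.a) (hi : sl ⟨j + 1, by omega⟩ = i)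
    (d : Fin (G.D + 1) → Desc W) (φ : Desc W → ℂ) :
    run P (G.stepHalf e) (regVec G.w (arc e (j + 1) t sl) (workVec d ⟨j + 1, by omega⟩ φ)) =
      regVec G.w (arc e (j + 1) (t + 1) sl) (workVec d ⟨j + 1, by omega⟩
        ((P.step (d ⟨j, by omega⟩) i t : Matrix _ _ ℂ) *ᵥ φ)) := by
  have hD := G.D_lt
  rw [stepHalf, run_append, run_append, run_fetch _ hj (by omega) hs i hi, run_singleton, regVec,
    toMatrix_stepGate, stepMatrix_emb P _ _ _ _ _ ⟨j + 1, by omega⟩ ⟨j, by omega⟩ rfl]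
  · have e1 : regVal (regQubit G.w idx) (regState G.w false true
        (Function.update (arc e (j + 1) t sl) idx (i : ℕ))) = i := by
      rw [regVal_regState _ _ _ _ (by simp [a_lt])]; simp
    have e2 : regVal G.timeEmb (regState G.w false true
        (Function.update (arc e (j + 1) t sl) idx (i : ℕ))) = t := by
      refine (regVal_regState _ _ _ _ (by simp [arc]; omega)).trans ?_; simp [arc]
    have e3 : regWrite G.timeEmb (t + 1) (regState G.w false true
        (Function.update (arc e (j + 1) t sl) idx (i : ℕ))) = regState G.w false true
        (Function.update (arc e (j + 1) (t + 1) sl) idx (i : ℕ)) := by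
      funext q
      revert q
      apply qubit_cases
      · rw [regWrite_of_ne]
        · simp
        · exact fun i => (regQubit_ne_ancilla _ _ _).symm
      · rw [regWrite_of_ne]
        · simp
        · exact fun i => (regQubit_ne_ancilla _ _ _).symm
      · intro r m
        by_cases hr : r = time
        · subst hr
          refine (regWrite_self _ _ _ m).trans ?_
          simp [arc]
        · rw [regWrite_of_ne]
          · rw [regState_regQubit, regState_regQubit]
            by_cases hr' : r = idx
            · subst hr'; simp
            · simp [hr', arc, hr]
          · intro m' h'
            exact hr (regQubit_inj.1 h').1
    rw [e1, e2, e3]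
    exact run_circuitInv (run_fetch _ hj ht hs i hi)
  · rw [regVal_regState]
    · simp [arc]
    · simp [arc]; omega

end WalkData

namespace WalkData

variable {G : WalkData} {W : ℕ} {b n₀ : ℝ} {Taux : ℝ → ℕ} {P : OrDivideConquer G.a b n₀ Taux W}
  {τ j : ℕ} {e : Bool} {sl : Fin (G.D + 1) → ℕ} (ω : (Fin (G.D + 1) → Desc W) → ℂ)

/-! ### Scattering at a node -/

/-- Superposition of the ports of a node. -/
noncomputable def coinVec (sl : Fin (G.D + 1) → ℕ) (ω : (Fin (G.D + 1) → Desc W) → ℂ)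
    (amp : Option (Fin G.a) → ℂ) : Config G.size (G.D + 1) W → ℂ :=
  amp none • regVec G.w (coinState none sl) ω +
    ∑ i, amp (some i) • regVec G.w (coinState (some i) sl) ω

theorem regState_low (f o : Bool) (ρ : G.Reg → ℕ) (r : G.Reg) :
    regState G.w f o ρ (G.low r) = (ρ r).testBit 0 := regState_regQubit _ _ _ _ _

/-- A register with content at most `1` differs from a zero register only in its lowest qubit. -/
theorem regState_congr_off {f o : Bool} {ρ ρ' : G.Reg → ℕ} {s : Set G.Reg}
    (h : ∀ r ∉ s, ρ r = ρ' r) (h₁ : ∀ r ∈ s, ρ r ≤ 1) (h₂ : ∀ r ∈ s, ρ' r ≤ 1) (q : Fin G.size)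
    (hq : ∀ r ∈ s, q ≠ G.low r) : regState G.w f o ρ q = regState G.w f o ρ' q := by
  revert hq
  refine qubit_cases (p := fun q => (∀ r ∈ s, q ≠ G.low r) → regState G.w f o ρ q =
    regState G.w f o ρ' q) ?_ ?_ ?_ q
  · simp
  · simp
  · intro r m hq
    rw [regState_regQubit, regState_regQubit]
    by_cases hr : r ∈ s
    · have hm : (m : ℕ) ≠ 0 := by
        intro hm
        exact hq r hr (by rw [low, regQubit_inj]; exact ⟨rfl, Fin.ext hm⟩)
      have h2 : 2 ≤ 2 ^ (m : ℕ) := by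
        calc 2 = 2 ^ 1 := rfl
          _ ≤ _ := Nat.pow_le_pow_right (by norm_num) (by omega)
      rw [Nat.testBit_lt_two_pow ((h₁ r hr).trans_lt (by omega)),
        Nat.testBit_lt_two_pow ((h₂ r hr).trans_lt (by omega))]
    · rw [h r hr]

theorem coinState_low (c c' : Option (Fin G.a)) :
    (coinState c' sl (coin c)).testBit 0 = decide (c = c') := by
  by_cases h : c = c' <;> simp [coinState, pathState, h]

theorem setPair_coinState {f o : Bool} {c c₁ c₂ c' : Option (Fin G.a)} (h : c₁ ≠ c₂)
    (hc : c = c₁ ∨ c = c₂) (hc' : c' = c₁ ∨ c' = c₂) :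
    setPair (G.low (coin c₁)) (G.low (coin c₂)) (decide (c₁ = c'), decide (c₂ = c'))
      (regState G.w f o (coinState c sl)) = regState G.w f o (coinState c' sl) := by
  symm
  rw [setPair_eq_iff (low_ne (by simp [h]))]
  refine ⟨fun s h1 h2 => regState_congr_off (s := {coin c₁, coin c₂}) ?_ ?_ ?_ s ?_, ?_⟩
  · intro r hr
    simp only [Set.mem_insert_iff, Set.mem_singleton_iff, not_or] at hr
    have e1 : r ≠ coin c := by rcases hc with rfl | rfl <;> tauto
    have e2 : r ≠ coin c' := by rcases hc' with rfl | rfl <;> tauto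
    simp [coinState, e1, e2]
  · rintro r (rfl | rfl) <;> simp [coinState, Function.update_apply, pathState] <;> split_ifs <;> simp
  · rintro r (rfl | rfl) <;> simp [coinState, Function.update_apply, pathState] <;> split_ifs <;> simp
  · rintro r (rfl | rfl) <;> assumption
  · rw [regState_low, regState_low, coinState_low, coinState_low]

theorem coinVec_eq_erase (i : Fin G.a) (amp : Option (Fin G.a) → ℂ) :
    coinVec sl ω amp = amp none • regVec G.w (coinState none sl) ω +
      (amp (some i) • regVec G.w (coinState (some i) sl) ω +
      ∑ m ∈ Finset.univ.erase i, amp (some m) • regVec G.w (coinState (some m) sl) ω) := by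
  rw [coinVec, Finset.add_sum_erase _ (fun m => amp (some m) • regVec G.w (coinState (some m) sl) ω)
    (Finset.mem_univ i)]

/-- Exactly one coin register of a coin state is `1`, so the two qubits are in |10⟩, |01⟩ or |00⟩.
The rotation mixes the first two and fixes the third. -/
theorem run_exchange (θ : ℝ) (i : Fin G.a) (h) (amp : Option (Fin G.a) → ℂ) :
    run P [.two (G.low (coin none)) (G.low (coin (some i))) h (exchangeUnitary θ)]
      (coinVec sl ω amp) = coinVec sl ω
        (Function.update (Function.update amp none
          (Complex.cos θ * amp none + Complex.sin θ * amp (some i)))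
          (some i) (-Complex.sin θ * amp none + Complex.cos θ * amp (some i))) := by
  have key : ∀ c, run P [.two (G.low (coin none)) (G.low (coin (some i))) h (exchangeUnitary θ)]
      (regVec G.w (coinState c sl) ω) = ∑ y, exchangeMatrix θ y (decide (none = c), decide (some i = c)) •
        emb (setPair (G.low (coin none)) (G.low (coin (some i))) y
          (regState G.w false true (coinState c sl))) ω := by
    intro c
    rw [run_singleton, regVec]
    refine (twoMatrix_emb h _ _ _).trans ?_
    rw [regState_low, regState_low, coinState_low, coinState_low]
    rfl
  have s1 : ∀ c, (c = none ∨ c = some i) → setPair (G.low (coin none)) (G.low (coin (some i))) (true, false)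
      (regState G.w false true (coinState c sl)) = regState G.w false true (coinState none sl) := by
    intro c hc
    have := setPair_coinState (sl := sl) (f := false) (o := true) (c₁ := none) (c₂ := some i)
      (c' := none) (by simp) hc (by simp)
    simpa using this
  have s2 : ∀ c, (c = none ∨ c = some i) → setPair (G.low (coin none)) (G.low (coin (some i))) (false, true)
      (regState G.w false true (coinState c sl)) = regState G.w false true (coinState (some i) sl) := by
    intro c hc
    have := setPair_coinState (sl := sl) (f := false) (o := true) (c₁ := none) (c₂ := some i)
      (c' := some i) (by simp) hc (by simp)
    simpa using this
  have k1 : run P [.two (G.low (coin none)) (G.low (coin (some i))) h (exchangeUnitary θ)]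
      (regVec G.w (coinState none sl) ω) = Complex.cos θ • regVec G.w (coinState none sl) ω +
        (-Complex.sin θ) • regVec G.w (coinState (some i) sl) ω := by
    rw [key, Fintype.sum_prod_type]
    simp [exchangeMatrix, s1, s2, regVec]
  have k2 : run P [.two (G.low (coin none)) (G.low (coin (some i))) h (exchangeUnitary θ)]
      (regVec G.w (coinState (some i) sl) ω) = Complex.sin θ • regVec G.w (coinState none sl) ω +
        Complex.cos θ • regVec G.w (coinState (some i) sl) ω := by
    rw [key, Fintype.sum_prod_type]
    simp [exchangeMatrix, s1, s2, regVec]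
  have k3 : ∀ m, m ≠ i → run P [.two (G.low (coin none)) (G.low (coin (some i))) h (exchangeUnitary θ)]
      (regVec G.w (coinState (some m) sl) ω) = regVec G.w (coinState (some m) sl) ω := by
    intro m hm
    have : setPair (G.low (coin none)) (G.low (coin (some i))) (false, false)
        (regState G.w false true (coinState (some m) sl)) =
        regState G.w false true (coinState (some m) sl) := by
      symm
      rw [setPair_eq_iff h]
      refine ⟨fun _ _ _ => rfl, ?_⟩
      rw [regState_low, regState_low, coinState_low, coinState_low]
      simp [hm.symm]
    rw [key, Fintype.sum_prod_type]
    simp [exchangeMatrix, regVec, hm.symm, this]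
  rw [coinVec_eq_erase ω i, coinVec_eq_erase ω i, run_add, run_add, run_smul, run_smul, run_sum, k1, k2]
  have : ∑ m ∈ Finset.univ.erase i, run P [.two (G.low (coin none)) (G.low (coin (some i))) h
      (exchangeUnitary θ)] (amp (some m) • regVec G.w (coinState (some m) sl) ω) =
      ∑ m ∈ Finset.univ.erase i, (Function.update (Function.update amp none
          (Complex.cos θ * amp none + Complex.sin θ * amp (some i)))
          (some i) (-Complex.sin θ * amp none + Complex.cos θ * amp (some i))) (some m) •
          regVec G.w (coinState (some m) sl) ω := by
    refine Finset.sum_congr rfl fun m hm => ?_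
    have hm' := (Finset.mem_erase.1 hm).1
    rw [run_smul, k3 m hm']
    simp [hm']
  rw [this]
  simp only [Function.update_self, Function.update_of_ne (show (none : Option (Fin G.a)) ≠ some i by simp)]
  module

theorem norm_mul_cos_angle (p g : ℝ) :
    ((‖(⟨p, g⟩ : ℂ)‖ : ℝ) : ℂ) * Complex.cos (angle p g) = p := by
  have := Complex.norm_mul_cos_arg ⟨p, g⟩
  rw [← Complex.ofReal_cos, ← Complex.ofReal_mul]
  exact congrArg _ this

theorem norm_mul_sin_angle (p g : ℝ) :
    ((‖(⟨p, g⟩ : ℂ)‖ : ℝ) : ℂ) * Complex.sin (angle p g) = g := by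
  have := Complex.norm_mul_sin_arg ⟨p, g⟩
  rw [← Complex.ofReal_sin, ← Complex.ofReal_mul]
  exact congrArg _ this

theorem norm_mk_pos {p : ℝ} (hp : 0 < p) (g : ℝ) : 0 < ‖(⟨p, g⟩ : ℂ)‖ := by
  rw [norm_pos_iff]
  intro h
  have := congrArg Complex.re h
  simp only [Complex.zero_re] at this
  exact hp.ne' this

/-- The rotation takes (p, g) to (‖(p, g)‖, 0), so it preserves the inner product with the vector
being collected: the hypothesis recurs with the new `p` and one child fewer. For the empty list it
says that the first amplitude vanishes. -/
theorem run_givens_of_orthogonal (g : ℝ) {p : ℝ} (hp : 0 < p) {l : List (Fin G.a)} (hl : l.Nodup)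
    {amp : Option (Fin G.a) → ℂ} (h : p * amp none + (l.map fun i => g * amp (some i)).sum = 0) :
    ∃ amp', run P (G.givens g p l) (coinVec sl ω amp) = coinVec sl ω amp' ∧ amp' none = 0 := by
  induction l generalizing p amp with
  | nil =>
    refine ⟨amp, by simp [givens], ?_⟩
    simpa [hp.ne'] using h
  | cons i l ih =>
    rw [List.nodup_cons] at hl
    rw [givens, ← List.singleton_append, run_append, run_exchange]
    refine ih (norm_mk_pos hp g) hl.2 ?_
    rw [List.map_cons, List.sum_cons] at h
    have hc := norm_mul_cos_angle p g
    have hs := norm_mul_sin_angle p g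
    have e : (l.map fun m => (g : ℂ) * (Function.update (Function.update amp none
          (Complex.cos (angle p g) * amp none + Complex.sin (angle p g) * amp (some i)))
          (some i) (-Complex.sin (angle p g) * amp none + Complex.cos (angle p g) * amp (some i)))
          (some m)) = l.map fun m => (g : ℂ) * amp (some m) := by
      refine List.map_congr_left fun m hm => ?_
      have : m ≠ i := by rintro rfl; exact hl.1 hm
      simp [this]
    rw [e, Function.update_of_ne (by simp), Function.update_self, ← h]
    linear_combination amp none * hc + amp (some i) * hs

/-- A multiple of (p, g, …, g) is turned into the first axis one child at a time; the amplitude of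
the child just treated becomes a multiple of -sin·cos + cos·sin = 0. -/
theorem run_givens_of_parallel (g : ℝ) {p : ℝ} (hp : 0 < p) {l : List (Fin G.a)} (hl : l.Nodup)
    {amp : Option (Fin G.a) → ℂ} {x : ℂ} (h₀ : amp none = p * x) (h₁ : ∀ i ∈ l, amp (some i) = g * x)
    (h₂ : ∀ i ∉ l, amp (some i) = 0) :
    ∃ amp', run P (G.givens g p l) (coinVec sl ω amp) = coinVec sl ω amp' ∧
      ∀ i, amp' (some i) = 0 := by
  induction l generalizing p amp with
  | nil => exact ⟨amp, by simp [givens], fun i => h₂ i (by simp)⟩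
  | cons i l ih =>
    rw [List.nodup_cons] at hl
    rw [givens, ← List.singleton_append, run_append, run_exchange]
    have hc := norm_mul_cos_angle p g
    have hs := norm_mul_sin_angle p g
    have hn := norm_mk_pos hp g
    have hn' : ((‖(⟨p, g⟩ : ℂ)‖ : ℝ) : ℂ) ≠ 0 := by exact_mod_cast hn.ne'
    have hi := h₁ i (by simp)
    have hcs := Complex.cos_sq_add_sin_sq (angle p g : ℂ)
    refine ih (norm_mk_pos hp g) hl.2 ?_ ?_ ?_
    · rw [Function.update_of_ne (by simp), Function.update_self, h₀, hi]
      rw [← hc, ← hs]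
      linear_combination ((‖(⟨p, g⟩ : ℂ)‖ : ℝ) : ℂ) * x * hcs
    · intro m hm
      have : m ≠ i := by rintro rfl; exact hl.1 hm
      simp [this, h₁ m (by simp [hm])]
    · intro m hm
      by_cases hmi : m = i
      · subst hmi
        rw [Function.update_self, h₀, hi]
        rw [← hc, ← hs]
        ring
      · simp [hmi, h₂ m (by simp [hmi, hm])]

theorem run_signGate (ρ : G.Reg → ℕ) :
    run P [G.signGate] (regVec G.w ρ ω) =
      (if (ρ (coin none)).testBit 0 then -1 else 1 : ℂ) • regVec G.w ρ ω := by
  rw [run_singleton, regVec]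
  refine (signUnitary_mulVec_emb (regQubit_ne_ancilla _ _ _) _ _ _).trans ?_
  simp only [regState_regQubit]

theorem run_signGate_coinVec (amp : Option (Fin G.a) → ℂ) :
    run P [G.signGate] (coinVec sl ω amp) =
      coinVec sl ω (Function.update amp none (-amp none)) := by
  simp only [coinVec, run_add, run_sum, run_smul, run_signGate, coinState_low]
  simp

/-- Scattering is a reflection. The rotations carry the direction (1, ratio, …, ratio) to the first
axis, where the sign gate negates it; vectors orthogonal to it have no component there. -/
theorem run_scatter_of_orthogonal (hj : j < G.D) {amp : Option (Fin G.a) → ℂ}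
    (h : amp none + G.ratio * ∑ i, amp (some i) = 0) :
    run P (G.scatter j) (coinVec sl ω amp) = coinVec sl ω amp := by
  obtain ⟨amp', h1, h2⟩ := run_givens_of_orthogonal (P := P) (sl := sl) ω G.ratio (one_pos) (List.nodup_finRange _)
    (amp := amp) (by
      rw [← h, Complex.ofReal_one, one_mul, Finset.mul_sum, ← List.sum_ofFn, List.ofFn_eq_map])
  rw [scatter, if_pos hj, run_append, run_append, h1, run_signGate_coinVec]
  have : Function.update amp' none (-amp' none) = amp' := by rw [h2, neg_zero, ← h2]; simp
  rw [this]
  exact run_circuitInv h1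

theorem run_scatter_of_parallel (hj : j < G.D) {amp : Option (Fin G.a) → ℂ}
    (h₀ : amp none = 1) (h : ∀ i, amp (some i) = G.ratio) :
    run P (G.scatter j) (coinVec sl ω amp) = (-1 : ℂ) • coinVec sl ω amp := by
  obtain ⟨amp', h1, h2⟩ := run_givens_of_parallel (P := P) (sl := sl) ω G.ratio (one_pos) (List.nodup_finRange _)
    (amp := amp) (x := 1) (by simp [h₀]) (fun i _ => by simp [h]) (fun i hi => absurd (List.mem_finRange i) hi)
  rw [scatter, if_pos hj, run_append, run_append, h1, run_signGate_coinVec]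
  have : coinVec (W := W) sl ω (Function.update amp' none (-amp' none)) =
      (-1 : ℂ) • coinVec sl ω amp' := by
    simp [coinVec, h2]
  rw [this, run_smul]
  rw [run_circuitInv h1]

/-! Leaves. -/

theorem run_leafPhase (ρ : G.Reg → ℕ) :
    run P [G.leafPhase] (regVec G.w ρ ω) =
      (if (ρ (coin none)).testBit 0 && !(ρ flag).testBit 0 then -1 else 1 : ℂ) • regVec G.w ρ ω := by
  rw [run_singleton, regVec]
  refine (signUnitary_mulVec_emb (low_ne (by simp)) _ _ _).trans ?_
  simp only [regState_low]

theorem run_markGate {ρ : G.Reg → ℕ} (hρ : ρ mlev = G.D) (d : Fin (G.D + 1) → Desc W) {c : Bool}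
    (hc : ρ flag = c.toNat) :
    run P [G.markGate] (regVec G.w ρ (Pi.single d 1)) =
      regVec G.w (Function.update ρ flag (xor c (P.marked (d (Fin.last _)))).toNat)
        (Pi.single d 1) := by
  have hD := G.D_lt
  rw [run_singleton, regVec]
  refine basisMatrix_emb fun z hz => ?_
  have hz' : z = d := by
    by_contra h
    exact hz (Pi.single_eq_of_ne h _)
  subst hz'
  have hv : regVal (regQubit G.w mlev) (regState G.w false true ρ) = G.D := by
    rw [regVal_regState _ _ _ _ (by omega), hρ]
  rw [markMap, dif_pos (by rw [hv]; omega)]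
  refine Prod.ext (funext fun q => ?_) rfl
  simp only [hv, regState_low, hc]
  have e : (⟨G.D, by omega⟩ : Fin (G.D + 1)) = Fin.last _ := rfl
  rw [e]
  by_cases hq : q = G.low flag
  · subst hq
    rw [Function.update_self, regState_low, Function.update_self]
    cases c <;> cases P.marked (z (Fin.last _)) <;> rfl
  · rw [Function.update_of_ne hq]
    refine regState_congr_off (s := {flag}) ?_ ?_ ?_ q ?_
    · intro r hr
      rw [Function.update_of_ne hr]
    · rintro r rfl
      rw [hc]; exact Bool.toNat_le c
    · rintro r rfl
      rw [Function.update_self]; exact Bool.toNat_le _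
    · rintro r rfl; exact hq

theorem run_markGate_idle {ρ : G.Reg → ℕ} (hρ : ρ mlev = G.D + 1) :
    run P [G.markGate] (regVec G.w ρ ω) = regVec G.w ρ ω := by
  have hD := G.D_lt
  rw [run_singleton, regVec]
  refine basisMatrix_emb fun z hz => ?_
  have hv : regVal (regQubit G.w mlev) (regState G.w false true ρ) = G.D + 1 := by
    rw [regVal_regState _ _ _ _ (by omega), hρ]
  rw [markMap, dif_neg]
  rw [hv]; omega

/-- The second marking call clears the flag, so only the phase remains. The work registers must be
in a basis state for the marking bit to be definite. -/
theorem run_leaf (d : Fin (G.D + 1) → Desc W) :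
    run P G.leaf (regVec G.w (coinState none sl) (Pi.single d 1)) =
      (if P.marked (d (Fin.last _)) then 1 else -1 : ℂ) •
        regVec G.w (coinState none sl) (Pi.single d 1) := by
  have h1 := G.one_lt_pow
  have e1 : ∀ ω, run P G.leafLevel (regVec G.w (coinState none sl) ω) =
      regVec G.w (Function.update (coinState none sl) mlev G.D) ω := by
    intro ω
    have : xorState (coinState none sl) [(mlev, G.D)] =
        Function.update (coinState none sl) mlev G.D := by
      funext r
      by_cases hr : r = mlev
      · subst hr; simp [xorState, xorVal, coinState, pathState]
      · simp [xorState, xorVal, hr]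
    rw [leafLevel, run_append, run_controlled_pos, run_controlled_neg (r := coin none), this]
    · simp
    · rw [this]; simp [coinState, xorVal]
    · rw [this]; simp [coinState, G.w_pos.ne']
    · simp [xorVal]
    · intro r hr
      simp at hr
      subst hr
      simp [coinState, xorVal]
    · simp
  have m := P.marked (d (Fin.last _))
  rw [leaf, run_append, run_append, run_append, run_append, e1,
    run_markGate (c := false) (by simp) d (by simp [coinState, pathState]), run_leafPhase, run_smul,
    run_markGate (c := P.marked (d (Fin.last _))) (by simp) d (by simp), run_smul]
  rw [Bool.xor_self, Function.update_idem]
  have : Function.update (Function.update (coinState none sl) mlev G.D) flag false.toNat =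
      (Function.update (coinState none sl) mlev G.D : G.Reg → ℕ) := by
    funext r
    by_cases hr : r = flag
    · subst hr; simp [coinState, pathState]
    · simp [hr]
  rw [this, run_circuitInv (e1 _)]
  congr 1
  have : ((coinState none sl : G.Reg → ℕ) (coin none)).testBit 0 = true := by simp [coinState]
  cases P.marked (d (Fin.last _)) <;> simp [this]

/-- Without a particle in the coin register the marking level is out of range and the phase gate
does not see the pattern it negates. -/
theorem run_leaf_fixed {ρ : G.Reg → ℕ} (hc : ρ (coin none) = 0) (hm : ρ mlev = 0) : run P G.leaf (regVec G.w ρ ω) = regVec G.w ρ ω := by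
  have h1 := G.one_lt_pow
  have e1 : run P G.leafLevel (regVec G.w ρ ω) =
      regVec G.w (Function.update ρ mlev (G.D + 1)) ω := by
    have : xorState ρ [(mlev, G.D + 1)] = Function.update ρ mlev (G.D + 1) := by
      funext r
      by_cases hr : r = mlev
      · subst hr; simp [xorState, xorVal, hm]
      · simp [xorState, xorVal, hr]
    rw [leafLevel, run_append, run_controlled_neg (r := coin none), run_controlled_pos, this]
    · intro r hr
      simp at hr
      subst hr
      simp [hc, xorVal]
    · simp
    · simp
    · simp [hc, xorVal]
    · simp [hc]
    · simp [xorVal, G.w_pos.ne']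
  rw [leaf, run_append, run_append, run_append, run_append, e1, run_markGate_idle _ (by simp),
    run_leafPhase, run_smul, run_markGate_idle _ (by simp), run_smul, run_circuitInv e1]
  simp [hc]

theorem run_givens_fixed (g p : ℝ) (l : List (Fin G.a)) {ρ : G.Reg → ℕ} (hc : ∀ c, ρ (coin c) = 0) :
    run P (G.givens g p l) (regVec G.w ρ ω) = regVec G.w ρ ω := by
  induction l generalizing p with
  | nil => simp [givens]
  | cons i l ih =>
    rw [givens, run_cons]
    have : Gate.toMatrix P (.two (G.low (coin none)) (G.low (coin (some i))) (low_ne (by simp))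
      (exchangeUnitary (angle p g))) *ᵥ regVec G.w ρ ω = regVec G.w ρ ω := by
      rw [regVec]
      refine (twoMatrix_emb (low_ne (by simp)) _ _ _).trans ?_
      rw [regState_low, regState_low, hc, hc, Fintype.sum_prod_type]
      have : setPair (G.low (coin none)) (G.low (coin (some i))) (false, false)
          (regState G.w false true ρ) = regState G.w false true ρ := by
        symm
        rw [setPair_eq_iff (low_ne (by simp))]
        refine ⟨fun _ _ _ => rfl, ?_⟩
        rw [regState_low, regState_low, hc, hc]
        simp
      simp [exchangeUnitary, exchangeMatrix, this]
    rw [this, ih]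

theorem run_scatter_fixed {ρ : G.Reg → ℕ} (hc : ∀ c, ρ (coin c) = 0) (hm : ρ mlev = 0) : run P (G.scatter j) (regVec G.w ρ ω) = regVec G.w ρ ω := by
  rw [scatter]
  split_ifs
  · rw [run_append, run_append, run_givens_fixed _ _ _ _ hc, run_signGate]
    simp only [hc, Nat.zero_testBit]
    simp only [Bool.false_eq_true, if_false, one_smul]
    exact run_circuitInv (run_givens_fixed _ _ _ _ hc)
  · exact run_leaf_fixed ω (hc _) hm

theorem run_node_fixed (hj : j ≤ G.D) (hτ : τ < 2 ^ G.w) {ρ : G.Reg → ℕ}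
    (hρ : ∀ r, ρ r < 2 ^ G.w) (hc : ∀ c, ρ (coin c) = 0) (hm : ρ mlev = 0)
    (h₁ : ∀ e, ¬ Matches ρ (G.parPat τ e j)) (h₂ : ∀ e, ρ (lev e) ≠ j + 1 ∨ ρ time ≠ 0) :
    run P (G.node τ j) (regVec G.w ρ ω) = regVec G.w ρ ω := by
  rw [node, run_append, run_append, run_convIn_fixed ω hj hτ hρ hc (h₁ _) (h₂ _),
    run_scatter_fixed ω hc hm]
  exact run_circuitInv (run_convIn_fixed ω hj hτ hρ hc (h₁ _) (h₂ _))

/-- Basis state of a particle at the port of a node to its parent. -/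
def portState (τ : ℕ) (e : Bool) (j : ℕ) (sl : Fin (G.D + 1) → ℕ) : G.Reg → ℕ :=
  xorState (pathState sl) (G.parPat τ e j)

theorem not_matches_arc {e' : Bool} {k t : ℕ} (h : j = 0 ∨ t ≠ G.L j ∨ k ≠ j) :
    ¬ Matches (arc e k t sl) (G.parPat τ e' j) := by
  intro hm
  by_cases hj : j = 0
  · have := hm pub (by simp [parPat, hj])
    simp [parPat, hj, arc, pathState, xorVal] at this
  · have h1 := hm (lev e') (by simp [parPat, hj])
    have h2 := hm time (by simp [parPat, hj])
    simp [parPat, hj, arc, pathState, xorVal, Function.update_apply] at h1 h2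
    by_cases he : e' = e
    · rw [if_pos he] at h1; omega
    · rw [if_neg he] at h1; omega

theorem run_node_arc {k t : ℕ} (hj : j ≤ G.D) (hτ : τ < 2 ^ G.w) (hs : ∀ k, sl k < 2 ^ G.w)
    (hk : k ≤ G.D) (ht : t < 2 ^ G.w) (h₁ : j = 0 ∨ t ≠ G.L j ∨ k ≠ j) (h₂ : k ≠ j + 1 ∨ t ≠ 0) :
    run P (G.node τ j) (regVec G.w (arc e k t sl) ω) = regVec G.w (arc e k t sl) ω := by
  refine run_node_fixed ω hj hτ (arc_lt hs hk ht) (by simp [arc, pathState])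
    (by simp [arc, pathState]) (fun e' => not_matches_arc h₁) fun e' => ?_
  rcases h₂ with h | h
  · left
    by_cases he : e' = e
    · subst he; simpa [arc] using h
    · simp [arc, he, pathState]
  · right; simpa [arc] using h

/-- The port to the parent of a node at level `j` involves no other node: at the root all levels are
`0`, and elsewhere the particle is at the lower end of its edge. -/
theorem run_node_port {j' : ℕ} (hj : j ≤ G.D) (hj' : j' ≤ G.D) (hjj : j' ≠ j) (hτ : τ < 2 ^ G.w)
    (hs : ∀ k, sl k < 2 ^ G.w) :
    run P (G.node τ j') (regVec G.w (portState τ e j sl) ω) =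
      regVec G.w (portState τ e j sl) ω := by
  by_cases h0 : j = 0
  · have hlev : ∀ e', portState τ e j sl (lev e') = 0 := by
      simp [portState, h0, xorState, parPat, xorVal, pathState]
    refine run_node_fixed ω hj' hτ ?_ ?_ ?_ (fun e' hm => ?_) fun e' => ?_
    · have := G.one_lt_pow
      intro r
      rw [portState, xorState]
      refine Nat.xor_lt_two_pow ?_ ?_
      · cases r <;> simp [pathState, hs]
      · by_cases hr : r ∈ (G.parPat τ e j).map Prod.fst
        · exact xorVal_parPat_lt hj hτ r hr
        · rw [xorVal_of_notMem hr]; omega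
    · simp [portState, h0, xorState, parPat, xorVal, pathState]
    · simp [portState, h0, xorState, parPat, xorVal, pathState]
    · have h1 := hm (lev e') (by simp [parPat, show j' ≠ 0 by omega])
      rw [hlev] at h1
      simp [parPat, show j' ≠ 0 by omega, xorVal] at h1
      omega
    · left; rw [hlev]; omega
  -- Positive length separates the two ends of an edge; otherwise this port would also be a child
  -- port of level `j - 1`.
  · have := G.L_pos j
    rw [portState, xorState_parPat h0]
    exact run_node_arc ω hj' hτ hs hj (G.L_lt j) (by omega) (by omega)

/-- Superposition of the two ports of an edge in one direction. -/
noncomputable def nodeVec (τ : ℕ) (e : Bool) (j : Fin G.D) (sl : Fin (G.D + 1) → ℕ)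
    (ω : (Fin (G.D + 1) → Desc W) → ℂ) (amp : Option (Fin G.a) → ℂ) :
    Config G.size (G.D + 1) W → ℂ :=
  amp none • regVec G.w (portState τ e j sl) ω +
    ∑ i, amp (some i) • regVec G.w (arc (!e) (j + 1) 0 (Function.update sl j.succ i)) ω

theorem run_convIn_nodeVec (j : Fin G.D) (hτ : τ < 2 ^ G.w) (hs : ∀ k, sl k < 2 ^ G.w)
    (hsj : sl j.succ = 0) (amp : Option (Fin G.a) → ℂ) :
    run P (G.convIn τ e j) (nodeVec τ e j sl ω amp) = coinVec sl ω amp := by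
  simp only [nodeVec, coinVec, run_add, run_sum, run_smul]
  rw [portState, run_convIn_par ω hs]
  have key : ∀ i : Fin G.a, run P (G.convIn τ e j)
      (regVec G.w (arc (!e) (j + 1) 0 (Function.update sl j.succ i)) ω) =
      regVec G.w (coinState (some i) sl) ω := fun i => run_convIn_child ω j.2 hτ hs i hsj
  simp only [key]

/-- Only the nodes at level `j` act. Arrival yields a coin vector, an eigenvector of the scattering,
and departure returns the same amplitudes with all directions reversed. -/
theorem run_nodes_nodeVec (j : Fin G.D) (hτ : τ < 2 ^ G.w) (hs : ∀ k, sl k < 2 ^ G.w)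
    (hsj : sl j.succ = 0) {amp : Option (Fin G.a) → ℂ} {ε : ℂ}
    (h : run P (G.scatter j) (coinVec sl ω amp) = ε • coinVec sl ω amp) :
    run P (G.nodes τ) (nodeVec τ false j sl ω amp) = ε • nodeVec τ true j sl ω amp := by
  have hj := j.2
  have hs' : ∀ (i : Fin G.a) k, Function.update sl j.succ (i : ℕ) k < 2 ^ G.w := by
    intro i k
    by_cases hk : k = j.succ
    · subst hk; simp [a_lt]
    · simp [hk, hs]
  have hfix : ∀ e, ∀ j' ∈ List.range (G.D + 1), j' ≠ j →
      run P (G.node τ j') (nodeVec τ e j sl ω amp) = nodeVec τ e j sl ω amp := by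
    intro e j' hj' hne
    rw [List.mem_range] at hj'
    simp only [nodeVec, run_add, run_sum, run_smul]
    have := G.L_pos j'
    have key : ∀ i : Fin G.a, run P (G.node τ j')
        (regVec G.w (arc (!e) (j + 1) 0 (Function.update sl j.succ i)) ω) =
        regVec G.w (arc (!e) (j + 1) 0 (Function.update sl j.succ i)) ω := fun i =>
      run_node_arc ω (by omega) hτ (hs' i) (by omega) pow_pos' (.inr (.inl (by omega)))
        (.inl (by omega))
    rw [run_node_port ω (by omega) (by omega) hne hτ hs]
    simp only [key]
  refine run_flatMap_of_single (i := (j : ℕ)) List.nodup_range (List.mem_range.2 (by omega)) (hfix false) ?_ ?_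
  · rw [node, run_append, run_append, run_convIn_nodeVec ω j hτ hs hsj, h, run_smul,
      run_circuitInv (run_convIn_nodeVec ω j hτ hs hsj amp)]
  · intro j' h1 h2
    rw [run_smul, hfix true j' h1 h2]

theorem run_nodes_leaf (hτ : τ < 2 ^ G.w) (hs : ∀ k, sl k < 2 ^ G.w) (d : Fin (G.D + 1) → Desc W) :
    run P (G.nodes τ) (regVec G.w (portState τ false G.D sl) (Pi.single d 1)) =
      (if P.marked (d (Fin.last _)) then 1 else -1 : ℂ) •
        regVec G.w (portState τ true G.D sl) (Pi.single d 1) := by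
  refine run_flatMap_of_single (i := G.D) List.nodup_range (by simp) ?_ ?_ ?_
  · intro j' h1 h2
    rw [List.mem_range] at h1
    exact run_node_port _ le_rfl (by omega) h2 hτ hs
  · rw [node, run_append, run_append, portState, run_convIn_par _ hs, scatter, if_neg (lt_irrefl _),
      run_leaf, run_smul]
    rw [run_circuitInv (run_convIn_par _ hs)]
    rfl
  · intro j' h1 h2
    rw [List.mem_range] at h1
    rw [run_smul, run_node_port _ le_rfl (by omega) h2 hτ hs]

theorem run_nodes_interior (j : Fin G.D) {t : ℕ} (hτ : τ < 2 ^ G.w) (hs : ∀ k, sl k < 2 ^ G.w)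
    (ht : 0 < t) (ht' : t < G.L (j + 1)) :
    run P (G.nodes τ) (regVec G.w (arc e (j + 1) t sl) ω) = regVec G.w (arc e (j + 1) t sl) ω := by
  refine run_flatMap_of_fixed fun j' hj' => ?_
  rw [List.mem_range] at hj'
  have := j.2
  have hL := G.L_lt (j + 1)
  by_cases h : j' = j + 1
  · subst h
    exact run_node_arc ω (by omega) hτ hs (by omega) (by omega) (by omega) (by omega)
  · exact run_node_arc ω (by omega) hτ hs (by omega) (by omega) (by omega) (by omega)

end WalkData

namespace WalkData

variable {G : WalkData} {W : ℕ} {b n₀ : ℝ} {Taux : ℝ → ℕ} {P : OrDivideConquer G.a b n₀ Taux W}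
  {τ j : ℕ} {e : Bool} {sl : Fin (G.D + 1) → ℕ} (ω : (Fin (G.D + 1) → Desc W) → ℂ)

/-! ### The stationary wave on the tree -/

theorem ratio_pos : 0 < G.ratio := by
  have : (0 : ℝ) < G.a := by exact_mod_cast G.a_pos
  unfold ratio
  positivity

theorem ratio_sq : G.ratio ^ 2 = (√G.a)⁻¹ := by
  rw [ratio, inv_pow, Real.sq_sqrt (Real.sqrt_nonneg _)]

/-- The sign with which the wave is reflected. -/
def sign (v : Bool) : ℂ := if v then 1 else -1

theorem sign_mul_self (v : Bool) : sign v * sign v = 1 := by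
  cases v <;> simp [sign]

theorem norm_sign (v : Bool) : ‖sign v‖ = 1 := by
  cases v <;> simp [sign]

/-- The amplitudes of the children of an inner node. -/
theorem exists_amplitudes {u : Desc W} (hu : n₀ < P.size u) :
    ∃ α : Fin G.a → ℝ, (∀ i, α i ≠ 0 → P.answer (P.sub u i) = P.answer u) ∧
      ∑ i, α i ^ 2 = √G.a ∧
      ∀ j < G.D, ∀ sl (ω : (Fin (G.D + 1) → Desc W) → ℂ), run P (G.scatter j)
        (coinVec sl ω fun c => c.elim 1 fun i => sign (P.answer u) * α i) =
        sign (P.answer u) • coinVec sl ω fun c => c.elim 1 fun i => sign (P.answer u) * α i := by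
  have hr := G.ratio_pos
  have ha : (0 : ℝ) < G.a := by exact_mod_cast G.a_pos
  have hr2 := G.ratio_sq
  cases hv : P.answer u with
  | true =>
    obtain ⟨i₀, hi₀⟩ := (P.answer_eq_or u hu).1 hv
    -- A single positive child carries the wave. The port vector with entries 1 and `-1 / ratio` is
    -- orthogonal to the negated direction, and `1 / ratio ^ 2 = √a`.
    refine ⟨fun i => if i = i₀ then -G.ratio⁻¹ else 0, ?_, ?_, ?_⟩
    · intro i hi
      by_cases h : i = i₀
      · rw [h, hi₀]
      · simp [h] at hi
    · simp only [ite_pow, ne_eq, OfNat.ofNat_ne_zero, not_false_eq_true, zero_pow,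
        Finset.sum_ite_eq', Finset.mem_univ, if_true, neg_sq, inv_pow, hr2, inv_inv]
    · intro j hj sl ω
      rw [run_scatter_of_orthogonal ω hj]
      · simp [sign]
      · have : (G.ratio : ℂ) ≠ 0 := by exact_mod_cast hr.ne'
        simp only [sign, if_true, one_mul, Option.elim_none, Option.elim_some]
        rw [Finset.sum_eq_single i₀ (by intro i _ hi; simp [hi]) (by simp)]
        simp [this]
  | false =>
    -- All children are negative. With the sign `-1`, the port vector is (1, ratio, …, ratio), which
    -- scattering negates, and `a * ratio ^ 2 = √a`. The fourth root in `ratio` balances the two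
    -- cases.
    refine ⟨fun _ => -G.ratio, ?_, ?_, ?_⟩
    · intro i _
      by_contra h
      rw [Bool.not_eq_false] at h
      have := (P.answer_eq_or u hu).2 ⟨i, h⟩
      rw [hv] at this
      simp at this
    · simp only [neg_sq, hr2, Finset.sum_const, Finset.card_univ, Fintype.card_fin, nsmul_eq_mul]
      rw [← div_eq_mul_inv, Real.div_sqrt]
    · intro j hj sl ω
      rw [run_scatter_of_parallel ω hj]
      · simp [sign]
      · simp
      · simp [sign]

theorem regVal_of_regVec_ne_zero {ρ : G.Reg → ℕ} {y : Config G.size (G.D + 1) W}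
    (h : regVec G.w ρ ω y ≠ 0) (r : G.Reg) (hr : ρ r < 2 ^ G.w) :
    regVal (regQubit G.w r) y.1 = ρ r := by
  have : y.1 = regState G.w false true ρ := by
    by_contra h'
    rw [regVec, emb, if_neg h'] at h
    exact h rfl
  rw [this, regVal_regState _ _ _ _ hr]

theorem nsq_runSteps (V : ℕ → Matrix.unitaryGroup (Desc W) ℂ) (t : ℕ) :
    nsq (runSteps (fun t => (V t : Matrix (Desc W) (Desc W) ℂ)) t) = 1 := by
  induction t with
  | zero =>
    rw [runSteps, nsq, Finset.sum_eq_single (fun _ => false)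
      (by intro z _ hz; rw [Pi.single_eq_of_ne hz]; simp) (by simp)]
    simp
  | succ t ih => rw [runSteps, nsq_mulVec (V t).2, ih]

theorem nsq_sum_of_label {X ι : Type} [Fintype X] [DecidableEq ι] {s : Finset ι} {v : ι → X → ℂ}
    (f : X → ℕ) (lab : ι → ℕ) (hl : Function.Injective lab)
    (h : ∀ i ∈ s, ∀ x, v i x ≠ 0 → f x = lab i) :
    nsq (∑ i ∈ s, v i) = ∑ i ∈ s, nsq (v i) := by
  refine nsq_sum_of_disjoint fun x i hi j hj hij => ?_
  by_contra! h'
  exact hij (hl ((h i hi x h'.1).symm.trans (h j hj x h'.2)))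

/-- State of a particle on an edge below a node at level `j` whose descriptions are `d`. -/
noncomputable def edgeVec (P : OrDivideConquer G.a b n₀ Taux W) (d : Fin (G.D + 1) → Desc W)
    (sl : Fin (G.D + 1) → ℕ) (j : Fin G.D) (i : Fin G.a) (e : Bool) (t : ℕ) :
    Config G.size (G.D + 1) W → ℂ :=
  regVec G.w (arc e (j + 1) t (Function.update sl j.succ i)) (workVec d j.succ
    (runSteps (fun t => (P.step (d j.castSucc) i t : Matrix (Desc W) (Desc W) ℂ)) t))

theorem update_lt (hs : ∀ k, sl k < 2 ^ G.w) (k : Fin (G.D + 1)) (i : Fin G.a) (k') :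
    Function.update sl k (i : ℕ) k' < 2 ^ G.w := by
  by_cases hk : k' = k
  · subst hk; simp [a_lt]
  · simp [hk, hs]

theorem run_stepHalf_edgeVec (hs : ∀ k, sl k < 2 ^ G.w) (d : Fin (G.D + 1) → Desc W) (j : Fin G.D)
    (i : Fin G.a) {t : ℕ} (ht : t + 1 < 2 ^ G.w) :
    run P (G.stepHalf e) (edgeVec P d sl j i e t) = edgeVec P d sl j i e (t + 1) :=
  run_stepHalf j.2 ht (update_lt hs _ i) i (Function.update_self _ _ _) d _

theorem run_stepHalf_edgeVec_not (d : Fin (G.D + 1) → Desc W) (j : Fin G.D)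
    (i : Fin G.a) (t : ℕ) :
    run P (G.stepHalf e) (edgeVec P d sl j i (!e) t) = edgeVec P d sl j i (!e) t :=
  run_stepHalf_idle _ (by simp [arc, pathState])

theorem run_steps_down (hs : ∀ k, sl k < 2 ^ G.w) (d : Fin (G.D + 1) → Desc W) (j : Fin G.D)
    (i : Fin G.a) {t : ℕ} (ht : t + 1 < 2 ^ G.w) :
    run P G.steps (edgeVec P d sl j i false t) = edgeVec P d sl j i false (t + 1) := by
  rw [steps, run_append, run_stepHalf_edgeVec hs d j i ht]
  exact run_circuitInv (run_stepHalf_edgeVec_not (e := true) d j i _)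

/-- Upward motion uses the inverse of `stepHalf`, which undoes the computation of the child. -/
theorem run_steps_up (hs : ∀ k, sl k < 2 ^ G.w) (d : Fin (G.D + 1) → Desc W) (j : Fin G.D)
    (i : Fin G.a) {t : ℕ} (ht : t + 1 < 2 ^ G.w) :
    run P G.steps (edgeVec P d sl j i true (t + 1)) = edgeVec P d sl j i true t := by
  have := run_stepHalf_edgeVec_not (P := P) (sl := sl) (e := false) d j i (t + 1)
  rw [Bool.not_false] at this
  rw [steps, run_append, this]
  exact run_circuitInv (run_stepHalf_edgeVec hs d j i ht)

theorem regVal_of_edgeVec_ne_zero (hs : ∀ k, sl k < 2 ^ G.w) {d : Fin (G.D + 1) → Desc W}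
    {j : Fin G.D} {i : Fin G.a} {t : ℕ} (ht : t < 2 ^ G.w) {y : Config G.size (G.D + 1) W}
    (h : edgeVec P d sl j i e t y ≠ 0) :
    regVal (regQubit G.w (time : G.Reg)) y.1 = t ∧
    regVal (regQubit G.w (lev e : G.Reg)) y.1 = j + 1 ∧
    regVal (regQubit G.w (lev !e : G.Reg)) y.1 = 0 ∧
    ∀ k, regVal (regQubit G.w (slot k : G.Reg)) y.1 = Function.update sl j.succ (i : ℕ) k := by
  have hb := arc_lt (e := e) (update_lt hs j.succ i) j.2 ht
  refine ⟨?_, ?_, ?_, fun k => ?_⟩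
  · rw [regVal_of_regVec_ne_zero _ h _ (hb _)]; simp [arc]
  · rw [regVal_of_regVec_ne_zero _ h _ (hb _)]; simp [arc]
  · rw [regVal_of_regVec_ne_zero _ h _ (hb _)]; simp [arc, pathState]
  · rw [regVal_of_regVec_ne_zero _ h _ (hb _)]; simp [arc, pathState]

theorem nsq_edgeVec (d : Fin (G.D + 1) → Desc W) (j : Fin G.D) (i : Fin G.a) (t : ℕ) :
    nsq (edgeVec P d sl j i e t) = 1 := by
  rw [edgeVec, regVec, nsq_emb, nsq_workVec, nsq_runSteps]

/-- The wave on an edge before the steps. -/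
noncomputable def edgePre (P : OrDivideConquer G.a b n₀ Taux W) (v : Bool)
    (d : Fin (G.D + 1) → Desc W) (sl : Fin (G.D + 1) → ℕ) (j : Fin G.D) (i : Fin G.a) :
    Config G.size (G.D + 1) W → ℂ :=
  ∑ t ∈ Finset.range (G.L (j + 1)), edgeVec P d sl j i false t +
    sign v • ∑ t ∈ Finset.range (G.L (j + 1)), edgeVec P d sl j i true (t + 1)

/-- The wave on an edge after the steps. -/
noncomputable def edgeMid (P : OrDivideConquer G.a b n₀ Taux W) (v : Bool)
    (d : Fin (G.D + 1) → Desc W) (sl : Fin (G.D + 1) → ℕ) (j : Fin G.D) (i : Fin G.a) :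
    Config G.size (G.D + 1) W → ℂ :=
  ∑ t ∈ Finset.range (G.L (j + 1)), edgeVec P d sl j i false (t + 1) +
    sign v • ∑ t ∈ Finset.range (G.L (j + 1)), edgeVec P d sl j i true t

/-- The part of the wave on an edge that does not touch its ends. -/
noncomputable def edgeInterior (P : OrDivideConquer G.a b n₀ Taux W) (v : Bool)
    (d : Fin (G.D + 1) → Desc W) (sl : Fin (G.D + 1) → ℕ) (j : Fin G.D) (i : Fin G.a) :
    Config G.size (G.D + 1) W → ℂ :=
  ∑ t ∈ Finset.range (G.L (j + 1) - 1), edgeVec P d sl j i false (t + 1) +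
    sign v • ∑ t ∈ Finset.range (G.L (j + 1) - 1), edgeVec P d sl j i true (t + 1)

/-- The two end terms are particles that have just left a node, downwards at time `0` and upwards at
time `L (j + 1)`. After the steps (`edgeMid_eq`) the end terms are the arriving particles instead,
with the same interior; so the nodes act on the ends only. -/
theorem edgePre_eq (v : Bool) (d : Fin (G.D + 1) → Desc W) (j : Fin G.D) (i : Fin G.a) :
    edgePre P v d sl j i = edgeVec P d sl j i false 0 + edgeInterior P v d sl j i +
      sign v • edgeVec P d sl j i true (G.L (j + 1)) := by
  obtain ⟨m, hm⟩ := Nat.exists_eq_add_of_le' (G.L_pos (j + 1))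
  rw [edgePre, edgeInterior, hm, Finset.sum_range_succ', Finset.sum_range_succ
    (fun t => edgeVec P d sl j i true (t + 1)), Nat.add_sub_cancel]
  module

theorem edgeMid_eq (v : Bool) (d : Fin (G.D + 1) → Desc W) (j : Fin G.D) (i : Fin G.a) :
    edgeMid P v d sl j i = edgeVec P d sl j i false (G.L (j + 1)) + edgeInterior P v d sl j i +
      sign v • edgeVec P d sl j i true 0 := by
  obtain ⟨m, hm⟩ := Nat.exists_eq_add_of_le' (G.L_pos (j + 1))
  rw [edgeMid, edgeInterior, hm, Finset.sum_range_succ' (fun t => edgeVec P d sl j i true t),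
    Finset.sum_range_succ, Nat.add_sub_cancel]
  module

theorem run_steps_edgePre (hs : ∀ k, sl k < 2 ^ G.w) (v : Bool) (d : Fin (G.D + 1) → Desc W)
    (j : Fin G.D) (i : Fin G.a) : run P G.steps (edgePre P v d sl j i) = edgeMid P v d sl j i := by
  have hL := G.L_lt (j + 1)
  have h₁ : ∀ t ∈ Finset.range (G.L (j + 1)),
      run P G.steps (edgeVec P d sl j i false t) = edgeVec P d sl j i false (t + 1) := by
    intro t ht
    rw [Finset.mem_range] at ht
    exact run_steps_down hs d j i (by omega)
  have h₂ : ∀ t ∈ Finset.range (G.L (j + 1)),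
      run P G.steps (edgeVec P d sl j i true (t + 1)) = edgeVec P d sl j i true t := by
    intro t ht
    rw [Finset.mem_range] at ht
    exact run_steps_up hs d j i (by omega)
  rw [edgePre, edgeMid, run_add, run_smul, run_sum, run_sum, Finset.sum_congr rfl h₁,
    Finset.sum_congr rfl h₂]

theorem run_nodes_edgeInterior (hτ : τ < 2 ^ G.w) (hs : ∀ k, sl k < 2 ^ G.w) (v : Bool)
    (d : Fin (G.D + 1) → Desc W) (j : Fin G.D) (i : Fin G.a) :
    run P (G.nodes τ) (edgeInterior P v d sl j i) = edgeInterior P v d sl j i := by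
  have key : ∀ e, ∀ t ∈ Finset.range (G.L (j + 1) - 1),
      run P (G.nodes τ) (edgeVec P d sl j i e (t + 1)) = edgeVec P d sl j i e (t + 1) := by
    intro e t ht
    rw [Finset.mem_range] at ht
    exact run_nodes_interior _ j hτ (update_lt hs _ i) (by omega) (by omega)
  rw [edgeInterior, run_add, run_smul, run_sum, run_sum, Finset.sum_congr rfl (key _),
    Finset.sum_congr rfl (key _)]

/-- The wave consists of `2 * L (j + 1)` unit vectors with distinct pairs of time and direction; the
sign does not change norms. -/
theorem nsq_edgePre (hs : ∀ k, sl k < 2 ^ G.w) (v : Bool) (d : Fin (G.D + 1) → Desc W)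
    (j : Fin G.D) (i : Fin G.a) : nsq (edgePre P v d sl j i) = 2 * G.L (j + 1) := by
  have hL := G.L_lt (j + 1)
  have key : ∀ (e : Bool) (c : ℕ), c ≤ 1 →
      nsq (∑ t ∈ Finset.range (G.L (j + 1)), edgeVec P d sl j i e (t + c)) = G.L (j + 1) := by
    intro e c hc
    rw [nsq_sum_of_label (fun y => regVal (regQubit G.w (time : G.Reg)) y.1) (fun t => t + c)
      (fun t t' h => by simpa using h)]
    · simp [nsq_edgeVec]
    · intro t ht y hy
      rw [Finset.mem_range] at ht
      exact (regVal_of_edgeVec_ne_zero hs (by omega) hy).1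
  rw [edgePre, nsq_add_of_disjoint, nsq_smul, norm_sign]
  · have := key false 0 (by norm_num)
    simp only [add_zero] at this
    rw [this, key true 1 le_rfl]
    ring
  · intro y
    by_contra! h
    rw [Pi.smul_apply, smul_ne_zero_iff, Finset.sum_apply, Finset.sum_apply] at h
    obtain ⟨t, ht, h1⟩ := Finset.exists_ne_zero_of_sum_ne_zero h.1
    obtain ⟨t', ht', h2⟩ := Finset.exists_ne_zero_of_sum_ne_zero h.2.2
    rw [Finset.mem_range] at ht ht'
    have e1 := (regVal_of_edgeVec_ne_zero hs (by omega) h1).2.1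
    have e2 := (regVal_of_edgeVec_ne_zero hs (by omega) h2).2.2.1
    rw [Bool.not_true, e1] at e2
    omega

/-- One of the two level registers is always `0`, so their sum is the level whatever the direction.
-/
theorem regVal_of_edgePre_ne_zero (hs : ∀ k, sl k < 2 ^ G.w) {v : Bool} {d : Fin (G.D + 1) → Desc W}
    {j : Fin G.D} {i : Fin G.a} {y : Config G.size (G.D + 1) W}
    (h : edgePre P v d sl j i y ≠ 0) :
    regVal (regQubit G.w (lev false : G.Reg)) y.1 + regVal (regQubit G.w (lev true : G.Reg)) y.1 =
      j + 1 ∧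
    ∀ k, regVal (regQubit G.w (slot k : G.Reg)) y.1 = Function.update sl j.succ (i : ℕ) k := by
  have hL := G.L_lt (j + 1)
  have : ∃ e, ∃ t < 2 ^ G.w, edgeVec P d sl j i e t y ≠ 0 := by
    by_contra! h'
    apply h
    rw [edgePre, Pi.add_apply, Pi.smul_apply, Finset.sum_apply, Finset.sum_apply,
      Finset.sum_eq_zero, Finset.sum_eq_zero, smul_zero, add_zero]
    · intro t ht
      rw [Finset.mem_range] at ht
      exact h' _ _ (by omega)
    · intro t ht
      rw [Finset.mem_range] at ht
      exact h' _ _ (by omega)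
  obtain ⟨e, t, ht, h1⟩ := this
  obtain ⟨-, e1, e2, e3⟩ := regVal_of_edgeVec_ne_zero hs ht h1
  refine ⟨?_, e3⟩
  cases e
  · rw [e1]; rw [Bool.not_false] at e2; rw [e2]
  · rw [e1]; rw [Bool.not_true] at e2; rw [e2]; omega

/-- The sizes and costs of a divide & conquer procedure agree with the parameters of the walk. -/
structure Fits (G : WalkData) (b n₀ : ℝ) (Taux : ℝ → ℕ) (n : ℝ) : Prop where
  lt : ∀ k < G.D, n₀ < n / b ^ k
  le : n / b ^ G.D ≤ n₀
  length : ∀ k < G.D, Taux (n / b ^ k) = G.L (k + 1)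

/-- `pre` is a stationary wave below a node at level `j`. -/
structure IsWave (P : OrDivideConquer G.a b n₀ Taux W) (v : Bool) (d : Fin (G.D + 1) → Desc W)
    (sl : Fin (G.D + 1) → ℕ) (j : ℕ) (pre mid : Config G.size (G.D + 1) W → ℂ) : Prop where
  steps : run P G.steps pre = mid
  -- The same `pre` and `mid` serve every counter value, which is what makes the wave stationary.
  nodes : ∀ τ < 2 ^ G.w,
    run P (G.nodes τ) (regVec G.w (portState τ false j sl) (Pi.single d 1) + mid) =
      sign v • regVec G.w (portState τ true j sl) (Pi.single d 1) + pre
  -- The conditions on the support give orthogonality: siblings differ in a slot, and an edge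
  -- differs in level from everything below it.
  slots : ∀ y, pre y ≠ 0 → ∀ k : Fin (G.D + 1), (k : ℕ) ≤ j →
    regVal (regQubit G.w (slot k : G.Reg)) y.1 = sl k
  levels : ∀ y, pre y ≠ 0 →
    j < regVal (regQubit G.w (lev false : G.Reg)) y.1 + regVal (regQubit G.w (lev true : G.Reg)) y.1

/-- There is nothing below a leaf, so the wave is zero. The size is at most `n₀`, so being marked is
the same as having a positive answer. -/
theorem isWave_leaf {n : ℝ} (hG : G.Fits b n₀ Taux n) {d : Fin (G.D + 1) → Desc W}
    (hs : ∀ k, sl k < 2 ^ G.w) (hn : P.size (d (Fin.last _)) = n / b ^ G.D) :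
    IsWave P (P.answer (d (Fin.last _))) d sl G.D 0 0 where
  steps := by simp [run]
  nodes τ hτ := by
    rw [add_zero, add_zero, run_nodes_leaf hτ hs]
    have : P.marked (d (Fin.last _)) = P.answer (d (Fin.last _)) := by
      have := hG.le
      rw [← hn] at this
      simp [OrDivideConquer.marked, this]
    rw [this]
    rfl
  slots y hy := by simp at hy
  levels y hy := by simp at hy

/-- Edge interiors are not affected by the nodes. The lower end of an edge is the parent port of the
child, since the procedure is exact, and there the child's wave reflects with the same sign. At the
upper ends the amplitudes `sign v * α i` arrive; scattering multiplies them by `sign v`, and they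
leave as `α i`, the amplitudes with which the edges start anew. -/
theorem isWave_inner {n : ℝ} (hG : G.Fits b n₀ Taux n) {j : Fin G.D} {d : Fin (G.D + 1) → Desc W}
    (hs : ∀ k, sl k < 2 ^ G.w) (hsj : sl j.succ = 0) (hdj : d j.succ = fun _ => false)
    (hn : P.size (d j.castSucc) = n / b ^ (j : ℕ)) {α : Fin G.a → ℝ}
    (hα : ∀ sl (ω : (Fin (G.D + 1) → Desc W) → ℂ), run P (G.scatter j)
        (coinVec sl ω fun c => c.elim 1 fun i => sign (P.answer (d j.castSucc)) * α i) =
        sign (P.answer (d j.castSucc)) •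
          coinVec sl ω fun c => c.elim 1 fun i => sign (P.answer (d j.castSucc)) * α i)
    {pre mid : Fin G.a → Config G.size (G.D + 1) W → ℂ}
    (h : ∀ i, α i ≠ 0 → IsWave P (P.answer (d j.castSucc))
      (Function.update d j.succ (P.sub (d j.castSucc) i)) (Function.update sl j.succ i) (j + 1)
      (pre i) (mid i)) :
    IsWave P (P.answer (d j.castSucc)) d sl j
      (∑ i, (α i : ℂ) • (edgePre P (P.answer (d j.castSucc)) d sl j i + pre i))
      (∑ i, (α i : ℂ) • (edgeMid P (P.answer (d j.castSucc)) d sl j i + mid i)) where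
  steps := by
    rw [run_sum]
    refine Finset.sum_congr rfl fun i _ => ?_
    rw [run_smul, run_add, run_steps_edgePre hs]
    by_cases hi : α i = 0
    · simp [hi]
    · rw [(h i hi).steps]
  nodes τ hτ := by
    set v := P.answer (d j.castSucc) with hv
    have hlt : n₀ < P.size (d j.castSucc) := by rw [hn]; exact hG.lt j j.2
    have hL : Taux (P.size (d j.castSucc)) = G.L (j + 1) := by rw [hn]; exact hG.length j j.2
    -- Before the first step the child's register is |0…0⟩, as in `d`.
    have e0 : ∀ (i : Fin G.a) (e : Bool), edgeVec P d sl j i e 0 =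
        regVec G.w (arc e (j + 1) 0 (Function.update sl j.succ i)) (Pi.single d 1) := by
      intro i e
      rw [edgeVec, runSteps, workVec_single, ← hdj, Function.update_eq_self]
    have eL : ∀ (i : Fin G.a) (e : Bool), edgeVec P d sl j i e (G.L (j + 1)) =
        regVec G.w (portState τ e (j + 1) (Function.update sl j.succ i))
          (Pi.single (Function.update d j.succ (P.sub (d j.castSucc) i)) 1) := by
      intro i e
      rw [edgeVec, ← hL, P.step_exact _ hlt, workVec_single, hL, portState,
        xorState_parPat (by omega)]
    have key : ∀ i, (α i : ℂ) • run P (G.nodes τ) (edgeInterior P v d sl j i +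
        (edgeVec P d sl j i false (G.L (j + 1)) + mid i)) =
        (α i : ℂ) • (edgeInterior P v d sl j i +
          (sign v • edgeVec P d sl j i true (G.L (j + 1)) + pre i)) := by
      intro i
      by_cases hi : α i = 0
      · simp [hi]
      · rw [run_add, run_nodes_edgeInterior hτ hs, eL, (h i hi).nodes τ hτ, eL]
    have split : regVec G.w (portState τ false j sl) (Pi.single d 1) +
        ∑ i, (α i : ℂ) • (edgeMid P v d sl j i + mid i) =
        nodeVec τ false j sl (Pi.single d 1) (fun c => c.elim 1 fun i => sign v * α i) +
          ∑ i, (α i : ℂ) • (edgeInterior P v d sl j i +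
            (edgeVec P d sl j i false (G.L (j + 1)) + mid i)) := by
      rw [nodeVec, add_assoc, ← Finset.sum_add_distrib]
      simp only [Option.elim_none, Option.elim_some, one_smul, Bool.not_false, ← e0, edgeMid_eq]
      congr 1
      refine Finset.sum_congr rfl fun i _ => ?_
      module
    rw [split, run_add, run_sum, run_nodes_nodeVec _ j hτ hs hsj (hα _ _)]
    simp only [run_smul, key]
    rw [nodeVec, smul_add, add_assoc, Finset.smul_sum, ← Finset.sum_add_distrib]
    simp only [Option.elim_none, Option.elim_some, one_smul, Bool.not_true, ← e0, edgePre_eq,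
      smul_smul, ← mul_assoc, sign_mul_self, one_mul]
    congr 1
    refine Finset.sum_congr rfl fun i _ => ?_
    module
  slots y hy k hk := by
    rw [Finset.sum_apply] at hy
    obtain ⟨i, -, hi⟩ := Finset.exists_ne_zero_of_sum_ne_zero hy
    rw [Pi.smul_apply, smul_ne_zero_iff] at hi
    have hk' : k ≠ j.succ := by rintro rfl; simp at hk
    have e : Function.update sl j.succ (i : ℕ) k = sl k := by simp [hk']
    rw [← e]
    by_cases h0 : edgePre P (P.answer (d j.castSucc)) d sl j i y = 0
    · rw [Pi.add_apply, h0, zero_add] at hi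
      exact (h i (by exact_mod_cast hi.1)).slots y hi.2 k (by omega)
    · exact (regVal_of_edgePre_ne_zero hs h0).2 k
  levels y hy := by
    rw [Finset.sum_apply] at hy
    obtain ⟨i, -, hi⟩ := Finset.exists_ne_zero_of_sum_ne_zero hy
    rw [Pi.smul_apply, smul_ne_zero_iff] at hi
    by_cases h0 : edgePre P (P.answer (d j.castSucc)) d sl j i y = 0
    · rw [Pi.add_apply, h0, zero_add] at hi
      have := (h i (by exact_mod_cast hi.1)).levels y hi.2
      omega
    · rw [(regVal_of_edgePre_ne_zero hs h0).1]
      omega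

/-- Different children are orthogonal because `slot j.succ` holds the index; an edge is orthogonal
to the wave below it because its level is exactly `j + 1`. -/
theorem nsq_inner_le (hs : ∀ k, sl k < 2 ^ G.w) {v : Bool} {j : Fin G.D}
    {d : Fin (G.D + 1) → Desc W} {d' : Fin G.a → Fin (G.D + 1) → Desc W} {α : Fin G.a → ℝ} {E : ℝ}
    {pre mid : Fin G.a → Config G.size (G.D + 1) W → ℂ}
    (h : ∀ i, α i ≠ 0 → IsWave P v (d' i) (Function.update sl j.succ i) (j + 1) (pre i) (mid i))
    (hE : ∀ i, α i ≠ 0 → nsq (pre i) ≤ E) :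
    nsq (∑ i, (α i : ℂ) • (edgePre P v d sl j i + pre i)) ≤
      (∑ i, α i ^ 2) * (2 * G.L (j + 1) + E) := by
  rw [nsq_sum_of_label (fun y => regVal (regQubit G.w (slot j.succ : G.Reg)) y.1)
    (fun i : Fin G.a => (i : ℕ)) Fin.val_injective, Finset.sum_mul]
  · refine Finset.sum_le_sum fun i _ => ?_
    by_cases hi : α i = 0
    · simp [hi, nsq]
    · rw [nsq_smul, Complex.norm_real, Real.norm_eq_abs, sq_abs, nsq_add_of_disjoint, nsq_edgePre hs]
      · gcongr
        exact hE i hi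
      · intro y
        by_contra! h0
        have h1 := (regVal_of_edgePre_ne_zero hs h0.1).1
        have h2 := (h i hi).levels y h0.2
        omega
  · intro i _ y hy
    rw [Pi.smul_apply, smul_ne_zero_iff] at hy
    have e : Function.update sl j.succ (i : ℕ) j.succ = i := by simp
    by_cases h0 : edgePre P v d sl j i y = 0
    · rw [Pi.add_apply, h0, zero_add] at hy
      rw [(h i (by exact_mod_cast hy.1)).slots y hy.2 j.succ (by simp), e]
    · rw [(regVal_of_edgePre_ne_zero hs h0).2 j.succ, e]

/-- Below every node there is a stationary wave of bounded norm that is reflected with the sign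
given by the answer of the node. -/
theorem exists_isWave {n : ℝ} (hG : G.Fits b n₀ Taux n) {E : ℕ → ℝ} (hE₀ : 0 ≤ E G.D)
    (hE : ∀ j < G.D, √G.a * (2 * G.L (j + 1) + E (j + 1)) ≤ E j) (m : ℕ) :
    ∀ (j : Fin (G.D + 1)) (_ : j + m = G.D) (d : Fin (G.D + 1) → Desc W)
      (sl : Fin (G.D + 1) → ℕ) (_ : ∀ k, sl k < 2 ^ G.w) (_ : ∀ k, j < k → sl k = 0)
      (_ : ∀ k, j < k → d k = fun _ => false) (_ : P.size (d j) = n / b ^ (j : ℕ)),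
      ∃ pre mid, IsWave P (P.answer (d j)) d sl j pre mid ∧ nsq pre ≤ E j := by
  induction m with
  | zero =>
    intro j hj d sl hs _ _ hn
    obtain rfl : j = Fin.last _ := Fin.ext (by simpa using hj)
    exact ⟨0, 0, isWave_leaf hG hs hn, by simpa [nsq] using hE₀⟩
  | succ m ih =>
    intro j hj d sl hs hsl hd hn
    obtain ⟨j, rfl⟩ : ∃ j' : Fin G.D, j = j'.castSucc := ⟨⟨j, by omega⟩, rfl⟩
    simp only [Fin.val_castSucc] at hj hn ⊢
    have hlt : n₀ < P.size (d j.castSucc) := by rw [hn]; exact hG.lt j j.2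
    obtain ⟨α, h1, h2, h3⟩ := exists_amplitudes (P := P) hlt
    have hjs : j.castSucc < j.succ := Fin.castSucc_lt_succ
    have H : ∀ i, ∃ pre mid, α i ≠ 0 → IsWave P (P.answer (d j.castSucc))
        (Function.update d j.succ (P.sub (d j.castSucc) i)) (Function.update sl j.succ (i : ℕ))
        (j + 1) pre mid ∧ nsq pre ≤ E (j + 1) := by
      intro i
      -- A child without amplitude may have a different answer from its parent; it needs no wave,
      -- and `0` is a dummy value.
      by_cases hi : α i = 0
      · exact ⟨0, 0, fun h => absurd hi h⟩
      · obtain ⟨pre, mid, h, h'⟩ := ih j.succ (by simp only [Fin.val_succ]; omega)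
          (Function.update d j.succ (P.sub (d j.castSucc) i))
          (Function.update sl j.succ (i : ℕ)) (update_lt hs _ i)
          (fun k hk => by rw [Function.update_of_ne hk.ne', hsl k (hjs.trans hk)])
          (fun k hk => by rw [Function.update_of_ne hk.ne', hd k (hjs.trans hk)])
          (by rw [Function.update_self, P.size_sub _ hlt, hn, Fin.val_succ, pow_succ, div_div])
        rw [Function.update_self, h1 i hi] at h
        exact ⟨pre, mid, fun _ => ⟨h, h'⟩⟩
    choose pre mid h using H
    refine ⟨_, _, isWave_inner hG hs (hsl _ hjs) (hd _ hjs) hn (h3 j j.2) fun i hi => (h i hi).1, ?_⟩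
    refine (nsq_inner_le hs (fun i hi => (h i hi).1) fun i hi => (h i hi).2).trans ?_
    rw [h2]
    exact hE j j.2

end WalkData

namespace WalkData

variable {G : WalkData} {W : ℕ} {b n₀ : ℝ} {Taux : ℝ → ℕ} {P : OrDivideConquer G.a b n₀ Taux W}

/-! ### The complete circuit -/

/-- The descriptions of the instances in the work registers at the beginning. -/
def initDesc (r : Desc W) : Fin (G.D + 1) → Desc W :=
  fun k => if (k : ℕ) = 0 then r else fun _ => false

/-- Basis state of a particle outside of the tree. -/
def waitState (c : Bool) (τ : ℕ) : G.Reg → ℕ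
  | ctl => c.toNat
  | pub => 1
  | cnt => τ
  | _ => 0

noncomputable def waitVec (G : WalkData) (r : Desc W) (c : Bool) (τ : ℕ) :
    Config G.size (G.D + 1) W → ℂ :=
  regVec G.w (waitState c τ) (Pi.single (initDesc r) 1)

/-- The outside world is the parent port of the root: entering and leaving particles are waiting
particles with control `1`. -/
theorem portState_zero (τ : ℕ) (e : Bool) :
    portState (G := G) τ e 0 (fun _ => 0) = waitState true τ := by
  funext r
  cases r <;> simp [portState, xorState, parPat, xorVal, pathState, waitState]

theorem run_steps_waitVec (r : Desc W) (c : Bool) (τ : ℕ) :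
    run P G.steps (waitVec G r c τ) = waitVec G r c τ := by
  rw [steps, run_append, waitVec, run_stepHalf_idle _ rfl]
  exact run_circuitInv (run_stepHalf_idle _ rfl)

theorem run_nodes_waitVec (r : Desc W) {c : Bool} {τ τ' : ℕ} (hτ : τ < 2 ^ G.w)
    (hτ' : τ' < 2 ^ G.w) (h : c = false ∨ τ' ≠ τ) :
    run P (G.nodes τ) (waitVec G r c τ') = waitVec G r c τ' := by
  have h1 := G.one_lt_pow
  refine run_flatMap_of_fixed fun j hj => ?_
  rw [List.mem_range] at hj
  refine run_node_fixed _ (by omega) hτ ?_ (fun _ => rfl) rfl (fun e hm => ?_) (fun e => ?_)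
  · have := Bool.toNat_le c
    intro r
    cases r <;> simp only [waitState] <;> omega
  · by_cases hj0 : j = 0
    · have h2 := hm ctl (by simp [parPat, hj0])
      have h3 := hm cnt (by simp [parPat, hj0])
      simp [parPat, hj0, waitState, xorVal] at h2 h3
      rcases h with h | h
      · rw [h] at h2; exact absurd h2 (by simp)
      · exact h h3
    · have h2 := hm (lev e) (by simp [parPat, hj0])
      simp [parPat, hj0, waitState, xorVal] at h2
      exact hj0 h2.symm
  · left; simp [waitState]

/-- The state of the particles outside of the tree after `s` iterations. -/
noncomputable def loopVec (G : WalkData) (r : Desc W) (v : Bool) (s : ℕ) :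
    Config G.size (G.D + 1) W → ℂ :=
  ∑ τ ∈ Finset.range (2 ^ G.κ), waitVec G r false τ +
    ∑ τ ∈ Finset.range (2 ^ G.κ), (if τ < s then sign v else 1) • waitVec G r true τ

variable (G) in
/-- The main loop. -/
noncomputable def loop (s : ℕ) : G.Circuit := (List.range s).flatMap fun τ => G.steps ++ G.nodes τ

/-- Only the term with control `1` and counter `s` enters the root; it comes back with the sign of
the answer while the wave is restored. All other terms wait. -/
theorem run_iteration {r : Desc W} {v : Bool} {pre mid : Config G.size (G.D + 1) W → ℂ}
    (h : IsWave P v (initDesc r) (fun _ => 0) 0 pre mid) {s : ℕ} (hs : s < 2 ^ G.κ) :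
    run P (G.steps ++ G.nodes s) (loopVec G r v s + pre) = loopVec G r v (s + 1) + pre := by
  have hκ : 2 ^ G.κ ≤ 2 ^ G.w := Nat.pow_le_pow_right (by norm_num) G.κ_le
  have h1 : run P G.steps (loopVec G r v s) = loopVec G r v s := by
    simp only [loopVec, run_add, run_sum, run_smul, run_steps_waitVec]
  have split : ∀ s', loopVec G r v s' = (∑ τ ∈ Finset.range (2 ^ G.κ), waitVec G r false τ +
      ∑ τ ∈ (Finset.range (2 ^ G.κ)).erase s, (if τ < s' then sign v else 1) • waitVec G r true τ) +
      (if s < s' then sign v else 1) • waitVec G r true s := by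
    intro s'
    rw [loopVec, ← Finset.sum_erase_add _ (fun τ => (if τ < s' then sign v else 1) • waitVec G r true τ)
      (Finset.mem_range.2 hs), add_assoc]
  have h2 := h.nodes s (by omega)
  rw [portState_zero, portState_zero] at h2
  rw [run_append, run_add, h1, h.steps, split s, split (s + 1), if_neg (lt_irrefl s),
    if_pos (Nat.lt_succ_self s), one_smul, add_assoc, run_add, waitVec, h2, run_add, run_sum, run_sum,
    ← add_assoc]
  have e1 : ∀ τ ∈ Finset.range (2 ^ G.κ), run P (G.nodes s) (waitVec G r false τ) =
      waitVec G r false τ := by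
    intro τ hτ
    rw [Finset.mem_range] at hτ
    exact run_nodes_waitVec r (by omega) (by omega) (.inl rfl)
  have e2 : ∀ τ ∈ (Finset.range (2 ^ G.κ)).erase s,
      run P (G.nodes s) ((if τ < s then sign v else 1) • waitVec G r true τ) =
      (if τ < s + 1 then sign v else 1) • waitVec G r true τ := by
    intro τ hτ
    rw [Finset.mem_erase, Finset.mem_range] at hτ
    have : τ < s + 1 ↔ τ < s := by omega
    rw [run_smul, run_nodes_waitVec r (by omega) (by omega) (.inr hτ.1)]
    simp only [this]
  rw [Finset.sum_congr rfl e1, Finset.sum_congr rfl e2]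

theorem run_loop {r : Desc W} {v : Bool} {pre mid : Config G.size (G.D + 1) W → ℂ}
    (h : IsWave P v (initDesc r) (fun _ => 0) 0 pre mid) {s : ℕ} (hs : s ≤ 2 ^ G.κ) :
    run P (G.loop s) (loopVec G r v 0 + pre) = loopVec G r v s + pre := by
  induction s with
  | zero => simp [loop]
  | succ s ih =>
    have : G.loop (s + 1) = G.loop s ++ (G.steps ++ G.nodes s) := by
      simp [loop, List.range_succ]
    rw [this, run_append, ih (by omega), run_iteration h (by omega)]

variable (G) in
/-- Rotate a qubit of a register. -/
noncomputable def mixGate (r : G.Reg) (j : Fin G.w) : Gate G.size (G.D + 1) :=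
  .two (regQubit G.w r j) (ancilla _ _ false) (regQubit_ne_ancilla _ _ _)
    ⟨mixMatrix, mixMatrix_unitary⟩

theorem update_regState {ρ : G.Reg → ℕ} {r : G.Reg} {j : Fin G.w} {v : ℕ} {c : Bool}
    (hv : ∀ i : Fin G.w, v.testBit i = if i = j then c else (ρ r).testBit i) :
    Function.update (regState G.w false true ρ) (regQubit G.w r j) c =
      regState G.w false true (Function.update ρ r v) := by
  funext q
  revert q
  apply qubit_cases
  · rw [Function.update_of_ne (regQubit_ne_ancilla _ _ _).symm]; simp
  · rw [Function.update_of_ne (regQubit_ne_ancilla _ _ _).symm]; simp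
  · intro r' i
    by_cases hr : r' = r
    · subst hr
      by_cases hi : i = j
      · subst hi; simp [hv]
      · rw [Function.update_of_ne (by simp [regQubit_inj, hi])]
        simp [hv, hi]
    · rw [Function.update_of_ne (by simp [regQubit_inj, hr])]
      simp [hr]

theorem run_mixGate (ρ : G.Reg → ℕ) (r : G.Reg) (j : Fin G.w) {v v' : ℕ}
    (hv : ∀ i : Fin G.w, v.testBit i = if i = j then false else (ρ r).testBit i)
    (hv' : ∀ i : Fin G.w, v'.testBit i = if i = j then true else (ρ r).testBit i)
    (ω : (Fin (G.D + 1) → Desc W) → ℂ) :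
    run P [G.mixGate r j] (regVec G.w ρ ω) = (((√2)⁻¹ : ℝ) : ℂ) •
      ((if (ρ r).testBit j then -1 else 1 : ℂ) • regVec G.w (Function.update ρ r v) ω +
        regVec G.w (Function.update ρ r v') ω) := by
  rw [run_singleton, regVec]
  refine (mixMatrix_mulVec_emb (regQubit_ne_ancilla _ _ _) _ _).trans ?_
  rw [update_regState hv, update_regState hv', regState_regQubit]
  rfl

theorem testBit_toNat (c : Bool) (i : Fin G.w) :
    c.toNat.testBit i = if i = ⟨0, G.w_pos⟩ then c else false := by
  by_cases hi : i = ⟨0, G.w_pos⟩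
  · subst hi; cases c <;> simp
  · have : (i : ℕ) ≠ 0 := fun h => hi (Fin.ext h)
    rw [if_neg hi]
    cases c
    · simp
    · rw [Bool.toNat_true, Nat.testBit_lt_two_pow (Nat.one_lt_two_pow this)]

theorem run_mix_waitVec (r : Desc W) (c : Bool) (τ : ℕ) :
    run P [G.mixGate ctl ⟨0, G.w_pos⟩] (waitVec G r c τ) = (((√2)⁻¹ : ℝ) : ℂ) •
      ((if c then -1 else 1 : ℂ) • waitVec G r false τ + waitVec G r true τ) := by
  have e : ∀ c' : Bool, Function.update (waitState c τ : G.Reg → ℕ) ctl c'.toNat =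
      waitState c' τ := by
    intro c'
    funext r
    cases r <;> simp [waitState]
  have e' : ∀ (c' : Bool) (i : Fin G.w), c'.toNat.testBit i =
      if i = ⟨0, G.w_pos⟩ then c' else ((waitState c τ : G.Reg → ℕ) ctl).testBit i := by
    intro c' i
    rw [testBit_toNat]
    split_ifs with h
    · rfl
    · exact ((testBit_toNat c i).trans (if_neg h)).symm
  rw [waitVec, run_mixGate _ _ _ (e' false) (e' true), e, e, waitVec, waitVec]
  have : ((waitState c τ : G.Reg → ℕ) ctl).testBit ((⟨0, G.w_pos⟩ : Fin G.w) : ℕ) = c := by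
    cases c <;> simp [waitState]
  rw [this]

variable (G) in
/-- Prepare the uniform superposition of the numbers below `2 ^ s` in the counter. -/
noncomputable def mixCounter : (s : ℕ) → s ≤ G.w → G.Circuit
  | 0, _ => []
  | s + 1, h => mixCounter s (by omega) ++ [G.mixGate cnt ⟨s, by omega⟩]

/-- Bit `s` of a number `τ < 2 ^ s` is `0`, so rotating it yields the sum of `τ` and `2 ^ s + τ`. -/
theorem run_mixCounter (r : Desc W) (c : Bool) {s : ℕ} (hs : s ≤ G.w) :
    run P (G.mixCounter s hs) (waitVec G r c 0) =
      (((√2)⁻¹ : ℝ) : ℂ) ^ s • ∑ τ ∈ Finset.range (2 ^ s), waitVec G r c τ := by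
  induction s with
  | zero => simp [mixCounter]
  | succ s ih =>
    have key : ∀ τ ∈ Finset.range (2 ^ s), run P [G.mixGate cnt ⟨s, by omega⟩] (waitVec G r c τ) =
        (((√2)⁻¹ : ℝ) : ℂ) • (waitVec G r c τ + waitVec G r c (2 ^ s + τ)) := by
      intro τ hτ
      rw [Finset.mem_range] at hτ
      have e : ∀ v, Function.update (waitState c τ : G.Reg → ℕ) cnt v = waitState c v := by
        intro v
        funext r
        cases r <;> simp [waitState]
      have h1 : τ.testBit s = false := Nat.testBit_lt_two_pow hτ
      have h2 : 2 ^ s + τ = 2 ^ s ||| τ := by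
        have := Nat.two_pow_add_eq_or_of_lt hτ 1
        simpa using this
      rw [waitVec, run_mixGate (v := τ) (v' := 2 ^ s + τ), e, e]
      · have : ((waitState c τ : G.Reg → ℕ) cnt).testBit ((⟨s, by omega⟩ : Fin G.w) : ℕ) = false := h1
        rw [this]
        simp [waitVec]
      · intro i
        split_ifs with hi
        · subst hi; exact h1
        · rfl
      · intro i
        rw [h2, Nat.testBit_or, Nat.testBit_two_pow]
        split_ifs with hi
        · subst hi; simp
        · have : s ≠ i := fun h => hi (Fin.ext h.symm)
          simp [this, waitState]
    rw [mixCounter, run_append, ih, run_smul, run_sum, Finset.sum_congr rfl key, ← Finset.smul_sum,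
      Finset.sum_add_distrib, pow_succ 2 s, mul_two, Finset.sum_range_add, smul_smul, pow_succ]

theorem ancilla_ne : ancilla G.Reg G.w false ≠ ancilla G.Reg G.w true := by simp [ancilla_inj]

variable (G) in
/-- Flip one of the ancillas. -/
noncomputable def ancillaGate : Gate G.size (G.D + 1) :=
  .two (ancilla _ _ false) (ancilla _ _ true) ancilla_ne (flipUnitary fun _ => true)

variable (G) in
/-- Preparation of the initial superposition. -/
noncomputable def prepare : G.Circuit :=
  [G.ancillaGate] ++
    xorCircuit _ _ (fun _ => true) [(pub, 1)] ++ [G.mixGate ctl ⟨0, G.w_pos⟩] ++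
    G.mixCounter G.κ G.κ_le

variable (G) in
/-- The circuit that solves the problem. -/
noncomputable def circuit : G.Circuit :=
  G.prepare ++ (G.loop (2 ^ G.κ) ++ [G.mixGate ctl ⟨0, G.w_pos⟩])

theorem run_prepare (r : Desc W) (v : Bool) :
    run P G.prepare (Pi.single (initConfig r) 1) =
      (((√2)⁻¹ : ℝ) : ℂ) ^ (G.κ + 1) • loopVec G r v 0 := by
  have e0 : (initConfig r : Config G.size (G.D + 1) W) =
      (regState G.w false false fun _ => 0, initDesc r) := by
    refine Prod.ext (funext fun q => ?_) rfl
    revert q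
    apply qubit_cases
    · simp [initConfig]
    · simp [initConfig]
    · intro r j; simp [initConfig]
  have e1 : (Pi.single (initConfig r) 1 : Config G.size (G.D + 1) W → ℂ) =
      emb (regState G.w false false fun _ => 0) (Pi.single (initDesc r) 1) := by
    rw [emb_single, e0]
  -- The zero tests need the second ancilla to be `1` at rest.
  have e2 : Function.update (regState G.w false false fun _ : G.Reg => 0) (ancilla _ _ true) true =
      regState G.w false true fun _ => 0 := by
    funext q
    revert q
    apply qubit_cases
    · simp [ancilla_inj]
    · simp
    · intro r j
      rw [Function.update_of_ne (regQubit_ne_ancilla _ _ _)]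
      simp
  have e3 : xorState (fun _ : G.Reg => 0) [(pub, 1)] = waitState false 0 := by
    funext r
    cases r <;> simp [xorState, xorVal, waitState]
  rw [prepare, run_append, run_append, run_append, e1]
  have e4 : run P [G.ancillaGate] (
      emb (regState G.w false false fun _ => 0) (Pi.single (initDesc r) 1)) =
      emb (regState G.w false true fun _ => 0) (Pi.single (initDesc r) 1) := by
    rw [run_singleton]
    refine (flipUnitary_mulVec_emb ancilla_ne _ _ _).trans ?_
    rw [← e2]
    simp
  rw [e4, run_xorCircuit, if_pos rfl, e3]
  have e5 : emb (regState G.w false true (waitState false 0)) (Pi.single (initDesc r) 1) =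
      waitVec G r false 0 := by rw [waitVec, regVec]
  rw [e5, run_mix_waitVec, run_smul, run_add, run_smul, run_mixCounter, run_mixCounter, loopVec]
  simp only [Bool.false_eq_true, if_false, one_smul, Nat.not_lt_zero, pow_succ]
  module

theorem regState_out {r : Desc W} {c : Bool} {τ : ℕ} {y : Config G.size (G.D + 1) W}
    (h : waitVec G r c τ y ≠ 0) : y.1 (G.low ctl) = c := by
  have : y.1 = regState G.w false true (waitState c τ) := by
    by_contra h'
    rw [waitVec, regVec, emb, if_neg h'] at h
    exact h rfl
  rw [this, regState_low]
  cases c <;> simp [waitState]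

/-- By now every slot carries the sign. The rotation maps |0⟩ + |1⟩ to √2 |1⟩ and |0⟩ - |1⟩ to √2
|0⟩, so the control qubit shows the answer. -/
theorem run_mix_loopVec (r : Desc W) (v : Bool) :
    run P [G.mixGate ctl ⟨0, G.w_pos⟩] (loopVec G r v (2 ^ G.κ)) =
      ((((√2)⁻¹ : ℝ) : ℂ) * 2) • ∑ τ ∈ Finset.range (2 ^ G.κ), waitVec G r v τ := by
  have e : loopVec G r v (2 ^ G.κ) = ∑ τ ∈ Finset.range (2 ^ G.κ),
      (waitVec G r false τ + sign v • waitVec G r true τ) := by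
    rw [loopVec, ← Finset.sum_add_distrib]
    refine Finset.sum_congr rfl fun τ hτ => ?_
    rw [if_pos (Finset.mem_range.1 hτ)]
  rw [e, run_sum, Finset.smul_sum]
  refine Finset.sum_congr rfl fun τ _ => ?_
  rw [run_add, run_smul, run_mix_waitVec, run_mix_waitVec]
  cases v <;> simp only [sign, Bool.false_eq_true, if_false, if_true] <;> module

theorem sum_filter_le_nsq {X : Type} [Fintype X] {p : X → Prop} [DecidablePred p] {u t err : X → ℂ}
    (h : u = t + err) (ht : ∀ x, p x → t x = 0) : ∑ x with p x, ‖u x‖ ^ 2 ≤ nsq err := by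
  refine (Finset.sum_le_sum fun x hx => ?_).trans
    (Finset.sum_le_sum_of_subset_of_nonneg (Finset.filter_subset p _) fun _ _ _ => by positivity)
  rw [h, Pi.add_apply, ht x (Finset.mem_filter.1 hx).2, zero_add]

/-- The wrong outcome is improbable if there is a stationary wave of small norm. -/
theorem wrong_prob_le {r : Desc W} {v : Bool} {pre mid : Config G.size (G.D + 1) W → ℂ}
    (h : IsWave P v (initDesc r) (fun _ => 0) 0 pre mid) (hκ : 6 * nsq pre ≤ 2 ^ G.κ) :
    ∑ y : Config G.size (G.D + 1) W with y.1 (G.low ctl) = !v,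
      ‖run P G.circuit (Pi.single (initConfig r) 1) y‖ ^ 2 ≤ 1 / 3 := by
  obtain ⟨c, hc⟩ : ∃ c : ℂ, c = (((√2)⁻¹ : ℝ) : ℂ) := ⟨_, rfl⟩
  have hcn : ‖c ^ (G.κ + 1)‖ ^ 2 = ((2 : ℝ) ^ (G.κ + 1))⁻¹ := by
    rw [norm_pow, hc, Complex.norm_real, Real.norm_of_nonneg (by positivity), ← pow_mul, mul_comm,
      pow_mul, inv_pow, Real.sq_sqrt (by norm_num), inv_pow]
  -- By linearity, the error of starting without the wave is the difference between the wave and its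
  -- image under the loop.
  obtain ⟨err, herr⟩ : ∃ err : Config G.size (G.D + 1) W → ℂ, err = c ^ (G.κ + 1) •
    run P [G.mixGate ctl ⟨0, G.w_pos⟩] (pre - run P (G.loop (2 ^ G.κ)) pre) := ⟨_, rfl⟩
  have key : run P G.circuit (Pi.single (initConfig r) 1) = c ^ (G.κ + 1) • (c * 2) •
      ∑ τ ∈ Finset.range (2 ^ G.κ), waitVec G r v τ + err := by
    have h1 := run_loop h le_rfl
    rw [run_add] at h1
    have h2 : run P (G.loop (2 ^ G.κ)) (loopVec G r v 0) =
        loopVec G r v (2 ^ G.κ) + (pre - run P (G.loop (2 ^ G.κ)) pre) := by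
      rw [eq_sub_of_add_eq h1]; abel
    rw [circuit, run_append, run_prepare r v, run_smul, run_append, h2, run_add, run_mix_loopVec,
      smul_add, herr, hc]
  -- The difference has squared norm at most `4 * nsq pre`, and the normalisation divides it by `2 ^
  -- (κ + 1)`; this explains the factor 6 in `hκ`.
  have hle : nsq err ≤ 1 / 3 := by
    rw [herr, nsq_smul, nsq_run, hcn]
    have h1 := nsq_sub_le pre (run P (G.loop (2 ^ G.κ)) pre)
    rw [nsq_run] at h1
    rw [inv_mul_le_iff₀ (by positivity), pow_succ]
    linarith
  refine (sum_filter_le_nsq key fun y hy => ?_).trans hle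
  rw [Pi.smul_apply, Pi.smul_apply, Finset.sum_apply, Finset.sum_eq_zero, smul_zero, smul_zero]
  intro τ _
  by_contra h'
  have := regState_out h'
  rw [this] at hy
  simp at hy

theorem acceptProb_circuit {r : Desc W} {v : Bool} {pre mid : Config G.size (G.D + 1) W → ℂ}
    (h : IsWave P v (initDesc r) (fun _ => 0) 0 pre mid) (hκ : 6 * nsq pre ≤ 2 ^ G.κ) :
    (v = true → 2 / 3 ≤ acceptProb P G.circuit (G.low ctl) r) ∧
      (v = false → acceptProb P G.circuit (G.low ctl) r ≤ 1 / 3) := by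
  have e : acceptProb P G.circuit (G.low ctl) r =
      ∑ y : Config G.size (G.D + 1) W with y.1 (G.low ctl) = true,
        ‖run P G.circuit (Pi.single (initConfig r) 1) y‖ ^ 2 := by
    simp only [acceptProb, run, Matrix.mulVec_single_one, Matrix.col_apply]
  have hw := wrong_prob_le h hκ
  constructor
  · rintro rfl
    have h1 : nsq (run P G.circuit (Pi.single (initConfig r) 1)) = 1 := by
      rw [nsq_run, nsq, Finset.sum_eq_single (initConfig r)
        (by intro z _ hz; rw [Pi.single_eq_of_ne hz]; simp) (by simp)]
      simp
    rw [nsq, ← Finset.sum_filter_add_sum_filter_not _ (fun y => y.1 (G.low ctl) = true), ← e] at h1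
    simp only [Bool.not_true] at hw
    simp only [Bool.not_eq_true] at h1
    linarith
  · rintro rfl
    rw [e]
    simpa using hw

/-! Numbers of gates. -/

theorem queryCount_convIn (τ : ℕ) (e : Bool) (j : ℕ) : queryCount (G.convIn τ e j) = 0 := by
  rw [convIn, queryCount_append, queryCount_move, zero_add]
  split_ifs
  · exact queryCount_flatMap_eq_zero fun i => queryCount_move _ _
  · rfl

theorem queryCount_givens (g p : ℝ) (l : List (Fin G.a)) : queryCount (G.givens g p l) = 0 := by
  induction l generalizing p with
  | nil => rfl
  | cons i l ih =>
    rw [givens, ← List.singleton_append, queryCount_append, ih]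
    rfl

theorem queryCount_node (τ j : ℕ) : queryCount (G.node τ j) = if j < G.D then 0 else 2 := by
  rw [node, queryCount_append, queryCount_append, queryCount_circuitInv, queryCount_convIn,
    queryCount_convIn, scatter]
  split_ifs
  · rw [queryCount_append, queryCount_append, queryCount_circuitInv, queryCount_givens]
    rfl
  · simp only [leaf, leafLevel, queryCount_append, queryCount_circuitInv, queryCount_controlled]
    rfl

theorem queryCount_nodes (τ : ℕ) : queryCount (G.nodes τ) = 2 := by
  rw [nodes, List.range_succ, List.flatMap_append, queryCount_append, queryCount_flatMap]
  have : (List.range G.D).map (fun j => queryCount (G.node τ j)) = (List.range G.D).map fun _ => 0 := by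
    refine List.map_congr_left fun j hj => ?_
    rw [queryCount_node, if_pos (List.mem_range.1 hj)]
  rw [this]
  simp [queryCount_node]

theorem queryCount_steps : queryCount G.steps = 2 := by
  have : ∀ e, queryCount (G.stepHalf e) = 1 := by
    intro e
    have h1 : queryCount (G.fetch e) = 0 :=
      queryCount_flatMap_eq_zero fun p => queryCount_controlled _ _
    rw [stepHalf, queryCount_append, queryCount_append, queryCount_circuitInv, h1]
    rfl
  rw [steps, queryCount_append, queryCount_circuitInv, this, this]

theorem queryCount_mixCounter (s : ℕ) (hs : s ≤ G.w) : queryCount (G.mixCounter s hs) = 0 := by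
  induction s with
  | zero => rfl
  | succ s ih => rw [mixCounter, queryCount_append, ih]; rfl

/-- An iteration calls the step oracle once, its inverse once, and the marking oracle twice, at the
leaf level only. -/
theorem queryCount_circuit : queryCount G.circuit = 4 * 2 ^ G.κ := by
  have : queryCount G.prepare = 0 := by
    rw [prepare, queryCount_append, queryCount_append, queryCount_append, queryCount_mixCounter,
      queryCount_xorCircuit]
    rfl
  rw [circuit, queryCount_append, queryCount_append, this, loop, queryCount_flatMap]
  simp only [queryCount_append, queryCount_nodes, queryCount_steps]
  simp [queryCount, Gate.isQuery, mixGate, mul_comm]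

theorem length_convIn_le (τ : ℕ) (e : Bool) (j : ℕ) :
    (G.convIn τ e j).length ≤ 24 * (G.a + 1) * G.w := by
  have hw := G.w_pos
  have h1 : ∀ (p : List (G.Reg × ℕ)) c, p.length ≤ 3 →
      (move (G.D + 1) G.w p c).length ≤ 24 * G.w := by
    intro p c hp
    refine (length_move_le p c).trans ?_
    nlinarith
  have h2 := h1 (G.parPat τ e j) (coin none) (by rw [parPat]; split_ifs <;> simp)
  rw [convIn, List.length_append]
  split_ifs with hj
  · have h3 := length_flatMap_le (l := List.finRange G.a) fun i =>
      h1 (G.childPat (!e) hj i) (coin (some i)) (by simp [childPat])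
    rw [List.length_finRange] at h3
    nlinarith
  · simp only [List.length_nil]
    nlinarith

theorem length_givens (g p : ℝ) (l : List (Fin G.a)) : (G.givens g p l).length = l.length := by
  induction l generalizing p with
  | nil => rfl
  | cons i l ih => rw [givens, List.length_cons, ih, List.length_cons]

theorem length_node_le (τ j : ℕ) : (G.node τ j).length ≤ 100 * (G.a + 1) * G.w := by
  have hw := G.w_pos
  have h1 := G.length_convIn_le τ false j
  have h2 := G.length_convIn_le τ true j
  have h3 : (G.scatter j).length ≤ 30 * (G.a + 1) * G.w := by
    rw [scatter]
    split_ifs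
    · simp only [List.length_append, length_circuitInv, length_givens, List.length_finRange,
        List.length_singleton]
      nlinarith
    · have h4 := length_controlled_le (K := G.D + 1) (w := G.w) [((coin none : G.Reg), 1)] [(mlev, G.D)]
      have h5 := length_controlled_le (K := G.D + 1) (w := G.w) [((coin none : G.Reg), 0)] [(mlev, G.D + 1)]
      simp only [leaf, leafLevel, List.length_append, length_circuitInv, List.length_singleton] at *
      have := G.a_pos
      nlinarith
  simp only [node, List.length_append, length_circuitInv]
  nlinarith

theorem length_steps_le : G.steps.length ≤ 50 * (G.D + 1) * (G.a + 1) * G.w := by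
  have hw := G.w_pos
  have h1 : ∀ e, (G.fetch e).length ≤ G.D * G.a * (11 * G.w) := by
    intro e
    have := length_flatMap_le (α := Gate G.size (G.D + 1)) (l := List.finRange G.D ×ˢ List.finRange G.a)
      (f := fun p => controlled _ G.w [(lev e, p.1 + 1), (slot p.1.succ, p.2)] [(idx, p.2)])
      (m := 11 * G.w) fun p => (length_controlled_le _ _).trans (by simp; omega)
    rw [List.length_product, List.length_finRange, List.length_finRange] at this
    exact this
  have h2 := h1 true
  have h3 := h1 false
  simp only [steps, stepHalf, List.length_append, length_circuitInv, List.length_singleton]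
  have : 1 ≤ (G.D + 1) * G.w := Nat.mul_pos (by omega) hw
  nlinarith [Nat.zero_le (G.D * G.a * G.w), Nat.zero_le (G.D * G.w), Nat.zero_le (G.a * G.w)]

theorem length_mixCounter (s : ℕ) (hs : s ≤ G.w) : (G.mixCounter s hs).length = s := by
  induction s with
  | zero => rfl
  | succ s ih => rw [mixCounter, List.length_append, ih, List.length_singleton]

/-- Of the constant 155, the nodes account for 100, the steps for 50, and preparation with the final
rotation for 5. -/
theorem length_circuit_le :
    G.circuit.length ≤ 2 ^ G.κ * (155 * (G.D + 1) * (G.a + 1) * G.w) := by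
  have hw := G.w_pos
  have hκ := G.κ_le
  have h1 : ∀ τ, (G.steps ++ G.nodes τ).length ≤ 150 * (G.D + 1) * (G.a + 1) * G.w := by
    intro τ
    have h2 := length_flatMap_le (l := List.range (G.D + 1)) (G.length_node_le τ)
    rw [List.length_range] at h2
    have h3 := G.length_steps_le
    rw [List.length_append, nodes]
    nlinarith
  have h4 := length_flatMap_le (l := List.range (2 ^ G.κ)) h1
  rw [List.length_range] at h4
  have h5 := length_xorCircuit_le (K := G.D + 1) (w := G.w) (fun _ => true) [((pub : G.Reg), 1)]
  have h6 : G.prepare.length ≤ 2 + 2 * G.w := by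
    simp only [prepare, List.length_append, List.length_singleton, length_mixCounter] at h5 ⊢
    omega
  have h7 : 3 + 2 * G.w ≤ 5 * (G.D + 1) * (G.a + 1) * G.w := by
    have : 1 ≤ (G.D + 1) * (G.a + 1) := Nat.mul_pos (by omega) (by omega)
    nlinarith
  have h8 : 1 ≤ 2 ^ G.κ := Nat.one_le_two_pow
  rw [circuit, List.length_append, List.length_append, loop, List.length_singleton]
  have h9 : 3 + 2 * G.w ≤ 2 ^ G.κ * (5 * (G.D + 1) * (G.a + 1) * G.w) :=
    h7.trans (Nat.le_mul_of_pos_left _ h8)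
  nlinarith

end WalkData

/-! ### The recurrence -/

section Recurrence

variable {a : ℕ} {b n₀ : ℝ} {Taux : ℝ → ℕ} {TQ : ℝ → ℝ}

theorem exists_div_pow_le (hb : 1 < b) (h₀ : 1 ≤ n₀) (x : ℝ) : ∃ k : ℕ, x / b ^ k ≤ n₀ := by
  obtain ⟨k, hk⟩ := pow_unbounded_of_one_lt x hb
  refine ⟨k, (div_le_one_of_le₀ hk.le (by positivity)).trans h₀⟩

/-- Induction on the number of divisions by `b` that lead to a base case; `√a ≥ 1` propagates the
bound. -/
theorem one_le_of_recurrence (ha : 1 ≤ a) (hb : 1 < b) (h₀ : 1 ≤ n₀)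
    (hbase : ∀ x, x ≤ n₀ → 1 ≤ TQ x)
    (hrec : ∀ x, n₀ < x → TQ x = √a * TQ (x / b) + Taux x) (x : ℝ) : 1 ≤ TQ x := by
  have hs : 1 ≤ √(a : ℝ) := Real.one_le_sqrt.2 (by exact_mod_cast ha)
  obtain ⟨k, hk⟩ := exists_div_pow_le hb h₀ x
  induction k generalizing x with
  | zero => exact hbase x (by simpa using hk)
  | succ k ih =>
    by_cases hx : x ≤ n₀
    · exact hbase x hx
    · have := ih (x / b) (by rwa [div_div, ← pow_succ'])
      rw [hrec x (not_le.1 hx)]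
      have : (0 : ℝ) ≤ Taux x := Nat.cast_nonneg _
      nlinarith

/-- Going down a level does not increase the cost, so the length of every edge is bounded by `TQ n`.
-/
theorem recurrence_div_pow_le (ha : 1 ≤ a) (hb : 1 < b) (h₀ : 1 ≤ n₀)
    (hbase : ∀ x, x ≤ n₀ → 1 ≤ TQ x)
    (hrec : ∀ x, n₀ < x → TQ x = √a * TQ (x / b) + Taux x) (x : ℝ) {k : ℕ}
    (hk : ∀ j < k, n₀ < x / b ^ j) : TQ (x / b ^ k) ≤ TQ x := by
  have hs : 1 ≤ √(a : ℝ) := Real.one_le_sqrt.2 (by exact_mod_cast ha)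
  induction k with
  | zero => simp
  | succ k ih =>
    refine le_trans ?_ (ih fun j hj => hk j (by omega))
    rw [hrec _ (hk k (by omega)), div_div, ← pow_succ]
    have := one_le_of_recurrence ha hb h₀ hbase hrec (x / b ^ (k + 1))
    have : (0 : ℝ) ≤ Taux (x / b ^ k) := Nat.cast_nonneg _
    nlinarith

/-- Level `D - 1` is still above `n₀ ≥ 1`, whence `b ^ (D - 1) ≤ x`. -/
theorem depth_le (hb : 1 < b) (h₀ : 1 ≤ n₀) {x : ℝ} {D : ℕ}
    (hD : ∀ j < D, n₀ < x / b ^ j) : ((D : ℝ) - 1) * Real.log b ≤ Real.log x ∨ D = 0 := by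
  cases D with
  | zero => simp
  | succ D =>
    left
    have h := hD D (by omega)
    have hbD : 0 < b ^ D := by positivity
    rw [lt_div_iff₀ hbD] at h
    have h1 : b ^ D ≤ x := by nlinarith
    have h2 := Real.log_le_log hbD h1
    rw [Real.log_pow] at h2
    push_cast
    linarith

end Recurrence

/-! ### Choice of the parameters and final estimates. -/

theorem exists_pow_two_between {x : ℝ} (hx : 1 ≤ x) : ∃ κ : ℕ, x ≤ 2 ^ κ ∧ (2 : ℝ) ^ κ ≤ 2 * x := by
  obtain ⟨k, h1, h2⟩ := exists_nat_pow_near hx one_lt_two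
  refine ⟨k + 1, h2.le, ?_⟩
  rw [pow_succ]
  linarith

/-- The data of the circuit for instances of size `n`. -/
theorem exists_walkData {a : ℕ} (ha : 1 ≤ a) {b n₀ : ℝ} (hb : 1 < b) {Taux : ℝ → ℕ}
    {TQ : ℝ → ℝ} (h₀ : 1 ≤ n₀) (hT : ∀ x, 1 ≤ Taux x) (hbase : ∀ x, x ≤ n₀ → 1 ≤ TQ x)
    (hrec : ∀ x, n₀ < x → TQ x = √a * TQ (x / b) + Taux x) (n : ℝ) :
    ∃ (D κ w : ℕ) (L : ℕ → ℕ) (h₁ : a ≤ 2 ^ w) (h₂ : D + 1 < 2 ^ w) (h₃ : κ ≤ w)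
      (h₄ : ∀ k, L k < 2 ^ w) (h₅ : ∀ k, 1 ≤ L k), w = κ + a + D + 2 ∧
      12 * (a * TQ n) ≤ 2 ^ κ ∧ (2 : ℝ) ^ κ ≤ 24 * (a * TQ n) ∧
      WalkData.Fits ⟨a, D, κ, w, L, ha, h₁, h₂, h₃, h₄, h₅⟩ b n₀ Taux n := by
  classical
  have ha' : (1 : ℝ) ≤ a := by exact_mod_cast ha
  have hs : 1 ≤ √(a : ℝ) := Real.one_le_sqrt.2 ha'
  have hone := one_le_of_recurrence ha hb h₀ hbase hrec
  have hex := exists_div_pow_le hb h₀ n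
  obtain ⟨D, hD, hlt⟩ : ∃ D : ℕ, n / b ^ D ≤ n₀ ∧ ∀ j < D, n₀ < n / b ^ j :=
    ⟨Nat.find hex, Nat.find_spec hex, fun j hj => not_le.1 (Nat.find_min hex hj)⟩
  -- The squared norm of the wave will be at most `2 * √a * TQ n`, and `2 ^ κ` has to be at least
  -- six times that; `√a ≤ a` gives 12.
  obtain ⟨κ, hκ, hκ'⟩ := exists_pow_two_between (x := 12 * (a * TQ n)) (by nlinarith [hone n])
  have hlen : ∀ j < D, (Taux (n / b ^ j) : ℝ) ≤ TQ n := by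
    intro j hj
    refine le_trans ?_ (recurrence_div_pow_le ha hb h₀ hbase hrec n fun i hi => hlt i (hi.trans hj))
    rw [hrec _ (hlt j hj)]
    nlinarith [hone (n / b ^ j / b)]
  have hpow : ∀ m ≤ κ + a + D + 2, 2 ^ m ≤ 2 ^ (κ + a + D + 2) :=
    fun m hm => Nat.pow_le_pow_right (by norm_num) hm
  have hκw : 2 ^ κ < 2 ^ (κ + a + D + 2) := Nat.pow_lt_pow_right (by norm_num) (by omega)
  -- The width exceeds everything that has to fit into a register and is still logarithmic. The
  -- index is shifted because `L (k + 1)` belongs to level `k`; beyond the depth the value `1` keeps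
  -- lengths positive.
  refine ⟨D, κ, κ + a + D + 2, fun k => if k - 1 < D then Taux (n / b ^ (k - 1)) else 1,
    Nat.lt_two_pow_self.le.trans (hpow a (by omega)),
    Nat.lt_two_pow_self.trans_le (hpow (D + 1) (by omega)), by omega, fun k => ?_, fun k => ?_,
    rfl, hκ, by linarith, ?_⟩
  · beta_reduce
    split_ifs with hk
    · refine lt_of_le_of_lt ?_ hκw
      have h1 := hlen _ hk
      have : (Taux (n / b ^ (k - 1)) : ℝ) ≤ 2 ^ κ := by nlinarith [hone n]
      exact_mod_cast this
    · exact Nat.one_lt_two_pow (by omega)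
  · beta_reduce
    split_ifs
    · exact hT _
    · exact le_rfl
  · refine ⟨hlt, hD, fun k hk => ?_⟩
    simp only [Nat.add_sub_cancel]
    rw [if_pos hk]

theorem WalkData.Fits.bounded_error {G : WalkData} {b n₀ : ℝ} {Taux : ℝ → ℕ} {n : ℝ}
    {TQ : ℝ → ℝ} (hG : G.Fits b n₀ Taux n)
    (hone : ∀ x, 1 ≤ TQ x) (hrec : ∀ x, n₀ < x → TQ x = √G.a * TQ (x / b) + Taux x)
    (hκ : 12 * (G.a * TQ n) ≤ 2 ^ G.κ) {W : ℕ} (P : OrDivideConquer G.a b n₀ Taux W) (r : Desc W)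
    (hr : P.size r = n) :
    (P.answer r = true → 2 / 3 ≤ acceptProb P G.circuit (G.low .ctl) r) ∧
      (P.answer r = false → acceptProb P G.circuit (G.low .ctl) r ≤ 1 / 3) := by
  have ha : (1 : ℝ) ≤ G.a := by exact_mod_cast G.a_pos
  have hs : √(G.a : ℝ) ≤ G.a := by
    rw [Real.sqrt_le_left (by linarith)]
    nlinarith
  have hpos : (0 : ℝ) < 2 ^ G.w := by positivity
  obtain ⟨pre, mid, h, hE⟩ := exists_isWave (P := P) hG
    -- This solves the recursion for the squared norm with equality, by the recurrence of `TQ`.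
    (E := fun j => 2 * √G.a * TQ (n / b ^ j))
    (by have := hone (n / b ^ G.D); positivity)
    (fun j hj => by
      rw [hrec _ (hG.lt j hj), hG.length j hj, div_div, ← pow_succ]
      linarith)
    G.D ⟨0, by omega⟩ (by simp) (WalkData.initDesc r) (fun _ => 0) (fun k => by positivity)
    (fun k _ => rfl)
    (fun k hk => by
      have : (k : ℕ) ≠ 0 := fun h => by
        rw [Fin.lt_def] at hk
        simp [h] at hk
      simp [WalkData.initDesc, this])
    (by simp [WalkData.initDesc, hr])
  have e : (WalkData.initDesc r : Fin (G.D + 1) → Desc W) ⟨0, by omega⟩ = r := by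
    simp [WalkData.initDesc]
  rw [e] at h
  refine WalkData.acceptProb_circuit h ?_
  simp only [pow_zero, div_one] at hE
  nlinarith [hone n]

/-- The depth is controlled by `log n` and `κ` by `log T`; since `Λ ≥ log 2`, additive constants are
absorbed into multiples of `Λ`. -/
theorem polylog_bound {a : ℕ} (ha : 1 ≤ a) {b : ℝ} (hb : 1 < b) :
    ∃ c : ℝ, 0 ≤ c ∧ ∀ (n T Λ : ℝ) (D κ : ℕ), 2 ≤ n → 1 ≤ T → Λ = Real.log (n * T) →
      (2 : ℝ) ^ κ ≤ 24 * (a * T) → (((D : ℝ) - 1) * Real.log b ≤ Real.log n ∨ D = 0) →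
      ((D : ℝ) + 1) ≤ c * Λ ∧ ((κ + a + D + 2 : ℕ) : ℝ) ≤ c * Λ := by
  have hb' : 0 < Real.log b := Real.log_pos hb
  have h2 : 0 < Real.log 2 := Real.log_pos one_lt_two
  have ha' : (1 : ℝ) ≤ a := by exact_mod_cast ha
  have ha24 : 0 ≤ Real.log (24 * a) := Real.log_nonneg (by linarith)
  refine ⟨(Real.log 2)⁻¹ + (Real.log b)⁻¹ + (Real.log (24 * a) / Real.log 2 + a + 3) / Real.log 2,
    by positivity, fun n T Λ D κ hn hT hΛ hκ hD => ?_⟩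
  have hΛ' : Λ = Real.log n + Real.log T := by
    rw [hΛ, Real.log_mul (by linarith) (by linarith)]
  have hT0 := Real.log_nonneg hT
  have hn0 := Real.log_le_log two_pos hn
  have h2Λ : Real.log 2 ≤ Λ := by linarith
  have hconst : ∀ c : ℝ, 0 ≤ c → c ≤ c / Real.log 2 * Λ := fun c hc => by
    rw [div_mul_eq_mul_div, le_div_iff₀ h2]
    exact mul_le_mul_of_nonneg_left h2Λ hc
  have hD' : (D : ℝ) ≤ (Real.log b)⁻¹ * Λ + 1 := by
    rcases hD with h | h
    · rw [← le_div_iff₀ hb'] at h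
      have : Real.log n / Real.log b ≤ (Real.log b)⁻¹ * Λ := by
        rw [div_eq_inv_mul]
        exact mul_le_mul_of_nonneg_left (by linarith) (by positivity)
      linarith
    · have : 0 ≤ (Real.log b)⁻¹ * Λ := by
        have : 0 ≤ Λ := by linarith
        positivity
      rw [h, Nat.cast_zero]
      linarith
  have hκ' : (κ : ℝ) ≤ (Real.log 2)⁻¹ * Λ + Real.log (24 * a) / Real.log 2 := by
    have h := Real.log_le_log (by positivity) hκ
    rw [Real.log_pow, ← mul_assoc, Real.log_mul (by positivity) (by positivity)] at h
    rw [← div_eq_inv_mul, ← add_div, le_div_iff₀ h2]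
    linarith
  have hq : 0 ≤ Real.log (24 * a) / Real.log 2 := by positivity
  have h3 := hconst (Real.log (24 * a) / Real.log 2 + a + 3) (by positivity)
  have h4 : 0 ≤ (Real.log 2)⁻¹ * Λ := by
    have : 0 ≤ Λ := by linarith
    positivity
  rw [add_mul, add_mul]
  push_cast
  constructor <;> linarith

theorem mainTheorem5 (a : ℕ) (ha : 1 ≤ a) (b : ℝ) (hb : 1 < b) :
    ∃ (C : ℝ) (d : ℕ), ∀ (n₀ : ℝ) (Taux : ℝ → ℕ) (TQ : ℝ → ℝ),
      1 ≤ n₀ → (∀ x, 1 ≤ Taux x) →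
      (∀ x, x ≤ n₀ → 1 ≤ TQ x) →
      (∀ x, n₀ < x → TQ x = Real.sqrt a * TQ (x / b) + Taux x) →
      ∀ n : ℝ, 2 ≤ n →
        ∃ (N K : ℕ) (c : List (Gate N K)) (out : Fin N),
          (queryCount c : ℝ) ≤ C * (TQ n * Real.sqrt (Real.log n)) ∧
          (timeCount c : ℝ) ≤ C * (TQ n * Real.log (n * TQ n) ^ d) ∧
          ∀ (W : ℕ) (P : OrDivideConquer a b n₀ Taux W) (r : Desc W), P.size r = n →
            (P.answer r = true → 2 / 3 ≤ acceptProb P c out r) ∧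
            (P.answer r = false → acceptProb P c out r ≤ 1 / 3) := by
  obtain ⟨c, hc, hpoly⟩ := polylog_bound ha hb
  have h2 : 0 < Real.log 2 := Real.log_pos one_lt_two
  have ha' : (1 : ℝ) ≤ a := by exact_mod_cast ha
  -- The first summand is for the queries, `4 * 24 * a`, the second for the time. The exponent is 2
  -- because depth and width contribute one logarithm each.
  refine ⟨96 * a / √(Real.log 2) + 24 * a * (155 * (a + 1) * c ^ 2), 2, ?_⟩
  intro n₀ Taux TQ h₀ hT hbase hrec n hn
  have hone := one_le_of_recurrence ha hb h₀ hbase hrec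
  obtain ⟨D, κ, w, L, h₁, h₂, h₃, h₄, h₅, hw, hκ, hκ', hG⟩ :=
    exists_walkData ha hb h₀ hT hbase hrec n
  have hTn := hone n
  have hT0 : 0 ≤ TQ n := by linarith
  obtain ⟨hd1, hd2⟩ := hpoly n (TQ n) _ D κ hn hTn rfl hκ' (depth_le hb h₀ hG.lt)
  refine ⟨_, _, WalkData.circuit ⟨a, D, κ, w, L, ha, h₁, h₂, h₃, h₄, h₅⟩,
    WalkData.low ⟨a, D, κ, w, L, ha, h₁, h₂, h₃, h₄, h₅⟩ .ctl, ?_, ?_,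
    fun W P r hr => hG.bounded_error hone hrec hκ P r hr⟩
  · rw [WalkData.queryCount_circuit]
    push_cast
    -- The number of queries is already linear in `TQ n`; the factor `√(log n)` is only bounded from
    -- below by a constant.
    have hs : √(Real.log 2) ≤ √(Real.log n) :=
      Real.sqrt_le_sqrt (Real.log_le_log two_pos hn)
    have hs0 : 0 < √(Real.log 2) := Real.sqrt_pos.2 h2
    have e1 : 96 * (a * TQ n) ≤ 96 * a / √(Real.log 2) * (TQ n * √(Real.log n)) := by
      rw [div_mul_eq_mul_div, le_div_iff₀ hs0]
      have := mul_le_mul_of_nonneg_left hs (by positivity : 0 ≤ 96 * (a * TQ n))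
      linarith
    have e2 : 0 ≤ 24 * a * (155 * (a + 1) * c ^ 2) * (TQ n * √(Real.log n)) := by positivity
    rw [add_mul]
    linarith
  · have hl := WalkData.length_circuit_le (G := ⟨a, D, κ, w, L, ha, h₁, h₂, h₃, h₄, h₅⟩)
    have hl' : (timeCount (WalkData.circuit ⟨a, D, κ, w, L, ha, h₁, h₂, h₃, h₄, h₅⟩) : ℝ) ≤
        2 ^ κ * (155 * (D + 1) * (a + 1) * w) := by exact_mod_cast hl
    refine hl'.trans ?_
    rw [← hw] at hd2
    have e1 : ((D : ℝ) + 1) * w ≤ (c * Real.log (n * TQ n)) * (c * Real.log (n * TQ n)) :=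
      mul_le_mul hd1 hd2 (by positivity) (le_trans (by positivity) hd1)
    have e2 : 155 * ((D : ℝ) + 1) * (a + 1) * w ≤
        155 * (a + 1) * (c ^ 2 * Real.log (n * TQ n) ^ 2) := by
      have := mul_le_mul_of_nonneg_left e1 (by positivity : (0 : ℝ) ≤ 155 * (a + 1))
      nlinarith
    have e3 := mul_le_mul hκ' e2 (by positivity) (by positivity)
    have e4 : 0 ≤ 96 * a / √(Real.log 2) * (TQ n * Real.log (n * TQ n) ^ 2) := by positivity
    rw [add_mul]
    linarith
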